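/- Let $\mathbf{ECST}$ be elementary constructive set theory: intuitionistic predicate logic with equality in the language $\{\in\}$, with the axioms Extensionality, Pairing, Union, Restricted Separation, Replacement and Strong Infinity. Let $\mathrm{FPA}$ be the Finite Powers Axiom: for every set $S$ and every $n\in\omega$, the class $S^n$ of functions from $\{0,\dots,n-1\}$ to $S$ is a set. **Definitions** (in the language of set theory). A class $\mathcal C$ of subsets of a set is *set-generated* if there is a set $G\subseteq\mathcal C$ such that for all $\alpha\in\mathcal C$ and $x\in\alpha$ there is $\beta\in G$ with $x\in\beta\subseteq\alpha$. $\mathrm{NID}_{<\omega}$: for every set $S$ and every set $R$ of pairs $(a,b)$ of subsets of $S$ with $a$ finitely enumerable (i.e. the image of a function on some $n\in\omega$), the class of subsets $\alpha\subseteq S$ such that $a\subseteq\alpha$ implies that $b\cap\alpha$ is inhabited, for all $(a,b)\in R$, is set-generated. For a preordered set $(S,\le)$ and $U,V\subseteq S$ put $U\downarrow V=\{c\in S\mid \exists a\in U\,\exists b\in V\,(c\le a\wedge c\le b)\}$ and $a\downarrow b=\{a\}\downarrow\{b\}$. An *axiom-set* $(I,C)$ on $S$ consists of a family of sets $(I(a))_{a\in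 S}$ and a family of subsets $C(a,i)\subseteq S$ for $a\in S$, $i\in I(a)$. A *set-presented formal topology* is a preordered set $(S,\le)$ with an axiom-set $(I,C)$ on $S$ such that the relation $a\vartriangleleft U :\Leftrightarrow \exists i\in I(a)\,(C(a,i)\subseteq U)$, for $a\in S$ and $U\subseteq S$, satisfies for all $a,b\in S$ and $U,V\subseteq S$, where $U\vartriangleleft V$ means $\forall a\in U\,(a\vartriangleleft V)$: 1. $a\in U$ implies $a\vartriangleleft U$; 2. $a\vartriangleleft U$ and $U\vartriangleleft V$ imply $a\vartriangleleft V$; 3. $a\vartriangleleft U$ and $a\vartriangleleft V$ imply $a\vartriangleleft U\downarrow V$; 4. $a\le b$ implies $a\vartriangleleft\{b\}$. An *inductively generated formal topology* is identified with a preordered set $(T,\le')$ equipped with an axiom-set $(J,D)$ on $T$. A *formal topology map* from such an $\mathcal S=(S,\le,I,C)$ to such a $\mathcal T=(T,\le',J,D)$ is a relation $r\subseteq S\times T$ such that, writing $r^-U=\{a\in S\mid\exists b\in U\,(a\mathrel r b)\}$ and $r^-b=r^-\{b\}$, for all $b,b'\in T$: 1. $S\vartriangleleft r^-T$; 2. $r^-b\downarrow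 r^-b'\vartriangleleft r^-(b\downarrow' b')$; 3. $b\le' b'$ implies $r^-b\vartriangleleft r^-b'$; 4. $r^-b\vartriangleleft r^-D(b,j)$ for each $j\in J(b)$. **Proposition.** The following are equivalent over $\mathbf{ECST}+\mathrm{FPA}$, i.e. their equivalence is derivable in that theory: (i) $\mathrm{NID}_{<\omega}$; (ii) for every set-presented formal topology $\mathcal S$ and every inductively generated formal topology $\mathcal T$, the class of formal topology maps from $\mathcal S$ to $\mathcal T$ (a class of subsets of $S\times T$) is set-generated. -/

import Mathlib

namespace CST

/-! ## First-order formulas of the language of set theory -/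

/-- The context `V` extended by one new variable. -/
inductive Ext (V : Type) : Type
  | new : Ext V
  | old (v : V) : Ext V

/-- Older variables are silently read as variables of an extended context. -/
instance {V : Type} : Coe V (Ext V) := ⟨Ext.old⟩

/-- Extension of a map of contexts that fixes the new variable. -/
def Ext.map {V W : Type} (ρ : V → W) : Ext V → Ext W
  | .new => .new
  | .old v => .old (ρ v)

/-- Formulas with free variables in `V`, over the binary predicates `∈` and `=`. All connectives and
both quantifiers are primitive, as they have to be in intuitionistic logic. A quantifier binds the
new variable `.new` of `Ext V`; a variable `v : V` is written `.old v` in its scope. -/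
inductive Fml : Type → Type 1
  | bot {V : Type} : Fml V
  | mem {V : Type} (x y : V) : Fml V
  | eq {V : Type} (x y : V) : Fml V
  | and {V : Type} (φ ψ : Fml V) : Fml V
  | or {V : Type} (φ ψ : Fml V) : Fml V
  | imp {V : Type} (φ ψ : Fml V) : Fml V
  | all {V : Type} (φ : Fml (Ext V)) : Fml V
  | ex {V : Type} (φ : Fml (Ext V)) : Fml V

infix:70 " ∊ " => Fml.mem
infix:70 " ≐ " => Fml.eq
infixr:60 " ⋏ " => Fml.and
infixr:55 " ⋎ " => Fml.or
infixr:50 " ⟾ " => Fml.imp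

/-- Biconditional. -/
def Fml.iff {V : Type} (φ ψ : Fml V) : Fml V := (φ ⟾ ψ) ⋏ (ψ ⟾ φ)

infix:45 " ⟺ₛ " => Fml.iff

/-- Renaming of free variables (there are no terms but variables, so this is substitution). -/
def Fml.rename {V : Type} : Fml V → {W : Type} → (V → W) → Fml W
  | .bot, _, _ => .bot
  | .mem x y, _, ρ => .mem (ρ x) (ρ y)
  | .eq x y, _, ρ => .eq (ρ x) (ρ y)
  | .and φ ψ, _, ρ => .and (φ.rename ρ) (ψ.rename ρ)
  | .or φ ψ, _, ρ => .or (φ.rename ρ) (ψ.rename ρ)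
  | .imp φ ψ, _, ρ => .imp (φ.rename ρ) (ψ.rename ρ)
  | .all φ, _, ρ => .all (φ.rename (Ext.map ρ))
  | .ex φ, _, ρ => .ex (φ.rename (Ext.map ρ))

/-- Weakening: read a formula in a context with one more variable. -/
def Fml.weaken {V : Type} (φ : Fml V) : Fml (Ext V) := φ.rename Ext.old

/-- Instantiation `φ[x]` of the variable bound by a quantifier. -/
def Fml.inst {V : Type} (φ : Fml (Ext V)) (x : V) : Fml V := φ.rename fun | .new => x | .old v => v

/-- `∀ x, φ x`. Inside the body, older variables are coerced along `Ext.old`. -/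
def allF {V : Type} (φ : Ext V → Fml (Ext V)) : Fml V := .all (φ .new)

/-- `∃ x, φ x`. -/
def exF {V : Type} (φ : Ext V → Fml (Ext V)) : Fml V := .ex (φ .new)

/-- `∀ x ∈ a, φ x`. -/
def ballF {V : Type} (a : V) (φ : Ext V → Fml (Ext V)) : Fml V :=
  .all (.imp (.mem .new (.old a)) (φ .new))

/-- `∃ x ∈ a, φ x`. -/
def bexF {V : Type} (a : V) (φ : Ext V → Fml (Ext V)) : Fml V :=
  .ex (.and (.mem .new (.old a)) (φ .new))

/-- Restricted formulas: every quantifier occurs in the form `∀ x ∈ a` or `∃ x ∈ a`. -/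
inductive Fml.Restricted : {V : Type} → Fml V → Prop
  | bot {V : Type} : Restricted (.bot : Fml V)
  | mem {V : Type} (x y : V) : Restricted (x ∊ y)
  | eq {V : Type} (x y : V) : Restricted (x ≐ y)
  | and {V : Type} {φ ψ : Fml V} : Restricted φ → Restricted ψ → Restricted (φ ⋏ ψ)
  | or {V : Type} {φ ψ : Fml V} : Restricted φ → Restricted ψ → Restricted (φ ⋎ ψ)
  | imp {V : Type} {φ ψ : Fml V} : Restricted φ → Restricted ψ → Restricted (φ ⟾ ψ)
  | ball {V : Type} (a : V) {φ : Fml (Ext V)} : Restricted φ →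
      Restricted (.all (.mem .new (.old a) ⟾ φ))
  | bex {V : Type} (a : V) {φ : Fml (Ext V)} : Restricted φ →
      Restricted (.ex (.mem .new (.old a) ⋏ φ))

/-! ## Intuitionistic predicate logic with equality -/

/-- A theory: a set of axioms in every context `V`; free variables of axioms are parameters. -/
abbrev Theory := (V : Type) → Set (Fml V)

/-- Natural deduction for intuitionistic predicate logic with equality:
`Derives T Γ φ` says that `φ` is derivable from the axioms of `T` and the hypotheses `Γ`. -/
inductive Derives (T : Theory) : {V : Type} → List (Fml V) → Fml V → Prop
  | ax {V : Type} {Γ : List (Fml V)} {φ : Fml V} : φ ∈ T V → Derives T Γ φ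
  | hyp {V : Type} {Γ : List (Fml V)} {φ : Fml V} : φ ∈ Γ → Derives T Γ φ
  | botE {V : Type} {Γ : List (Fml V)} {φ : Fml V} : Derives T Γ .bot → Derives T Γ φ
  | andI {V : Type} {Γ : List (Fml V)} {φ ψ : Fml V} :
      Derives T Γ φ → Derives T Γ ψ → Derives T Γ (φ ⋏ ψ)
  | andE₁ {V : Type} {Γ : List (Fml V)} {φ ψ : Fml V} : Derives T Γ (φ ⋏ ψ) → Derives T Γ φ
  | andE₂ {V : Type} {Γ : List (Fml V)} {φ ψ : Fml V} : Derives T Γ (φ ⋏ ψ) → Derives T Γ ψ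
  | orI₁ {V : Type} {Γ : List (Fml V)} {φ ψ : Fml V} : Derives T Γ φ → Derives T Γ (φ ⋎ ψ)
  | orI₂ {V : Type} {Γ : List (Fml V)} {φ ψ : Fml V} : Derives T Γ ψ → Derives T Γ (φ ⋎ ψ)
  | orE {V : Type} {Γ : List (Fml V)} {φ ψ χ : Fml V} : Derives T Γ (φ ⋎ ψ) →
      Derives T (φ :: Γ) χ → Derives T (ψ :: Γ) χ → Derives T Γ χ
  | impI {V : Type} {Γ : List (Fml V)} {φ ψ : Fml V} :
      Derives T (φ :: Γ) ψ → Derives T Γ (φ ⟾ ψ)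
  | impE {V : Type} {Γ : List (Fml V)} {φ ψ : Fml V} :
      Derives T Γ (φ ⟾ ψ) → Derives T Γ φ → Derives T Γ ψ
  | allI {V : Type} {Γ : List (Fml V)} {φ : Fml (Ext V)} :
      Derives T (Γ.map Fml.weaken) φ → Derives T Γ (.all φ)
  | allE {V : Type} {Γ : List (Fml V)} {φ : Fml (Ext V)} (x : V) :
      Derives T Γ (.all φ) → Derives T Γ (φ.inst x)
  | exI {V : Type} {Γ : List (Fml V)} {φ : Fml (Ext V)} (x : V) :
      Derives T Γ (φ.inst x) → Derives T Γ (.ex φ)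
  | exE {V : Type} {Γ : List (Fml V)} {φ : Fml (Ext V)} {χ : Fml V} : Derives T Γ (.ex φ) →
      Derives T (φ :: Γ.map Fml.weaken) χ.weaken → Derives T Γ χ
  | eqI {V : Type} {Γ : List (Fml V)} (x : V) : Derives T Γ (x ≐ x)
  | eqE {V : Type} {Γ : List (Fml V)} {x y : V} (φ : Fml (Ext V)) :
      Derives T Γ (x ≐ y) → Derives T Γ (φ.inst x) → Derives T Γ (φ.inst y)
  /-- The domain of discourse is inhabited. -/
  | inhabited {V : Type} {Γ : List (Fml V)} : Derives T Γ (.ex (.eq .new .new))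

/-- The sentences `φ` and `ψ` are equivalent over the theory `T`. -/
def EquivalentOver (T : Theory) (φ ψ : Fml Empty) : Prop :=
  Derives T [] (φ ⟺ₛ ψ)

/-! ## Basic set-theoretic vocabulary -/

section vocabulary
variable {V : Type}

/-- `a ⊆ b`. -/
def subF (a b : V) : Fml V := ballF a fun x => x ∊ b

/-- `z = ∅`. -/
def isEmptyF (z : V) : Fml V := ballF z fun _ => .bot

/-- `y = x ∪ {x}`. -/
def isSuccF (y x : V) : Fml V := subF x y ⋏ x ∊ y ⋏ ballF y fun u => u ∊ x ⋎ u ≐ x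

/-- `0 ∈ a`, and `x + 1 ∈ a` for all `x ∈ a`. -/
def isInductiveF (a : V) : Fml V :=
  (bexF a fun z => isEmptyF z) ⋏ ballF a fun x => bexF a fun y => isSuccF y x

/-- `a = ω`. -/
def isOmegaF (a : V) : Fml V := isInductiveF a ⋏ allF fun y => isInductiveF y ⟾ subF a y

/-- `z = {x, y}`. -/
def isPairF (z x y : V) : Fml V := x ∊ z ⋏ y ∊ z ⋏ ballF z fun u => u ≐ x ⋎ u ≐ y

/-- `p = (x, y)`, the ordered pair `{{x}, {x, y}}`. -/
def isOPairF (p x y : V) : Fml V :=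
  bexF p fun s => bexF p fun t => isPairF s x x ⋏ isPairF t x y ⋏ isPairF p s t

/-- `(x, y) ∈ r`. -/
def relF (r x y : V) : Fml V := bexF r fun p => isOPairF p x y

/-- `r ⊆ a × b`. -/
def isRelF (r a b : V) : Fml V := ballF r fun p => bexF a fun x => bexF b fun y => isOPairF p x y

/-- `f` is a function from `a` to `b`. -/
def isFunF (f a b : V) : Fml V :=
  isRelF f a b ⋏ ballF a fun x => bexF b fun y => relF f x y ⋏ ballF b fun z => relF f x z ⟾ z ≐ y

/-- `f` is a surjection from `a` to `b`. -/
def isSurjF (f a b : V) : Fml V := isFunF f a b ⋏ ballF b fun y => bexF a fun x => relF f x y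

/-- `a` is finitely enumerable: there is a surjection from some `n = {0, …, n - 1} ∈ ω` to `a`. -/
def isFinEnumF (a : V) : Fml V :=
  exF fun w => isOmegaF w ⋏ bexF w fun n => exF fun f => isSurjF f n a

/-- `f` is a family indexed by `a`, that is, a function with domain `a`. -/
def isFamilyF (f a : V) : Fml V := exF fun b => isFunF f a b

end vocabulary

/-! ## The theory `ECST + FPA` -/

section axioms
variable {V : Type}

def extensionality : Fml V := allF fun a => allF fun b => (allF fun x => x ∊ a ⟺ₛ x ∊ b) ⟾ a ≐ b

def pairing : Fml V :=
  allF fun a => allF fun b => exF fun y => allF fun u => u ∊ y ⟺ₛ (u ≐ a ⋎ u ≐ b)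

def union : Fml V :=
  allF fun a => exF fun y => allF fun x => x ∊ y ⟺ₛ bexF a fun u => x ∊ u

/-- `∀ a ∃ b ∀ x (x ∈ b ↔ x ∈ a ∧ φ(x))`. In `φ` the variable `x` is `.new`, the variable `a` is
`.old .new`, and all other variables are parameters. -/
def separation (φ : Fml (Ext (Ext V))) : Fml V :=
  allF fun a => exF fun b => allF fun x => x ∊ b ⟺ₛ (x ∊ a ⋏ φ.rename (Ext.map Ext.old))

/-- `∀ a (∀ x ∈ a ∃! y φ(x, y) → ∃ b ∀ y (y ∈ b ↔ ∃ x ∈ a φ(x, y)))`. In `φ` the variable `y` is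
`.new`, `x` is `.old .new`, `a` is `.old (.old .new)`, and all other variables are parameters. -/
def replacement (φ : Fml (Ext (Ext (Ext V)))) : Fml V :=
  allF fun a =>
    (ballF a fun _ => exF fun y => φ ⋏ allF fun z => φ.rename (Ext.map Ext.old) ⟾ z ≐ y) ⟾
      exF fun b => allF fun y => y ∊ b ⟺ₛ bexF a fun x => φ.rename fun
        | .new => y
        | .old .new => x
        | .old (.old v) => .old (.old (.old v))

def strongInfinity : Fml V := exF fun a => isOmegaF a

/-- The Finite Powers Axiom: for all `S` and all `n ∈ ω`, the class of functions from
`n = {0, …, n - 1}` to `S` is a set. -/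
def finitePowers : Fml V :=
  allF fun w => isOmegaF w ⟾ allF fun S => ballF w fun n =>
    exF fun P => allF fun f => f ∊ P ⟺ₛ isFunF f n S

/-- Elementary constructive set theory. -/
inductive ECSTAxiom {V : Type} : Fml V → Prop
  | extensionality : ECSTAxiom extensionality
  | pairing : ECSTAxiom pairing
  | union : ECSTAxiom union
  | separation (φ : Fml (Ext (Ext V))) (hφ : φ.Restricted) : ECSTAxiom (separation φ)
  | replacement (φ : Fml (Ext (Ext (Ext V)))) : ECSTAxiom (replacement φ)
  | strongInfinity : ECSTAxiom strongInfinity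

end axioms

def ECST : Theory := fun _ => {φ | ECSTAxiom φ}

def ECST_FPA : Theory := fun V => ECST V ∪ {finitePowers}

/-! ## Set-generated classes and the finitary NID principle -/

section nid
variable {V : Type}

/-- The class `{α | φ α}` is set-generated: there is a set `G` of members of the class such that for
every member `α` and every `x ∈ α` there is `β ∈ G` with `x ∈ β ⊆ α`. -/
def setGeneratedF (φ : Ext V → Fml (Ext V)) : Fml V :=
  exF fun G =>
    (ballF G fun _ => (φ .new).rename (Ext.map Ext.old)) ⋏
    (allF fun α => (φ .new).rename (Ext.map Ext.old) ⟾
      ballF α fun x => bexF G fun β => x ∊ β ⋏ subF β α)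

/-- `R` is a set of finitary rules on `S`: a set of pairs `(a, b)` of subsets of `S` with `a` finitely
enumerable. -/
def isFinitaryRuleSetF (S R : V) : Fml V :=
  ballF R fun p => exF fun a => exF fun b =>
    isOPairF p a b ⋏ subF a S ⋏ subF b S ⋏ isFinEnumF a

/-- `α` is an `R`-closed subset of `S`: if `(a, b) ∈ R` and `a ⊆ α`, then `b` meets `α`. -/
def isClosedSubsetF (S R α : V) : Fml V :=
  subF α S ⋏ allF fun a => allF fun b => relF R a b ⟾ subF a α ⟾ bexF b fun y => y ∊ α

/-- The finitary principle of non-deterministic inductive definitions. -/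
def finitaryNID : Fml V :=
  allF fun S => allF fun R => isFinitaryRuleSetF S R ⟾
    setGeneratedF fun α => isClosedSubsetF S R α

end nid

/-! ## Formal topologies -/

section topology
variable {V : Type}

/-- `≤` is a preorder on the set `S`. -/
def isPreorderF (S le : V) : Fml V :=
  isRelF le S S ⋏ (ballF S fun a => relF le a a) ⋏
    (ballF S fun a => ballF S fun b => ballF S fun c => relF le a b ⟾ relF le b c ⟾ relF le a c)

/-- `i ∈ I(a)`, for a family `I`: some `p ∈ I` is a pair `(a, J)` with `i ∈ J`. Since `J` is an
element of the element `{a, J}` of `p`, all quantifiers can be bounded. -/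
def memFamF (I a i : V) : Fml V :=
  bexF I fun p => bexF p fun t => bexF t fun J => isOPairF p a J ⋏ i ∊ J

/-- `∃ i ∈ I(a), φ i`, for a family `I`. -/
def exFamF (I a : V)
    (φ : Ext (Ext (Ext (Ext V))) → Fml (Ext (Ext (Ext (Ext V))))) :
    Fml V :=
  bexF I fun p => bexF p fun t => bexF t fun J => isOPairF p a J ⋏ bexF J φ

/-- `c ∈ C(a, i)`, for a family `C` of sets indexed by pairs: some `p ∈ C` is a pair `((a, i), U)`
with `c ∈ U`. -/
def memFam₂F (C a i c : V) : Fml V :=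
  bexF C fun p => bexF p fun t => bexF t fun q => bexF t fun U =>
    isOPairF q a i ⋏ isOPairF p q U ⋏ c ∊ U

/-- `D = {(a, i) | a ∈ S, i ∈ I(a)}`. -/
def isSigmaF (D S I : V) : Fml V :=
  (ballF D fun p => bexF S fun a => exFamF I a fun i => isOPairF p a i) ⋏
    (ballF S fun a => allF fun i => memFamF I a i ⟾ bexF D fun p => isOPairF p a i)

/-- `(I, C)` is an axiom-set on `S`: a family `(I(a))` of sets indexed by `a ∈ S`, and a family
`(C(a, i))` of subsets of `S` indexed by the pairs `(a, i)` with `a ∈ S` and `i ∈ I(a)`. -/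
def isAxiomSetF (S I C : V) : Fml V :=
  isFamilyF I S ⋏ (exF fun D => isSigmaF D S I ⋏ isFamilyF C D) ⋏
    (allF fun a => allF fun i => allF fun c => memFam₂F C a i c ⟾ c ∊ S)

/-- `a ◁ {c ∈ S | φ c}` for the relation presented by `(I, C)`:
there is `i ∈ I(a)` with `C(a, i) ⊆ {c ∈ S | φ c}`. -/
def coverF (S I C a : V)
    (φ : Ext (Ext (Ext (Ext (Ext V)))) →
      Fml (Ext (Ext (Ext (Ext (Ext V)))))) : Fml V :=
  exFamF I a fun i => ballF S fun c => memFam₂F C a i c ⟾ φ c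

/-- `(S, ≤, ◁)` is a formal topology with set-presentation `(I, C)`, i.e. `(S, ≤)` is a preordered
set, `(I, C)` is an axiom-set on `S`, and the relation `a ◁ U` given by `∃ i ∈ I(a), C(a, i) ⊆ U`
makes `(S, ≤, ◁)` a formal topology. -/
def isSetPresentedFTopF (S le I C : V) : Fml V :=
  isPreorderF S le ⋏ isAxiomSetF S I C ⋏
  -- `a ∈ U` implies `a ◁ U`
  (allF fun U => subF U S ⟾ ballF U fun a => coverF S I C a fun c => c ∊ U) ⋏
  -- `a ◁ U` and `U ◁ W` imply `a ◁ W`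
  (allF fun U => allF fun W => subF U S ⟾ subF W S ⟾ ballF S fun a =>
    (coverF S I C a fun c => c ∊ U) ⟾
    (ballF U fun b => coverF S I C b fun c => c ∊ W) ⟾
      coverF S I C a fun c => c ∊ W) ⋏
  -- `a ◁ U` and `a ◁ W` imply `a ◁ U ↓ W`
  (allF fun U => allF fun W => subF U S ⟾ subF W S ⟾ ballF S fun a =>
    (coverF S I C a fun c => c ∊ U) ⟾
    (coverF S I C a fun c => c ∊ W) ⟾
      coverF S I C a fun c => bexF U fun u => bexF W fun w => relF le c u ⋏ relF le c w) ⋏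
  -- `a ≤ b` implies `a ◁ {b}`
  (ballF S fun a => ballF S fun b => relF le a b ⟾ coverF S I C a fun c => c ≐ b)

/-- `r` is a formal topology map from the formal topology on `(S, ≤)` with set-presentation `(I, C)`
to the formal topology on `(T, ≤')` inductively generated by the axiom-set `(J, D)`. Here
`c ∈ r⁻ U` means that `(c, d) ∈ r` for some `d ∈ U`. -/
def isFTopMapF (S le I C T le' J D r : V) : Fml V :=
  isRelF r S T ⋏
  -- `S ◁ r⁻ T`
  (ballF S fun a => coverF S I C a fun c => bexF T fun d => relF r c d) ⋏
  -- `r⁻ b₁ ↓ r⁻ b₂ ◁ r⁻ (b₁ ↓' b₂)`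
  (ballF T fun b₁ => ballF T fun b₂ => ballF S fun a =>
    (bexF S fun x => bexF S fun y =>
      relF r x b₁ ⋏ relF r y b₂ ⋏ relF le a x ⋏ relF le a y) ⟾
    coverF S I C a fun c => bexF T fun d => relF le' d b₁ ⋏ relF le' d b₂ ⋏ relF r c d) ⋏
  -- `b₁ ≤' b₂` implies `r⁻ b₁ ◁ r⁻ b₂`
  (ballF T fun b₁ => ballF T fun b₂ => relF le' b₁ b₂ ⟾ ballF S fun a => relF r a b₁ ⟾
    coverF S I C a fun c => relF r c b₂) ⋏
  -- `r⁻ b ◁ r⁻ D(b, j)` for each `j ∈ J(b)`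
  (ballF T fun b => allF fun j => memFamF J b j ⟾ ballF S fun a => relF r a b ⟾
    coverF S I C a fun c => bexF T fun d => memFam₂F D b j d ⋏ relF r c d)

/-- For every set-presented formal topology and every inductively generated one, given by a preorder
`(T, ≤')` with an axiom-set `(J, D)`, the class of formal topology maps from the former to the
latter is set-generated. -/
def formalTopologyMapsSetGenerated : Fml V :=
  allF fun S => allF fun le => allF fun I => allF fun C =>
  allF fun T => allF fun le' => allF fun J => allF fun D =>
    isSetPresentedFTopF S le I C ⟾ isPreorderF T le' ⟾ isAxiomSetF T J D ⟾
      setGeneratedF fun r => isFTopMapF S le I C T le' J D r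

end topology

end CST

/-!
# The finitary NID principle and set-generated classes of formal topology maps

Intuitionistic derivability is shown to be complete for Kripke models whose domains carry an equality
congruence. The two principles are then compared at the worlds of a Kripke model of `ECST + FPA`.
A formal topology is built from the finitely enumerable subsets for one implication; for the other,
formal topology maps are described by finitary rules on pairs together with tagged choices of
indices.
-/

namespace CST

/-! ## Renaming -/

/-! Derivability is replaced by forcing. By `derives_of_forall_sat`, a sentence forced at every
world of every Kripke model of the theory is derivable, so it suffices to fix such a model and to
show that each principle, forced at a world, makes the other one forced there. The metatheory is
classical. Inside the model, however, every set must be produced by an axiom of the theory (`IsSet`,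
`isSet_restr`, `isSet_bex`), every induction needs a restricted formula, and disjunctions and
existentials are available only where they are forced.

From maps to NID (`finitaryNID_of_maps`): given finitary rules R on S, take as source the one-point
topology. As target take the set of finitely enumerable subsets of S under reverse inclusion, where
a rule (a, b) becomes the axiom that a is covered by the singletons {y} with y in b. A closed α
gives the map relating the point to all u ⊆ α (`IsRuleTopology.map_of_closed`). Conversely, the
union of all u related to the point by a map is closed (`IsRuleTopology.closed_of_map`). A
generating set of maps is carried by the second operation to a generating set of closed subsets. The
Finite Powers Axiom is what makes the finitely enumerable subsets form a set.

From NID to maps (`maps_of_finitaryNID`): each clause defining a map r is a family of requests of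
the form "if the finite set P is included in r, then a ◁ r⁻U" (`frc_isFTopMapF_iff_meetsRequests`).
Unfolded, the conclusion says that some i ∈ I(a) is such that every c ∈ C(a,i) has some d ∈ U with
(c,d) ∈ r. This is an ∃∀∃ statement, while the conclusion of an NID rule is a mere ∃. So the carrier
S × T is enlarged by markers (t,i,a,U), each promising that the index i works for a and U. One kind
of rule leads from P to some marker with i ∈ I(a). The other leads from a single marker, for each c
∈ C(a,i), to some pair (c,d) with d ∈ U. The trace on S × T of a closed set is a map, and a map
together with all markers whose promise it keeps is closed, with the map as its trace. Hence the
traces of a generating set generate the maps (`setGenerated_meetsRequests`). -/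

theorem Ext.map_id {V : Type} : Ext.map (id : V → V) = id := by
  funext x; cases x <;> rfl

theorem Ext.map_comp {V W X : Type} (g : W → X) (f : V → W) :
    Ext.map g ∘ Ext.map f = Ext.map (g ∘ f) := by
  funext x; cases x <;> rfl

theorem Fml.rename_id {V : Type} (φ : Fml V) : φ.rename id = φ := by
  induction φ with
  | bot | mem | eq => rfl
  | and φ ψ ih₁ ih₂ | or φ ψ ih₁ ih₂ | imp φ ψ ih₁ ih₂ => simp only [rename, ih₁, ih₂]
  | all φ ih | ex φ ih => simp only [rename, Ext.map_id, ih]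

theorem Fml.rename_rename {V W X : Type} (φ : Fml V) (f : V → W) (g : W → X) :
    (φ.rename f).rename g = φ.rename (g ∘ f) := by
  induction φ generalizing W X with
  | bot | mem | eq => rfl
  | and φ ψ ih₁ ih₂ | or φ ψ ih₁ ih₂ | imp φ ψ ih₁ ih₂ => simp only [rename, ih₁, ih₂]
  | all φ ih | ex φ ih => simp only [rename, Ext.map_comp, ih]

theorem Fml.rename_inst {V W : Type} (φ : Fml (Ext V)) (x : V) (f : V → W) :
    (φ.inst x).rename f = (φ.rename (Ext.map f)).inst (f x) := by
  simp only [inst, rename_rename]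
  congr 1; funext v; cases v <;> rfl

theorem Fml.rename_weaken {V W : Type} (φ : Fml V) (f : V → W) :
    φ.weaken.rename (Ext.map f) = (φ.rename f).weaken := by
  simp only [weaken, rename_rename]; rfl

theorem Fml.Restricted.rename {V W : Type} {φ : Fml V} (h : φ.Restricted) (f : V → W) :
    (φ.rename f).Restricted := by
  induction h generalizing W with
  | bot => exact .bot
  | mem => exact .mem _ _
  | eq => exact .eq _ _
  | and _ _ ih₁ ih₂ => exact .and (ih₁ f) (ih₂ f)
  | or _ _ ih₁ ih₂ => exact .or (ih₁ f) (ih₂ f)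
  | imp _ _ ih₁ ih₂ => exact .imp (ih₁ f) (ih₂ f)
  | ball a _ ih => exact .ball (f a) (ih _)
  | bex a _ ih => exact .bex (f a) (ih _)

/-- A theory is stable if its axioms are closed under renaming of parameters. -/
def Theory.Stable (T : Theory) : Prop :=
  ∀ {V W : Type} (f : V → W) {φ : Fml V}, φ ∈ T V → φ.rename f ∈ T W

theorem rename_separation {V W : Type} (φ : Fml (Ext (Ext V))) (f : V → W) :
    (separation φ).rename f = separation (φ.rename (Ext.map (Ext.map f))) := by
  simp only [separation, allF, exF, Fml.rename, Fml.iff, Fml.rename_rename, Ext.map_comp]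
  rfl

theorem rename_replacement {V W : Type} (φ : Fml (Ext (Ext (Ext V)))) (f : V → W) :
    (replacement φ).rename f = replacement (φ.rename (Ext.map (Ext.map (Ext.map f)))) := by
  simp only [replacement, allF, exF, ballF, bexF, Fml.rename, Fml.iff, Fml.rename_rename,
    Ext.map_comp]
  have : ∀ (g h : Ext (Ext (Ext V)) → Ext (Ext (Ext (Ext W)))), g = h →
    φ.rename g = φ.rename h := fun g h e => by rw [e]
  congr 9
  all_goals funext x; rcases x with _ | _ | _ | _ <;> rfl

/-- The schemes commute with renaming, up to renaming the instance, and renaming preserves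
restrictedness. The remaining axioms have no parameters. -/
theorem ECST_FPA_stable : ECST_FPA.Stable := by
  intro V W f φ h
  rcases h with h | h
  · left
    cases h with
    | extensionality => exact .extensionality
    | pairing => exact .pairing
    | union => exact .union
    | separation φ hφ => rw [rename_separation]; exact .separation _ (hφ.rename _)
    | replacement φ => rw [rename_replacement]; exact .replacement _
    | strongInfinity => exact .strongInfinity
  · right
    cases h; rfl

/-! ## Structural rules -/

/-- Stability is used only for axioms. The lemma serves to turn a fresh name into a bound variable
and, at the end, to discard names altogether. -/
theorem Derives.rename {T : Theory} (hT : T.Stable) {V W : Type} {Γ : List (Fml V)} {φ : Fml V}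
    (h : Derives T Γ φ) (f : V → W) : Derives T (Γ.map (·.rename f)) (φ.rename f) := by
  induction h generalizing W with
  | ax h => exact .ax (hT f h)
  | hyp h => exact .hyp (List.mem_map_of_mem h)
  | botE _ ih => exact .botE (ih f)
  | andI _ _ ih₁ ih₂ => exact .andI (ih₁ f) (ih₂ f)
  | andE₁ _ ih => exact .andE₁ (ih f)
  | andE₂ _ ih => exact .andE₂ (ih f)
  | orI₁ _ ih => exact .orI₁ (ih f)
  | orI₂ _ ih => exact .orI₂ (ih f)
  | orE _ _ _ ih₁ ih₂ ih₃ => exact .orE (ih₁ f) (ih₂ f) (ih₃ f)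
  | impI _ ih => exact .impI (ih f)
  | impE _ _ ih₁ ih₂ => exact .impE (ih₁ f) (ih₂ f)
  | allI _ ih =>
    refine .allI ?_
    simpa only [List.map_map, Function.comp_def, Fml.rename_weaken] using ih (Ext.map f)
  | allE x _ ih => rw [Fml.rename_inst]; exact .allE (f x) (ih f)
  | exI x _ ih => exact .exI (f x) (by rw [← Fml.rename_inst]; exact ih f)
  | exE _ _ ih₁ ih₂ =>
    refine .exE (ih₁ f) ?_
    simpa only [List.map_map, Function.comp_def, Fml.rename_weaken, List.map_cons] using
      ih₂ (Ext.map f)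
  | eqI x => exact .eqI _
  | eqE φ _ _ ih₁ ih₂ =>
    rw [Fml.rename_inst]
    exact .eqE _ (ih₁ f) (by rw [← Fml.rename_inst]; exact ih₂ f)
  | inhabited => exact .inhabited

theorem Derives.weaken {T : Theory} {V : Type} {Γ Δ : List (Fml V)} {φ : Fml V}
    (h : Derives T Γ φ) (hΔ : Γ ⊆ Δ) : Derives T Δ φ := by
  induction h with
  | ax h => exact .ax h
  | hyp h => exact .hyp (hΔ h)
  | botE _ ih => exact .botE (ih hΔ)
  | andI _ _ ih₁ ih₂ => exact .andI (ih₁ hΔ) (ih₂ hΔ)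
  | andE₁ _ ih => exact .andE₁ (ih hΔ)
  | andE₂ _ ih => exact .andE₂ (ih hΔ)
  | orI₁ _ ih => exact .orI₁ (ih hΔ)
  | orI₂ _ ih => exact .orI₂ (ih hΔ)
  | orE _ _ _ ih₁ ih₂ ih₃ =>
    exact .orE (ih₁ hΔ) (ih₂ (List.cons_subset_cons _ hΔ)) (ih₃ (List.cons_subset_cons _ hΔ))
  | impI _ ih => exact .impI (ih (List.cons_subset_cons _ hΔ))
  | impE _ _ ih₁ ih₂ => exact .impE (ih₁ hΔ) (ih₂ hΔ)
  | allI _ ih => exact .allI (ih (List.map_subset _ hΔ))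
  | allE x _ ih => exact .allE x (ih hΔ)
  | exI x _ ih => exact .exI x (ih hΔ)
  | exE _ _ ih₁ ih₂ =>
    exact .exE (ih₁ hΔ) (ih₂ (List.cons_subset_cons _ (List.map_subset _ hΔ)))
  | eqI x => exact .eqI _
  | eqE φ _ _ ih₁ ih₂ => exact .eqE φ (ih₁ hΔ) (ih₂ hΔ)
  | inhabited => exact .inhabited

/-! ## Supports of formulas -/

/-- The extension of a predicate on variables which holds for the new variable. -/
def Ext.lift {V : Type} (D : V → Prop) : Ext V → Prop
  | .new => True
  | .old v => D v

/-- All free variables of the formula satisfy `D`. -/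
def Fml.Over : {V : Type} → Fml V → (V → Prop) → Prop
  | _, .bot, _ => True
  | _, .mem x y, D => D x ∧ D y
  | _, .eq x y, D => D x ∧ D y
  | _, .and φ ψ, D => φ.Over D ∧ ψ.Over D
  | _, .or φ ψ, D => φ.Over D ∧ ψ.Over D
  | _, .imp φ ψ, D => φ.Over D ∧ ψ.Over D
  | _, .all φ, D => φ.Over (Ext.lift D)
  | _, .ex φ, D => φ.Over (Ext.lift D)

theorem Fml.Over.rename {V W : Type} {φ : Fml V} {D : V → Prop} {D' : W → Prop} {f : V → W}
    (h : φ.Over D) (hf : ∀ v, D v → D' (f v)) : (φ.rename f).Over D' := by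
  induction φ generalizing W with
  | bot => trivial
  | mem | eq => exact ⟨hf _ h.1, hf _ h.2⟩
  | and φ ψ ih₁ ih₂ | or φ ψ ih₁ ih₂ | imp φ ψ ih₁ ih₂ => exact ⟨ih₁ h.1 hf, ih₂ h.2 hf⟩
  | all φ ih | ex φ ih => exact ih h fun v hv => by cases v <;> [trivial; exact hf _ hv]

theorem Fml.Over.mono {V : Type} {φ : Fml V} {D D' : V → Prop} (h : φ.Over D)
    (hD : ∀ v, D v → D' v) : φ.Over D' := by
  simpa only [rename_id] using h.rename (f := id) hD

theorem Fml.over_of_forall {V : Type} (φ : Fml V) {D : V → Prop} (hD : ∀ v, D v) :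
    φ.Over D := by
  induction φ with
  | bot => trivial
  | mem | eq => exact ⟨hD _, hD _⟩
  | and φ ψ ih₁ ih₂ | or φ ψ ih₁ ih₂ | imp φ ψ ih₁ ih₂ => exact ⟨ih₁ hD, ih₂ hD⟩
  | all φ ih | ex φ ih => exact ih fun v => by cases v <;> [trivial; exact hD _]

theorem Fml.Over.rename_congr {V W : Type} {φ : Fml V} {D : V → Prop} {f g : V → W}
    (h : φ.Over D) (hfg : ∀ v, D v → f v = g v) : φ.rename f = φ.rename g := by
  induction φ generalizing W with
  | bot => rfl
  | mem | eq => simp only [Fml.rename, hfg _ h.1, hfg _ h.2]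
  | and φ ψ ih₁ ih₂ | or φ ψ ih₁ ih₂ | imp φ ψ ih₁ ih₂ =>
    simp only [Fml.rename, ih₁ h.1 hfg, ih₂ h.2 hfg]
  | all φ ih | ex φ ih =>
    simp only [Fml.rename]
    rw [ih h fun v hv => ?_]
    cases v <;> [rfl; exact congrArg _ (hfg _ hv)]

/-- Only finitely many variables are free in a formula. A numerical bound on them is enough to find
an unused name. -/
theorem Fml.exists_over_lt {V : Type} (φ : Fml V) (f : V → ℕ) :
    ∃ N, φ.Over fun v => f v < N := by
  induction φ with
  | bot => exact ⟨0, trivial⟩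
  | mem x y | eq x y =>
    exact ⟨max (f x) (f y) + 1, Nat.lt_succ_of_le (le_max_left _ _),
      Nat.lt_succ_of_le (le_max_right _ _)⟩
  | and φ ψ ih₁ ih₂ | or φ ψ ih₁ ih₂ | imp φ ψ ih₁ ih₂ =>
    obtain ⟨N₁, h₁⟩ := ih₁ f
    obtain ⟨N₂, h₂⟩ := ih₂ f
    exact ⟨max N₁ N₂, h₁.mono fun v hv => hv.trans_le (le_max_left _ _),
      h₂.mono fun v hv => hv.trans_le (le_max_right _ _)⟩
  | all φ ih | ex φ ih =>
    obtain ⟨N, h⟩ := ih fun | .new => 0 | .old v => f v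
    exact ⟨N, h.mono fun v hv => by cases v <;> [trivial; exact hv]⟩

theorem exists_over_lt_of_list {V : Type} (L : List (Fml V)) (f : V → ℕ) :
    ∃ N, ∀ φ ∈ L, φ.Over fun v => f v < N := by
  induction L with
  | nil => exact ⟨0, by simp⟩
  | cons φ L ih =>
    obtain ⟨N₁, h₁⟩ := φ.exists_over_lt f
    obtain ⟨N₂, h₂⟩ := ih
    refine ⟨max N₁ N₂, fun ψ hψ => ?_⟩
    rcases List.mem_cons.1 hψ with rfl | hψ
    · exact h₁.mono fun v hv => hv.trans_le (le_max_left _ _)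
    · exact (h₂ ψ hψ).mono fun v hv => hv.trans_le (le_max_right _ _)

/-! ## Countability of the language -/

/-- A numerical code of a formula, relative to codes of its free variables. -/
def Fml.code : {V : Type} → Fml V → (V → ℕ) → ℕ
  | _, .bot, _ => Nat.pair 0 0
  | _, .mem x y, f => Nat.pair 1 (Nat.pair (f x) (f y))
  | _, .eq x y, f => Nat.pair 2 (Nat.pair (f x) (f y))
  | _, .and φ ψ, f => Nat.pair 3 (Nat.pair (φ.code f) (ψ.code f))
  | _, .or φ ψ, f => Nat.pair 4 (Nat.pair (φ.code f) (ψ.code f))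
  | _, .imp φ ψ, f => Nat.pair 5 (Nat.pair (φ.code f) (ψ.code f))
  | _, .all φ, f => Nat.pair 6 (φ.code fun | .new => 0 | .old v => f v + 1)
  | _, .ex φ, f => Nat.pair 7 (φ.code fun | .new => 0 | .old v => f v + 1)

/-- Under a quantifier the codes of old variables are shifted by one, which frees 0 for the bound
variable. The resulting countability allows all formulas to be enumerated in `exists_world`. -/
theorem Fml.code_injective {V : Type} (f : V → ℕ) (hf : Function.Injective f) :
    Function.Injective fun φ : Fml V => φ.code f := by
  have hext : ∀ {V : Type} {f : V → ℕ}, Function.Injective f → Function.Injective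
      (fun | .new => 0 | .old v => f v + 1 : Ext V → ℕ) := by
    intro V f hf x y h
    cases x <;> cases y <;> simp_all [hf.eq_iff]
  intro φ ψ h
  induction φ with
  | bot => cases ψ <;> simp_all [code, Nat.pair_eq_pair]
  | mem | eq => cases ψ <;> simp_all [code, Nat.pair_eq_pair, hf.eq_iff]
  | and φ₁ φ₂ ih₁ ih₂ | or φ₁ φ₂ ih₁ ih₂ | imp φ₁ φ₂ ih₁ ih₂ =>
    cases ψ <;> simp only [code, Nat.pair_eq_pair] at h <;> try omega
    rw [ih₁ f hf h.2.1, ih₂ f hf h.2.2]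
  | all φ ih | ex φ ih =>
    cases ψ <;> simp only [code, Nat.pair_eq_pair] at h <;> try omega
    rw [ih _ (hext hf) h.2]

instance {V : Type} [Countable V] : Countable (Fml V) := by
  obtain ⟨f, hf⟩ := exists_injective_nat V
  exact (Fml.code_injective f hf).countable

/-! ## Kripke models -/

/-- A Kripke structure for the language of set theory with equality. The elements that exist at a
world `w` are those with `dom w x`. -/
class Kripke (W : Type 1) (M : outParam Type) extends Preorder W where
  dom : W → M → Prop
  mem : W → M → M → Prop
  eq : W → M → M → Prop
  dom_mono {w w' : W} {x : M} : w ≤ w' → dom w x → dom w' x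
  mem_mono {w w' : W} {x y : M} : w ≤ w' → mem w x y → mem w' x y
  eq_mono {w w' : W} {x y : M} : w ≤ w' → eq w x y → eq w' x y
  dom_of_mem {w : W} {x y : M} : mem w x y → dom w x ∧ dom w y
  dom_of_eq {w : W} {x y : M} : eq w x y → dom w x ∧ dom w y
  eq_refl {w : W} {x : M} : dom w x → eq w x x
  eq_symm {w : W} {x y : M} : eq w x y → eq w y x
  eq_trans {w : W} {x y z : M} : eq w x y → eq w y z → eq w x z
  mem_congr {w : W} {x x' y y' : M} : eq w x x' → eq w y y' → mem w x y → mem w x' y'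

/-- Extension of an assignment by a value of the new variable. -/
def cons {V M : Type} (ρ : V → M) (x : M) : Ext V → M
  | .new => x
  | .old v => ρ v

@[simp] theorem cons_new {V M : Type} (ρ : V → M) (x : M) : cons ρ x .new = x := rfl

@[simp] theorem cons_old {V M : Type} (ρ : V → M) (x : M) (v : V) :
    cons ρ x (.old v) = ρ v := rfl

theorem cons_comp_map {V U M : Type} (ρ : U → M) (f : V → U) (x : M) :
    cons ρ x ∘ Ext.map f = cons (ρ ∘ f) x := by
  funext v; cases v <;> rfl

section forcing
variable {W : Type 1} {M : Type} [K : Kripke W M]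

/-- The formula is forced at the world under the assignment. -/
def Sat : {V : Type} → W → Fml V → (V → M) → Prop
  | _, _, .bot, _ => False
  | _, w, .mem x y, ρ => K.mem w (ρ x) (ρ y)
  | _, w, .eq x y, ρ => K.eq w (ρ x) (ρ y)
  | _, w, .and φ ψ, ρ => Sat w φ ρ ∧ Sat w ψ ρ
  | _, w, .or φ ψ, ρ => Sat w φ ρ ∨ Sat w ψ ρ
  | _, w, .imp φ ψ, ρ => ∀ w', w ≤ w' → Sat w' φ ρ → Sat w' ψ ρ
  | _, w, .all φ, ρ => ∀ w', w ≤ w' → ∀ x, K.dom w' x → Sat w' φ (cons ρ x)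
  | _, w, .ex φ, ρ => ∃ x, K.dom w x ∧ Sat w φ (cons ρ x)

theorem Sat.up {V : Type} {w w' : W} {φ : Fml V} {ρ : V → M} (h : Sat w φ ρ) (hw : w ≤ w') :
    Sat w' φ ρ := by
  induction φ with
  | bot => exact h
  | mem => exact K.mem_mono hw h
  | eq => exact K.eq_mono hw h
  | and φ ψ ih₁ ih₂ => exact ⟨ih₁ h.1, ih₂ h.2⟩
  | or φ ψ ih₁ ih₂ => exact h.imp ih₁ ih₂
  | imp => exact fun v hv => h v (hw.trans hv)
  | all => exact fun v hv => h v (hw.trans hv)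
  | ex φ ih => obtain ⟨x, hx, h⟩ := h; exact ⟨x, K.dom_mono hw hx, ih h⟩

theorem sat_rename {V U : Type} (w : W) (φ : Fml V) (f : V → U) (ρ : U → M) :
    Sat w (φ.rename f) ρ ↔ Sat w φ (ρ ∘ f) := by
  induction φ generalizing U w with
  | bot | mem | eq => rfl
  | and φ ψ ih₁ ih₂ => exact and_congr (ih₁ _ _ _) (ih₂ _ _ _)
  | or φ ψ ih₁ ih₂ => exact or_congr (ih₁ _ _ _) (ih₂ _ _ _)
  | imp φ ψ ih₁ ih₂ => simp only [Fml.rename, Sat, ih₁, ih₂]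
  | all φ ih | ex φ ih => simp only [Fml.rename, Sat, ih, cons_comp_map]

/-- Equality is interpreted by a congruence on names rather than by identity, so invariance of
formulas under it has to be proved. Persistence of equality carries the argument through
implications and universal quantifiers. -/
theorem Sat.congr {V : Type} {w : W} {φ : Fml V} {ρ ρ' : V → M} (h : Sat w φ ρ)
    (hρ : ∀ v, K.eq w (ρ v) (ρ' v)) : Sat w φ ρ' := by
  have hcons : ∀ {V : Type} {w : W} {ρ ρ' : V → M} {x : M}, (∀ v, K.eq w (ρ v) (ρ' v)) →
      K.dom w x → ∀ v, K.eq w (cons ρ x v) (cons ρ' x v) := by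
    intro V w ρ ρ' x hρ hx v
    cases v <;> [exact K.eq_refl hx; exact hρ _]
  induction φ generalizing w with
  | bot => exact h
  | mem => exact K.mem_congr (hρ _) (hρ _) h
  | eq x y => exact K.eq_trans (K.eq_symm (hρ x)) (K.eq_trans h (hρ y))
  | and φ ψ ih₁ ih₂ => exact ⟨ih₁ h.1 hρ, ih₂ h.2 hρ⟩
  | or φ ψ ih₁ ih₂ => exact h.imp (ih₁ · hρ) (ih₂ · hρ)
  | imp φ ψ ih₁ ih₂ =>
    exact fun v hv h' => ih₂ (h v hv (ih₁ h' fun u => K.eq_symm (K.eq_mono hv (hρ u))))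
      fun u => K.eq_mono hv (hρ u)
  | all φ ih =>
    exact fun v hv x hx => ih (h v hv x hx) (hcons (fun u => K.eq_mono hv (hρ u)) hx)
  | ex φ ih => obtain ⟨x, hx, h⟩ := h; exact ⟨x, hx, ih h (hcons hρ hx)⟩

end forcing

/-- All axioms of the theory are forced at all worlds. -/
def Models (W : Type 1) {M : Type} [K : Kripke W M] (T : Theory) : Prop :=
  ∀ (w : W) {V : Type} {φ : Fml V} {ρ : V → M}, φ ∈ T V → (∀ v, K.dom w (ρ v)) → Sat w φ ρ

/-! ## Provability from a set of formulas -/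

/-- `φ` is derivable from finitely many formulas of the set `Γ`. -/
def Prov (T : Theory) {V : Type} (Γ : Set (Fml V)) (φ : Fml V) : Prop :=
  ∃ L : List (Fml V), (∀ ψ ∈ L, ψ ∈ Γ) ∧ Derives T L φ

namespace Prov
variable {T : Theory} {V : Type} {Γ Δ : Set (Fml V)} {φ ψ χ : Fml V}

theorem of_mem (h : φ ∈ Γ) : Prov T Γ φ := ⟨[φ], by simpa using h, .hyp (by simp)⟩

theorem of_derives (h : Derives T [] φ) : Prov T Γ φ := ⟨[], by simp, h⟩

theorem mono (h : Prov T Γ φ) (hΓ : Γ ⊆ Δ) : Prov T Δ φ :=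
  h.imp fun _ hL => ⟨fun ψ hψ => hΓ (hL.1 ψ hψ), hL.2⟩

theorem map₂ (h₁ : Prov T Γ φ) (h₂ : Prov T Γ ψ)
    (H : ∀ {L}, Derives T L φ → Derives T L ψ → Derives T L χ) : Prov T Γ χ := by
  obtain ⟨L₁, hL₁, d₁⟩ := h₁
  obtain ⟨L₂, hL₂, d₂⟩ := h₂
  refine ⟨L₁ ++ L₂, fun ψ hψ => (List.mem_append.1 hψ).elim (hL₁ ψ) (hL₂ ψ),
    H (d₁.weaken (by simp)) (d₂.weaken (by simp))⟩

theorem map (h : Prov T Γ φ) (H : ∀ {L}, Derives T L φ → Derives T L χ) : Prov T Γ χ :=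
  map₂ h h fun d _ => H d

/-- All copies of ψ are filtered out of the finite list of hypotheses, and one is put at its head,
ready to be discharged. -/
theorem exists_cons (h : Prov T (insert ψ Γ) φ) :
    ∃ L : List (Fml V), (∀ χ ∈ L, χ ∈ Γ) ∧ Derives T (ψ :: L) φ := by
  classical
  obtain ⟨L, hL, d⟩ := h
  refine ⟨L.filter (· ≠ ψ), fun χ hχ => ?_, d.weaken fun χ hχ => ?_⟩
  · simp only [ne_eq, decide_not, List.mem_filter, Bool.not_eq_eq_eq_not, Bool.not_true,
      decide_eq_false_iff_not] at hχ
    exact (hL χ hχ.1).resolve_left hχ.2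
  · by_cases h : χ = ψ <;> simp [h, hχ]

theorem imp (h : Prov T (insert ψ Γ) φ) : Prov T Γ (ψ ⟾ φ) := by
  obtain ⟨L, hL, d⟩ := h.exists_cons
  exact ⟨L, hL, .impI d⟩

theorem cut (h : Prov T (insert ψ Γ) φ) (h' : Prov T Γ ψ) : Prov T Γ φ :=
  map₂ h.imp h' .impE

theorem or_elim (h : Prov T Γ (φ ⋎ ψ)) (h₁ : Prov T (insert φ Γ) χ)
    (h₂ : Prov T (insert ψ Γ) χ) : Prov T Γ χ := by
  obtain ⟨L, hL, d⟩ := map₂ h₁.imp h₂.imp .andI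
  obtain ⟨L', hL', d'⟩ := h
  refine ⟨L' ++ L, fun ψ hψ => (List.mem_append.1 hψ).elim (hL' ψ) (hL ψ),
    .orE (d'.weaken (by simp)) (.impE (d.andE₁.weaken ?_) (.hyp (by simp)))
      (.impE (d.andE₂.weaken ?_) (.hyp (by simp)))⟩ <;>
  exact fun x hx => by simp [hx]

end Prov

/-! ## Fresh variables -/

open Classical in
/-- The renaming that turns the variable `c` into the new variable. -/
noncomputable def abstractVar {V : Type} (c v : V) : Ext V := if v = c then .new else .old v

theorem Fml.Over.rename_abstractVar {V : Type} {c : V} {φ : Fml V} (h : φ.Over (· ≠ c)) :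
    φ.rename (abstractVar c) = φ.weaken :=
  h.rename_congr fun _ hv => if_neg hv

theorem Fml.Over.inst_rename_abstractVar {V : Type} {c : V} {φ : Fml (Ext V)}
    (h : φ.Over (Ext.lift (· ≠ c))) : (φ.inst c).rename (abstractVar c) = φ := by
  rw [Fml.inst, Fml.rename_rename]
  conv_rhs => rw [← φ.rename_id]
  refine h.rename_congr fun v hv => ?_
  rcases v with _ | v
  · exact if_pos rfl
  · exact if_neg hv

theorem map_rename_abstractVar {V : Type} {c : V} {Γ : List (Fml V)}
    (hΓ : ∀ ψ ∈ Γ, ψ.Over (· ≠ c)) : Γ.map (·.rename (abstractVar c)) = Γ.map Fml.weaken :=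
  List.map_congr_left fun ψ hψ => (hΓ ψ hψ).rename_abstractVar

/-- Renaming c to the new variable leaves Γ merely weakened and restores φ, because c occurs in
neither; then `allI` applies. The existential version below is the same with `exE`. -/
theorem Derives.all_of_fresh {T : Theory} (hT : T.Stable) {V : Type} {c : V} {Γ : List (Fml V)}
    {φ : Fml (Ext V)} (hΓ : ∀ ψ ∈ Γ, ψ.Over (· ≠ c)) (hφ : φ.Over (Ext.lift (· ≠ c)))
    (h : Derives T Γ (φ.inst c)) : Derives T Γ (.all φ) := by
  have := h.rename hT (abstractVar c)
  rw [hφ.inst_rename_abstractVar, map_rename_abstractVar hΓ] at this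
  exact .allI this

theorem Derives.ex_of_fresh {T : Theory} (hT : T.Stable) {V : Type} {c : V} {Γ : List (Fml V)}
    {φ : Fml (Ext V)} {χ : Fml V} (hΓ : ∀ ψ ∈ Γ, ψ.Over (· ≠ c))
    (hφ : φ.Over (Ext.lift (· ≠ c))) (hχ : χ.Over (· ≠ c)) (hex : Derives T Γ (.ex φ))
    (h : Derives T (φ.inst c :: Γ) χ) : Derives T Γ χ := by
  have := h.rename hT (abstractVar c)
  rw [List.map_cons, hφ.inst_rename_abstractVar, map_rename_abstractVar hΓ,
    hχ.rename_abstractVar] at this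
  exact .exE hex this

/-! ## The canonical model -/

/-- Variables of the canonical model; those of rank less than `k` exist at level `k`. -/
abbrev Name := ℕ × ℕ

/-- A saturated theory in the language with the names of rank less than `level`. -/
structure World (T : Theory) : Type 1 where
  level : ℕ
  thy : Set (Fml Name)
  support {φ} : φ ∈ thy → φ.Over (·.1 < level)
  closed {φ} : φ.Over (·.1 < level) → Prov T thy φ → φ ∈ thy
  consistent : Fml.bot ∉ thy
  prime {φ ψ} : (φ ⋎ ψ) ∈ thy → φ ∈ thy ∨ ψ ∈ thy
  henkin {φ} : Fml.ex φ ∈ thy → ∃ c : Name, c.1 < level ∧ φ.inst c ∈ thy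

theorem Fml.Over.lift_inst {V : Type} {φ : Fml (Ext V)} {D : V → Prop} {c : V}
    (h : φ.Over (Ext.lift D)) (hc : D c) : (φ.inst c).Over D :=
  h.rename fun v hv => by cases v <;> [exact hc; exact hv]

/-- One stage of the saturation: e is added if this does not make χ provable, and an existential e
is added together with a witness. All of rank k is reserved for such witnesses, so there are
infinitely many candidates. -/
theorem lindenbaum_step {T : Theory} (hT : T.Stable) {k : ℕ} {Γ : Set (Fml Name)} {χ : Fml Name}
    (hΓ : ∀ γ ∈ Γ, γ.Over (·.1 < k)) (hχ : χ.Over (·.1 < k))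
    (L : List (Fml Name)) (hL : ∀ ψ ∈ L, ψ.Over (·.1 < k + 1))
    (hLχ : ¬ Prov T (Γ ∪ {ψ | ψ ∈ L}) χ) (e : Fml Name) :
    ∃ L' : List (Fml Name), ((∀ ψ ∈ L', ψ.Over (·.1 < k + 1)) ∧
      ¬ Prov T (Γ ∪ {ψ | ψ ∈ L'}) χ) ∧ L ⊆ L' ∧
      (e.Over (·.1 < k + 1) → ¬ Prov T (insert e (Γ ∪ {ψ | ψ ∈ L})) χ → e ∈ L' ∧
        ∀ φ, e = .ex φ → ∃ c : Name, c.1 < k + 1 ∧ φ.inst c ∈ L') := by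
  by_cases he : e.Over (·.1 < k + 1) ∧ ¬ Prov T (insert e (Γ ∪ {ψ | ψ ∈ L})) χ
  swap
  · exact ⟨L, ⟨hL, hLχ⟩, List.Subset.refl _, fun h₁ h₂ => absurd ⟨h₁, h₂⟩ he⟩
  obtain ⟨he, heχ⟩ := he
  have hins : ∀ (ψ : Fml Name) (K : List (Fml Name)),
      Γ ∪ {x | x ∈ ψ :: K} = insert ψ (Γ ∪ {x | x ∈ K}) := by
    intro ψ K; ext; simp; tauto
  by_cases hex : ∃ φ, e = .ex φ
  swap
  · refine ⟨e :: L, ⟨List.forall_mem_cons.2 ⟨he, hL⟩, by rwa [hins]⟩, by simp, fun _ _ => ⟨by simp, ?_⟩⟩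
    exact fun φ hφ => absurd ⟨φ, hφ⟩ hex
  obtain ⟨φ, rfl⟩ := hex
  -- The witness will be (k, N). Its rank k keeps it out of Γ and χ, and its second coordinate keeps
  -- it out of e and of the finitely many formulas added so far.
  obtain ⟨N, hN⟩ := exists_over_lt_of_list (.ex φ :: L) Prod.snd
  have hφ : φ.Over (Ext.lift fun v : Name => v.2 < N) := hN _ List.mem_cons_self
  have hne : ∀ v : Name, v.2 < N → v ≠ (k, N) := by rintro v h rfl; exact lt_irrefl _ h
  have hne' : ∀ v : Name, v.1 < k → v ≠ (k, N) := by rintro v h rfl; exact lt_irrefl _ h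
  refine ⟨φ.inst (k, N) :: .ex φ :: L, ⟨?_, ?_⟩, fun x hx => by simp [hx], fun _ _ => ⟨by simp, ?_⟩⟩
  · intro ψ hψ
    rcases List.mem_cons.1 hψ with rfl | hψ
    · exact Fml.Over.lift_inst he k.lt_succ_self
    · rcases List.mem_cons.1 hψ with rfl | hψ
      exacts [he, hL _ hψ]
  · rw [hins, hins]
    intro h
    obtain ⟨K, hK, d⟩ := h.exists_cons
    refine heχ ⟨.ex φ :: K, fun ψ hψ => (List.mem_cons.1 hψ).elim (by rintro rfl; simp) (hK ψ), ?_⟩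
    refine Derives.ex_of_fresh hT (c := (k, N)) ?_ ?_ (hχ.mono hne') (.hyp List.mem_cons_self)
      (d.weaken fun x hx => ?_)
    · intro ψ hψ
      have hψ : ψ ∈ insert (Fml.ex φ) (Γ ∪ {x | x ∈ L}) :=
        (List.mem_cons.1 hψ).elim (by rintro rfl; simp) (hK ψ)
      rcases hψ with rfl | hψ | hψ
      · exact (hN _ List.mem_cons_self).mono hne
      · exact (hΓ _ hψ).mono hne'
      · exact (hN _ (List.mem_cons_of_mem _ hψ)).mono hne
    · exact hφ.mono fun v hv => by cases v <;> [trivial; exact hne _ hv]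
    · rcases List.mem_cons.1 hx with rfl | hx <;> simp [*]
  · rintro φ' h
    cases h
    exact ⟨(k, N), k.lt_succ_self, by simp⟩

/-- Every set of formulas that does not prove `χ` extends to a saturated theory without `χ`. -/
theorem exists_world {T : Theory} (hT : T.Stable) {k : ℕ} {Γ : Set (Fml Name)} {χ : Fml Name}
    (hΓ : ∀ γ ∈ Γ, γ.Over (·.1 < k)) (hχ : χ.Over (·.1 < k)) (hΓχ : ¬ Prov T Γ χ) :
    ∃ w : World T, w.level = k + 1 ∧ Γ ⊆ w.thy ∧ χ ∉ w.thy := by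
  have : Nonempty (Fml Name) := ⟨.bot⟩
  obtain ⟨e, he⟩ := exists_surjective_nat (Fml Name)
  let P : List (Fml Name) → Prop := fun L => (∀ ψ ∈ L, ψ.Over (·.1 < k + 1)) ∧
    ¬ Prov T (Γ ∪ {ψ | ψ ∈ L}) χ
  have step : ∀ (n : ℕ) (L : {L // P L}), ∃ L' : {L // P L}, L.1 ⊆ L'.1 ∧
      ((e n).Over (·.1 < k + 1) → ¬ Prov T (insert (e n) (Γ ∪ {ψ | ψ ∈ L.1})) χ → e n ∈ L'.1 ∧
        ∀ φ, e n = .ex φ → ∃ c : Name, c.1 < k + 1 ∧ φ.inst c ∈ L'.1) := by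
    rintro n ⟨L, hL⟩
    obtain ⟨L', hL', h⟩ := lindenbaum_step hT hΓ hχ L hL.1 hL.2 (e n)
    exact ⟨⟨L', hL'⟩, h⟩
  choose f hf hfe using step
  let L : ℕ → {L // P L} := Nat.rec ⟨[], by simp [P, hΓχ]⟩ f
  have hLmono : ∀ {m n}, m ≤ n → (L m).1 ⊆ (L n).1 := by
    intro m n h
    induction h with
    | refl => exact List.Subset.refl _
    | step _ ih => exact List.Subset.trans ih (hf _ _)
  let Δ : Set (Fml Name) := Γ ∪ {ψ | ∃ n, ψ ∈ (L n).1}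
  have hΔ : ∀ ψ ∈ Δ, ψ.Over (·.1 < k + 1) := by
    rintro ψ (h | ⟨n, h⟩)
    · exact (hΓ ψ h).mono fun v hv => Nat.lt_succ_of_lt hv
    · exact (L n).2.1 ψ h
  -- A derivation uses finitely many hypotheses, hence only those present at some finite stage.
  have hΔχ : ¬ Prov T Δ χ := by
    rintro ⟨K, hK, d⟩
    have : ∃ n, ∀ ψ ∈ K, ψ ∈ Γ ∪ {ψ | ψ ∈ (L n).1} := by
      clear d
      induction K with
      | nil => exact ⟨0, by simp⟩
      | cons ψ K ih =>
        obtain ⟨n, hn⟩ := ih fun x hx => hK x (List.mem_cons_of_mem _ hx)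
        obtain ⟨m, hm⟩ : ∃ m, ψ ∈ Γ ∪ {ψ | ψ ∈ (L m).1} := by
          rcases hK ψ List.mem_cons_self with h | ⟨m, h⟩
          exacts [⟨0, .inl h⟩, ⟨m, .inr h⟩]
        refine ⟨max m n, fun x hx => ?_⟩
        rcases List.mem_cons.1 hx with rfl | hx
        · exact hm.imp id fun h => hLmono (le_max_left _ _) h
        · exact (hn x hx).imp id fun h => hLmono (le_max_right _ _) h
    obtain ⟨n, hn⟩ := this
    exact (L n).2.2 ⟨K, hn, d⟩
  -- Maximality: if ψ is compatible with Δ, it was compatible with the smaller theory at the stage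
  -- where it was enumerated, and was added there with its witness. Closure, primeness and the
  -- Henkin property all follow from this.
  have hmax : ∀ {ψ : Fml Name}, ψ.Over (·.1 < k + 1) → ¬ Prov T (insert ψ Δ) χ →
      ψ ∈ Δ ∧ ∀ φ, ψ = .ex φ → ∃ c : Name, c.1 < k + 1 ∧ φ.inst c ∈ Δ := by
    intro ψ hψ h
    obtain ⟨n, rfl⟩ := he ψ
    obtain ⟨h₁, h₂⟩ := hfe n (L n) hψ fun h' => h (h'.mono (Set.insert_subset_insert
      (Set.union_subset_union_right _ fun x hx => ⟨n, hx⟩)))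
    refine ⟨.inr ⟨n + 1, h₁⟩, fun φ hφ => ?_⟩
    obtain ⟨c, hc, h₃⟩ := h₂ φ hφ
    exact ⟨c, hc, .inr ⟨n + 1, h₃⟩⟩
  have hclosed : ∀ {ψ : Fml Name}, ψ.Over (·.1 < k + 1) → Prov T Δ ψ → ψ ∈ Δ :=
    fun hψ h => (hmax hψ fun h' => hΔχ (h'.cut h)).1
  refine ⟨⟨k + 1, Δ, hΔ _, hclosed, ?_, ?_, ?_⟩, rfl, Set.subset_union_left, ?_⟩
  · exact fun h => hΔχ ((Prov.of_mem h).map .botE)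
  · intro φ ψ h
    by_contra! hn
    have h₁ : Prov T (insert φ Δ) χ := by_contra fun h' => hn.1 (hmax (hΔ _ h).1 h').1
    have h₂ : Prov T (insert ψ Δ) χ := by_contra fun h' => hn.2 (hmax (hΔ _ h).2 h').1
    exact hΔχ ((Prov.of_mem h).or_elim h₁ h₂)
  · intro φ h
    exact (hmax (hΔ _ h) fun h' => hΔχ (h'.cut (.of_mem h))).2 φ rfl
  · exact fun h => hΔχ (.of_mem h)

variable {T : Theory}

theorem World.mem_of_derives (w : World T) {φ : Fml Name} (hφ : φ.Over (·.1 < w.level))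
    (h : Derives T [] φ) : φ ∈ w.thy :=
  w.closed hφ (.of_derives h)

theorem World.eq_inst (w : World T) {x y : Name} (φ : Fml (Ext Name)) (hxy : (x ≐ y) ∈ w.thy)
    (hφ : (φ.inst y).Over (·.1 < w.level)) (h : φ.inst x ∈ w.thy) : φ.inst y ∈ w.thy :=
  w.closed hφ (Prov.map₂ (.of_mem hxy) (.of_mem h) fun d₁ d₂ => .eqE φ d₁ d₂)

/-- Later worlds have larger theories and larger levels, so more names exist. The laws of equality
are instances of `eqE`, available because each theory is deductively closed in its own language. -/
instance : Kripke (World T) Name where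
  le w w' := w.level ≤ w'.level ∧ w.thy ⊆ w'.thy
  le_refl w := ⟨le_rfl, Set.Subset.rfl⟩
  le_trans _ _ _ h h' := ⟨h.1.trans h'.1, h.2.trans h'.2⟩
  dom w x := x.1 < w.level
  mem w x y := (x ∊ y) ∈ w.thy
  eq w x y := (x ≐ y) ∈ w.thy
  dom_mono h h' := h'.trans_le h.1
  mem_mono h h' := h.2 h'
  eq_mono h h' := h.2 h'
  dom_of_mem {w _ _} h := w.support h
  dom_of_eq {w _ _} h := w.support h
  eq_refl {w x} h := w.mem_of_derives ⟨h, h⟩ (.eqI x)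
  eq_symm {w x y} h := w.eq_inst (.new ≐ .old x) h (w.support h).symm
    (w.mem_of_derives ⟨(w.support h).1, (w.support h).1⟩ (.eqI x))
  eq_trans {w x y z} h h' := w.eq_inst (.old x ≐ .new) h' ⟨(w.support h).1, (w.support h').2⟩ h
  mem_congr {w x x' y y'} hx hy h :=
    w.eq_inst (.old x' ∊ .new) hy ⟨(w.support hx).2, (w.support hy).2⟩
      (w.eq_inst (.new ∊ .old y) hx ⟨(w.support hx).2, (w.support hy).1⟩ h)

theorem rename_cons {V : Type} (φ : Fml (Ext V)) (ρ : V → Name) (c : Name) :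
    φ.rename (cons ρ c) = (φ.rename (Ext.map ρ)).inst c := by
  rw [Fml.inst, Fml.rename_rename]
  congr 1; funext v; cases v <;> rfl

/-- Forcing in the canonical model is membership in the saturated theory. -/
theorem sat_iff_mem (hT : T.Stable) {V : Type} (φ : Fml V) (w : World T) (ρ : V → Name)
    (hρ : ∀ v, (ρ v).1 < w.level) : Sat w φ ρ ↔ φ.rename ρ ∈ w.thy := by
  have hover : ∀ {V : Type} {w : World T} {ρ : V → Name} (φ : Fml V),
      (∀ v, (ρ v).1 < w.level) → (φ.rename ρ).Over (·.1 < w.level) := fun φ hρ =>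
    (φ.over_of_forall (D := fun _ => True) fun _ => trivial).rename fun v _ => hρ v
  have hcons : ∀ {V : Type} {w : World T} {ρ : V → Name} {c : Name},
      (∀ v, (ρ v).1 < w.level) → c.1 < w.level → ∀ v, (cons ρ c v).1 < w.level :=
    fun hρ hc v => by cases v <;> [exact hc; exact hρ _]
  have hup : ∀ {V : Type} {w w' : World T} {ρ : V → Name}, w ≤ w' →
      (∀ v, (ρ v).1 < w.level) → ∀ v, (ρ v).1 < w'.level :=
    fun hw hρ v => (hρ v).trans_le hw.1
  induction φ generalizing w with
  | bot => exact ⟨False.elim, w.consistent⟩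
  | mem | eq => rfl
  | and φ ψ ih₁ ih₂ =>
    refine (and_congr (ih₁ w ρ hρ) (ih₂ w ρ hρ)).trans ⟨fun h => ?_, fun h => ⟨?_, ?_⟩⟩
    · exact w.closed (hover (φ ⋏ ψ) hρ) (Prov.map₂ (.of_mem h.1) (.of_mem h.2) .andI)
    · exact w.closed (hover φ hρ) ((Prov.of_mem h).map .andE₁)
    · exact w.closed (hover ψ hρ) ((Prov.of_mem h).map .andE₂)
  | or φ ψ ih₁ ih₂ =>
    refine (or_congr (ih₁ w ρ hρ) (ih₂ w ρ hρ)).trans ⟨?_, w.prime⟩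
    rintro (h | h)
    · exact w.closed (hover (φ ⋎ ψ) hρ) ((Prov.of_mem h).map .orI₁)
    · exact w.closed (hover (φ ⋎ ψ) hρ) ((Prov.of_mem h).map .orI₂)
  | imp φ ψ ih₁ ih₂ =>
    refine ⟨fun h => by_contra fun hn => ?_, fun h w' hw' h' => ?_⟩
    · have hn' : ¬ Prov T (insert (φ.rename ρ) w.thy) (ψ.rename ρ) := fun h' =>
        hn (w.closed (hover (φ ⟾ ψ) hρ) h'.imp)
      -- If the implication is missing, its premise together with the present theory does not prove
      -- its conclusion, and saturating them yields a later world that refutes the implication.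
      obtain ⟨w', hlev, hsub, hψ⟩ := exists_world hT (k := w.level)
        (by rintro γ (rfl | hγ) <;> [exact hover φ hρ; exact w.support hγ]) (hover ψ hρ) hn'
      have hw : w ≤ w' := ⟨hlev ▸ Nat.le_succ _, (Set.subset_insert _ _).trans hsub⟩
      refine hψ ((ih₂ w' ρ (hup hw hρ)).1 (h w' hw ((ih₁ w' ρ (hup hw hρ)).2 ?_)))
      exact hsub (Set.mem_insert _ _)
    · have h' := (ih₁ w' ρ (hup hw' hρ)).1 h'
      exact (ih₂ w' ρ (hup hw' hρ)).2 (w'.closed (hover ψ (hup hw' hρ))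
        (Prov.map₂ (.of_mem (hw'.2 h)) (.of_mem h') .impE))
  | all φ ih =>
    refine ⟨fun h => by_contra fun hn => ?_, fun h w' hw' c hc => ?_⟩
    · have hφ : (φ.rename (Ext.map ρ)).Over (Ext.lift fun v : Name => v.1 < w.level) :=
        hover (.all φ) hρ
      -- This name does not exist at w, hence is fresh for its theory, but it has rank below w.level
      -- + 1. The counterexample about c is therefore saturated with k one higher than in the case
      -- of implication.
      let c : Name := (w.level, 0)
      have hne : ∀ v : Name, v.1 < w.level → v ≠ c := by rintro v h rfl; exact lt_irrefl _ h
      have hn' : ¬ Prov T w.thy ((φ.rename (Ext.map ρ)).inst c) := by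
        rintro ⟨L, hL, d⟩
        refine hn (w.closed hφ ⟨L, hL, d.all_of_fresh hT (fun ψ hψ =>
          (w.support (hL ψ hψ)).mono hne) ?_⟩)
        exact hφ.mono fun v hv => by
          cases v <;> [trivial; exact hne _ hv]
      obtain ⟨w', hlev, hsub, hψ⟩ := exists_world hT (k := w.level + 1)
        (fun γ hγ => (w.support hγ).mono fun v hv => Nat.lt_succ_of_lt hv)
        (Fml.Over.lift_inst (D := fun v : Name => v.1 < w.level + 1) (hφ.mono fun v hv => by
            cases v <;> [trivial; exact Nat.lt_succ_of_lt hv]) w.level.lt_succ_self) hn'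
      have hw : w ≤ w' := ⟨by omega, hsub⟩
      have hc : c.1 < w'.level := by simp only [c]; omega
      refine hψ ?_
      rw [← rename_cons]
      exact (ih w' _ (hcons (hup hw hρ) hc)).1 (h w' hw c hc)
    · refine (ih w' _ (hcons (hup hw' hρ) hc)).2 ?_
      rw [rename_cons]
      refine w'.closed ?_ ((Prov.of_mem (hw'.2 h)).map (.allE c))
      rw [← rename_cons]
      exact hover φ (hcons (hup hw' hρ) hc)
  | ex φ ih =>
    refine ⟨fun ⟨c, hc, h⟩ => ?_, fun h => ?_⟩
    · have h := (ih w _ (hcons hρ hc)).1 h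
      rw [rename_cons] at h
      exact w.closed (hover (.ex φ) hρ) ((Prov.of_mem h).map (.exI c))
    · obtain ⟨c, hc, h⟩ := w.henkin h
      exact ⟨c, hc, (ih w _ (hcons hρ hc)).2 (by rw [rename_cons]; exact h)⟩

theorem models_world (hT : T.Stable) : Models (World T) T := by
  intro w V φ ρ hφ hρ
  refine (sat_iff_mem hT φ w ρ hρ).2 ?_
  exact w.mem_of_derives ((φ.over_of_forall (D := fun _ => True) fun _ => trivial).rename
    fun v _ => hρ v) (.ax (hT ρ hφ))

/-- A sentence forced in all Kripke models of a theory is derivable from it. -/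
theorem derives_of_forall_sat (hT : T.Stable) {φ : Fml Empty}
    (h : ∀ (W : Type 1) (M : Type) [Kripke W M], Models W T →
      ∀ (w : W) (ρ : Empty → M), Sat w φ ρ) : Derives T [] φ := by
  have hname : Derives T [] (φ.rename (Empty.elim : Empty → Name)) := by
    by_contra hn
    obtain ⟨w, -, -, hw⟩ := exists_world hT (k := 0) (Γ := ∅) (χ := φ.rename Empty.elim) (by simp)
      ((φ.over_of_forall (D := fun _ => True) fun _ => trivial).rename fun v => v.elim) (by
        rintro ⟨L, hL, d⟩
        exact hn (d.weaken fun x hx => (hL x hx).elim))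
    exact hw ((sat_iff_mem hT φ w _ fun v => v.elim).1 (h _ _ (models_world hT) w _))
  -- The derivation just obtained may mention names. All of them are collapsed to a single variable,
  -- which is then eliminated by the inhabitedness of the domain.
  have := hname.rename hT (fun _ => Ext.new : Name → Ext Empty)
  rw [Fml.rename_rename, show _ ∘ _ = Ext.old from funext fun v => v.elim] at this
  exact .exE (φ := .eq .new .new) .inhabited (this.weaken (by simp))

/-! ## Forcing of formulas with parameters -/

section forcing
variable {W : Type 1} {M : Type} [K : Kripke W M]

/-- The formula `φ` with parameters in the model is forced at `w`. -/
def Frc (w : W) (φ : Fml M) : Prop := Sat w φ id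

infix:44 " ⊩ " => Frc

/-- The element `x` exists at the world `w`. -/
def Dom (w : W) (x : M) : Prop := K.dom w x

theorem Frc.up {w w' : W} {φ : Fml M} (h : w ⊩ φ) (hw : w ≤ w') : w' ⊩ φ := Sat.up h hw

theorem Dom.up {w w' : W} {x : M} (h : Dom w x) (hw : w ≤ w') : Dom w' x := K.dom_mono hw h

variable {V : Type} {w : W} {ρ : V → M} {x y z : M}

theorem Frc.dom_left (h : w ⊩ x ∊ y) : Dom w x := (K.dom_of_mem h).1
theorem Frc.dom_right (h : w ⊩ x ∊ y) : Dom w y := (K.dom_of_mem h).2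
theorem Frc.dom_eq_left (h : w ⊩ x ≐ y) : Dom w x := (K.dom_of_eq h).1
theorem Frc.dom_eq_right (h : w ⊩ x ≐ y) : Dom w y := (K.dom_of_eq h).2
theorem Dom.refl (h : Dom w x) : w ⊩ x ≐ x := K.eq_refl h
theorem Frc.symm (h : w ⊩ x ≐ y) : w ⊩ y ≐ x := K.eq_symm h
theorem Frc.trans (h : w ⊩ x ≐ y) (h' : w ⊩ y ≐ z) : w ⊩ x ≐ z := K.eq_trans h h'
theorem Frc.mem_eq (h : w ⊩ x ∊ y) (h' : w ⊩ y ≐ z) : w ⊩ x ∊ z :=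
  K.mem_congr (K.eq_refl h.dom_left) h' h
theorem Frc.eq_mem (h : w ⊩ x ≐ y) (h' : w ⊩ x ∊ z) : w ⊩ y ∊ z :=
  K.mem_congr h (K.eq_refl h'.dom_right) h'

@[simp] theorem cons_comp_map' {U : Type} (ρ : U → M) (f : V → U) (x : M) :
    cons ρ x ∘ Ext.map f = cons (ρ ∘ f) x := cons_comp_map ρ f x

@[simp] theorem cons_comp_old (ρ : V → M) (x : M) : cons ρ x ∘ Ext.old = ρ := rfl

@[simp] theorem sat_bot : Sat w (.bot : Fml V) ρ ↔ False := Iff.rfl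
@[simp] theorem sat_mem (a b : V) : Sat w (a ∊ b) ρ ↔ w ⊩ ρ a ∊ ρ b := Iff.rfl
@[simp] theorem sat_eq (a b : V) : Sat w (a ≐ b) ρ ↔ w ⊩ ρ a ≐ ρ b := Iff.rfl
@[simp] theorem sat_and (φ ψ : Fml V) : Sat w (φ ⋏ ψ) ρ ↔ Sat w φ ρ ∧ Sat w ψ ρ := Iff.rfl
@[simp] theorem sat_or (φ ψ : Fml V) : Sat w (φ ⋎ ψ) ρ ↔ Sat w φ ρ ∨ Sat w ψ ρ := Iff.rfl
@[simp] theorem sat_imp (φ ψ : Fml V) :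
    Sat w (φ ⟾ ψ) ρ ↔ ∀ w', w ≤ w' → Sat w' φ ρ → Sat w' ψ ρ := Iff.rfl
@[simp] theorem sat_iff (φ ψ : Fml V) :
    Sat w (φ ⟺ₛ ψ) ρ ↔ ∀ w', w ≤ w' → (Sat w' φ ρ ↔ Sat w' ψ ρ) :=
  ⟨fun h w' hw => ⟨h.1 w' hw, h.2 w' hw⟩, fun h => ⟨fun w' hw => (h w' hw).1,
    fun w' hw => (h w' hw).2⟩⟩
@[simp] theorem sat_allF (φ : Ext V → Fml (Ext V)) :
    Sat w (allF φ) ρ ↔ ∀ w', w ≤ w' → ∀ x, Dom w' x → Sat w' (φ .new) (cons ρ x) := Iff.rfl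
@[simp] theorem sat_exF (φ : Ext V → Fml (Ext V)) :
    Sat w (exF φ) ρ ↔ ∃ x, Dom w x ∧ Sat w (φ .new) (cons ρ x) := Iff.rfl
-- The two future worlds, of the quantifier and of the implication, merge into the later one.
-- Existence of x comes for free, since members exist.
@[simp] theorem sat_ballF (a : V) (φ : Ext V → Fml (Ext V)) :
    Sat w (ballF a φ) ρ ↔
      ∀ w', w ≤ w' → ∀ x, w' ⊩ x ∊ ρ a → Sat w' (φ .new) (cons ρ x) :=
  ⟨fun h w' hw x hx => h w' hw x hx.dom_left w' le_rfl hx,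
    fun h _ hw x _ w'' hw' hx => h w'' (hw.trans hw') x hx⟩
@[simp] theorem sat_bexF (a : V) (φ : Ext V → Fml (Ext V)) :
    Sat w (bexF a φ) ρ ↔ ∃ x, w ⊩ x ∊ ρ a ∧ Sat w (φ .new) (cons ρ x) :=
  ⟨fun ⟨x, _, h⟩ => ⟨x, h⟩, fun ⟨x, h⟩ => ⟨x, h.1.dom_left, h⟩⟩

@[simp] theorem sat_rename' {U : Type} (φ : Fml V) (f : V → U) (ρ : U → M) :
    Sat w (φ.rename f) ρ ↔ Sat w φ (ρ ∘ f) := sat_rename w φ f ρ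

section vocabulary
variable (a b c d e f g h r : V)
-- The vocabulary is uniform in its context, so an assignment can be moved into the parameters by
-- mere unfolding. This normal form lets the forcing clauses below be stated once, for elements of
-- the model.
@[simp] theorem sat_subF : Sat w (subF a b) ρ ↔ w ⊩ subF (ρ a) (ρ b) := Iff.rfl
@[simp] theorem sat_isEmptyF : Sat w (isEmptyF a) ρ ↔ w ⊩ isEmptyF (ρ a) := Iff.rfl
@[simp] theorem sat_isSuccF : Sat w (isSuccF a b) ρ ↔ w ⊩ isSuccF (ρ a) (ρ b) := Iff.rfl
@[simp] theorem sat_isInductiveF : Sat w (isInductiveF a) ρ ↔ w ⊩ isInductiveF (ρ a) := Iff.rfl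
@[simp] theorem sat_isOmegaF : Sat w (isOmegaF a) ρ ↔ w ⊩ isOmegaF (ρ a) := Iff.rfl
@[simp] theorem sat_isPairF : Sat w (isPairF a b c) ρ ↔ w ⊩ isPairF (ρ a) (ρ b) (ρ c) := Iff.rfl
@[simp] theorem sat_isOPairF : Sat w (isOPairF a b c) ρ ↔ w ⊩ isOPairF (ρ a) (ρ b) (ρ c) := Iff.rfl
@[simp] theorem sat_relF : Sat w (relF a b c) ρ ↔ w ⊩ relF (ρ a) (ρ b) (ρ c) := Iff.rfl
@[simp] theorem sat_isRelF : Sat w (isRelF a b c) ρ ↔ w ⊩ isRelF (ρ a) (ρ b) (ρ c) := Iff.rfl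
@[simp] theorem sat_isFunF : Sat w (isFunF a b c) ρ ↔ w ⊩ isFunF (ρ a) (ρ b) (ρ c) := Iff.rfl
@[simp] theorem sat_isSurjF : Sat w (isSurjF a b c) ρ ↔ w ⊩ isSurjF (ρ a) (ρ b) (ρ c) := Iff.rfl
@[simp] theorem sat_isFinEnumF : Sat w (isFinEnumF a) ρ ↔ w ⊩ isFinEnumF (ρ a) := Iff.rfl
@[simp] theorem sat_isFamilyF : Sat w (isFamilyF a b) ρ ↔ w ⊩ isFamilyF (ρ a) (ρ b) := Iff.rfl
@[simp] theorem sat_isFinitaryRuleSetF :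
    Sat w (isFinitaryRuleSetF a b) ρ ↔ w ⊩ isFinitaryRuleSetF (ρ a) (ρ b) := Iff.rfl
@[simp] theorem sat_isClosedSubsetF :
    Sat w (isClosedSubsetF a b c) ρ ↔ w ⊩ isClosedSubsetF (ρ a) (ρ b) (ρ c) := Iff.rfl
@[simp] theorem sat_isPreorderF :
    Sat w (isPreorderF a b) ρ ↔ w ⊩ isPreorderF (ρ a) (ρ b) := Iff.rfl
@[simp] theorem sat_memFamF : Sat w (memFamF a b c) ρ ↔ w ⊩ memFamF (ρ a) (ρ b) (ρ c) := Iff.rfl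
@[simp] theorem sat_memFam₂F :
    Sat w (memFam₂F a b c d) ρ ↔ w ⊩ memFam₂F (ρ a) (ρ b) (ρ c) (ρ d) := Iff.rfl
@[simp] theorem sat_isSigmaF : Sat w (isSigmaF a b c) ρ ↔ w ⊩ isSigmaF (ρ a) (ρ b) (ρ c) := Iff.rfl
@[simp] theorem sat_isAxiomSetF :
    Sat w (isAxiomSetF a b c) ρ ↔ w ⊩ isAxiomSetF (ρ a) (ρ b) (ρ c) := Iff.rfl
@[simp] theorem sat_isSetPresentedFTopF : Sat w (isSetPresentedFTopF a b c d) ρ ↔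
    w ⊩ isSetPresentedFTopF (ρ a) (ρ b) (ρ c) (ρ d) := Iff.rfl
@[simp] theorem sat_isFTopMapF : Sat w (isFTopMapF a b c d e f g h r) ρ ↔
    w ⊩ isFTopMapF (ρ a) (ρ b) (ρ c) (ρ d) (ρ e) (ρ f) (ρ g) (ρ h) (ρ r) := Iff.rfl
end vocabulary

/-! ### Forcing clauses of the set-theoretic vocabulary -/

section unfold
variable {a b c d n f r S R T s p u v i k : M}

theorem frc_subF : w ⊩ subF a b ↔ ∀ w', w ≤ w' → ∀ x, w' ⊩ x ∊ a → w' ⊩ x ∊ b := by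
  rw [Frc, subF]; simp

theorem frc_isEmptyF : w ⊩ isEmptyF a ↔ ∀ w', w ≤ w' → ∀ x, ¬ w' ⊩ x ∊ a := by
  rw [Frc, isEmptyF]; simp

theorem frc_isSuccF : w ⊩ isSuccF a b ↔ w ⊩ subF b a ∧ w ⊩ b ∊ a ∧
    ∀ w', w ≤ w' → ∀ x, w' ⊩ x ∊ a → w' ⊩ x ∊ b ∨ w' ⊩ x ≐ b := by
  rw [Frc, isSuccF]; simp

theorem frc_isInductiveF : w ⊩ isInductiveF a ↔ (∃ z, w ⊩ z ∊ a ∧ w ⊩ isEmptyF z) ∧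
    ∀ w', w ≤ w' → ∀ x, w' ⊩ x ∊ a → ∃ y, w' ⊩ y ∊ a ∧ w' ⊩ isSuccF y x := by
  rw [Frc, isInductiveF]; simp

theorem frc_isOmegaF : w ⊩ isOmegaF a ↔ w ⊩ isInductiveF a ∧
    ∀ w', w ≤ w' → ∀ y, Dom w' y → ∀ w'', w' ≤ w'' → w'' ⊩ isInductiveF y → w'' ⊩ subF a y := by
  rw [Frc, isOmegaF]; simp

theorem frc_isPairF : w ⊩ isPairF a b c ↔ w ⊩ b ∊ a ∧ w ⊩ c ∊ a ∧
    ∀ w', w ≤ w' → ∀ x, w' ⊩ x ∊ a → w' ⊩ x ≐ b ∨ w' ⊩ x ≐ c := by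
  rw [Frc, isPairF]; simp

theorem frc_isOPairF : w ⊩ isOPairF p x y ↔ ∃ s, w ⊩ s ∊ p ∧ ∃ t, w ⊩ t ∊ p ∧
    w ⊩ isPairF s x x ∧ w ⊩ isPairF t x y ∧ w ⊩ isPairF p s t := by
  rw [Frc, isOPairF]; simp

theorem frc_relF : w ⊩ relF r x y ↔ ∃ p, w ⊩ p ∊ r ∧ w ⊩ isOPairF p x y := by
  rw [Frc, relF]; simp

theorem frc_isRelF : w ⊩ isRelF r a b ↔ ∀ w', w ≤ w' → ∀ p, w' ⊩ p ∊ r →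
    ∃ x, w' ⊩ x ∊ a ∧ ∃ y, w' ⊩ y ∊ b ∧ w' ⊩ isOPairF p x y := by
  rw [Frc, isRelF]; simp

theorem frc_isFunF : w ⊩ isFunF f a b ↔ w ⊩ isRelF f a b ∧ ∀ w', w ≤ w' → ∀ x, w' ⊩ x ∊ a →
    ∃ y, w' ⊩ y ∊ b ∧ w' ⊩ relF f x y ∧
      ∀ w'', w' ≤ w'' → ∀ z, w'' ⊩ z ∊ b → w'' ⊩ relF f x z → w'' ⊩ z ≐ y := by
  rw [Frc, isFunF]
  simp only [sat_and, sat_isRelF, sat_ballF, sat_bexF, sat_imp, sat_relF, sat_eq, cons_old,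
    cons_new, id]
  exact and_congr_right fun _ => forall₄_congr fun _ _ _ _ => exists_congr fun y =>
    and_congr_right fun _ => and_congr_right fun _ =>
      ⟨fun H w₁ h₁ z hz h => H w₁ h₁ z hz w₁ le_rfl h,
        fun H w₁ h₁ z hz w₂ h₂ h => H w₂ (h₁.trans h₂) z (hz.up h₂) h⟩

theorem frc_isSurjF : w ⊩ isSurjF f a b ↔ w ⊩ isFunF f a b ∧ ∀ w', w ≤ w' → ∀ y, w' ⊩ y ∊ b →
    ∃ x, w' ⊩ x ∊ a ∧ w' ⊩ relF f x y := by
  rw [Frc, isSurjF]; simp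

theorem frc_isFinEnumF : w ⊩ isFinEnumF a ↔ ∃ o, Dom w o ∧ w ⊩ isOmegaF o ∧
    ∃ n, w ⊩ n ∊ o ∧ ∃ f, Dom w f ∧ w ⊩ isSurjF f n a := by
  rw [Frc, isFinEnumF]; simp

theorem frc_isFamilyF : w ⊩ isFamilyF f a ↔ ∃ b, Dom w b ∧ w ⊩ isFunF f a b := by
  rw [Frc, isFamilyF]; simp

theorem frc_isFinitaryRuleSetF : w ⊩ isFinitaryRuleSetF S R ↔ ∀ w', w ≤ w' → ∀ p, w' ⊩ p ∊ R →
    ∃ a, Dom w' a ∧ ∃ b, Dom w' b ∧ w' ⊩ isOPairF p a b ∧ w' ⊩ subF a S ∧ w' ⊩ subF b S ∧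
      w' ⊩ isFinEnumF a := by
  rw [Frc, isFinitaryRuleSetF]; simp

theorem frc_memFamF : w ⊩ memFamF r a i ↔ ∃ p, w ⊩ p ∊ r ∧ ∃ t, w ⊩ t ∊ p ∧ ∃ u, w ⊩ u ∊ t ∧
    w ⊩ isOPairF p a u ∧ w ⊩ i ∊ u := by
  rw [Frc, memFamF]; simp

theorem frc_memFam₂F : w ⊩ memFam₂F r a i c ↔ ∃ p, w ⊩ p ∊ r ∧ ∃ t, w ⊩ t ∊ p ∧ ∃ q, w ⊩ q ∊ t ∧
    ∃ u, w ⊩ u ∊ t ∧ w ⊩ isOPairF q a i ∧ w ⊩ isOPairF p q u ∧ w ⊩ c ∊ u := by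
  rw [Frc, memFam₂F]; simp

theorem dom_of_isPairF (h : w ⊩ isPairF p x y) : Dom w p ∧ Dom w x ∧ Dom w y := by
  rw [frc_isPairF] at h
  exact ⟨h.1.dom_right, h.1.dom_left, h.2.1.dom_left⟩

theorem dom_of_isOPairF (h : w ⊩ isOPairF p x y) : Dom w p ∧ Dom w x ∧ Dom w y := by
  rw [frc_isOPairF] at h
  obtain ⟨s, hs, t, -, -, h, -⟩ := h
  exact ⟨hs.dom_right, (dom_of_isPairF h).2⟩

theorem dom_of_relF (h : w ⊩ relF r x y) : Dom w r ∧ Dom w x ∧ Dom w y := by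
  rw [frc_relF] at h
  obtain ⟨p, hp, h⟩ := h
  exact ⟨hp.dom_right, (dom_of_isOPairF h).2⟩

theorem frc_isPreorderF : w ⊩ isPreorderF S r ↔ w ⊩ isRelF r S S ∧
    (∀ w', w ≤ w' → ∀ x, w' ⊩ x ∊ S → w' ⊩ relF r x x) ∧
    ∀ w', w ≤ w' → ∀ x y z, w' ⊩ x ∊ S → w' ⊩ y ∊ S → w' ⊩ z ∊ S → w' ⊩ relF r x y →
      w' ⊩ relF r y z → w' ⊩ relF r x z := by
  rw [Frc, isPreorderF]
  simp only [sat_and, sat_isRelF, sat_ballF, sat_imp, sat_relF, cons_old, cons_new, id]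
  refine and_congr_right fun _ => and_congr_right fun _ => ⟨?_, ?_⟩
  · intro h w' hw x y z hx hy hz hxy hyz
    exact h w' hw x hx w' le_rfl y hy w' le_rfl z hz w' le_rfl hxy w' le_rfl hyz
  · intro h w₁ h₁ x hx w₂ h₂ y hy w₃ h₃ z hz w₄ h₄ hxy w₅ h₅ hyz
    have h₃₅ := h₄.trans h₅
    have h₂₅ := h₃.trans h₃₅
    have h₁₅ := h₂.trans h₂₅
    exact h w₅ (h₁.trans h₁₅) x y z (hx.up h₁₅) (hy.up h₂₅) (hz.up h₃₅) (hxy.up h₅) hyz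

theorem frc_isClosedSubsetF : w ⊩ isClosedSubsetF S R a ↔ w ⊩ subF a S ∧
    ∀ w', w ≤ w' → ∀ x y, w' ⊩ relF R x y → w' ⊩ subF x a → ∃ z, w' ⊩ z ∊ y ∧ w' ⊩ z ∊ a := by
  rw [Frc, isClosedSubsetF]
  simp only [sat_and, sat_subF, sat_allF, sat_bexF, sat_imp, sat_relF, sat_mem, cons_old,
    cons_new, id]
  refine and_congr_right fun _ => ⟨?_, ?_⟩
  · intro h w' hw x y hxy hx
    exact h w' hw x (dom_of_relF hxy).2.1 w' le_rfl y (dom_of_relF hxy).2.2 w' le_rfl hxy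
      w' le_rfl hx
  · intro h w₁ h₁ x hx w₂ h₂ y hy w₃ h₃ hxy w₄ h₄ hxa
    exact h w₄ (h₁.trans (h₂.trans (h₃.trans h₄))) x y (hxy.up h₄) hxa

end unfold
end forcing

/-! ## Set theory in a Kripke model -/

/-- A Kripke model of `ECST + FPA`. -/
class SetModel (W : Type 1) (M : outParam Type) extends Kripke W M where
  models : Models W ECST_FPA

section model
variable {W : Type 1} {M : Type} [K : SetModel W M] {w : W}

/-- The elements that exist at a world. -/
abbrev Elt {W : Type 1} {M : Type} [Kripke W M] (w : W) : Type := {x : M // Dom w x}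

/-- An existing element, as a parameter of a formula. -/
abbrev par {W : Type 1} {M : Type} [Kripke W M] {w : W} {x : M} (h : Dom w x) : Elt w := ⟨x, h⟩

theorem sat_axiom {V : Type} {φ : Fml V} (h : ECSTAxiom φ) {ρ : V → M} (hρ : ∀ v, Dom w (ρ v)) :
    Sat w φ ρ :=
  K.models w (.inl h) hρ

theorem ext {a b : M} (ha : Dom w a) (hb : Dom w b)
    (h : ∀ w', w ≤ w' → ∀ x, w' ⊩ x ∊ a ↔ w' ⊩ x ∊ b) : w ⊩ a ≐ b := by
  have := sat_axiom (w := w) .extensionality (V := Empty) (ρ := fun v => v.elim) fun v => v.elim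
  rw [CST.extensionality] at this
  simp only [sat_allF, sat_imp, sat_iff, sat_mem, sat_eq, cons_old, cons_new] at this
  exact this w le_rfl a ha w le_rfl b hb w le_rfl fun w₁ h₁ x _ w₂ h₂ => h w₂ (h₁.trans h₂) x

/-- The class `P` is a set at the world `w`. -/
def IsSet (w : W) (P : W → M → Prop) : Prop :=
  ∃ s, Dom w s ∧ ∀ w', w ≤ w' → ∀ z, w' ⊩ z ∊ s ↔ P w' z

theorem IsSet.congr {P Q : W → M → Prop} (h : IsSet w P)
    (hPQ : ∀ w', w ≤ w' → ∀ z, P w' z ↔ Q w' z) : IsSet w Q := by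
  obtain ⟨s, hs, H⟩ := h
  exact ⟨s, hs, fun w' hw z => (H w' hw z).trans (hPQ w' hw z)⟩

/-- The class `P`, binary with parameters at `w`, is given by a formula. -/
def Definable (w : W) (P : W → M → M → Prop) : Prop :=
  ∃ φ : Fml (Ext (Ext (Elt w))), ∀ w', w ≤ w' → ∀ x z, Dom w' x → Dom w' z →
    (Sat w' φ (cons (cons Subtype.val x) z) ↔ P w' x z)

/-- The class `P`, binary with parameters at `w`, is given by a restricted formula. -/
def RestrDefinable (w : W) (P : W → M → M → Prop) : Prop :=
  ∃ φ : Fml (Ext (Ext (Elt w))), φ.Restricted ∧ ∀ w', w ≤ w' → ∀ x z, Dom w' x → Dom w' z →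
    (Sat w' φ (cons (cons Subtype.val x) z) ↔ P w' x z)

theorem pairing_exists {a b : M} (ha : Dom w a) (hb : Dom w b) : ∃ p, w ⊩ isPairF p a b := by
  have := sat_axiom (w := w) .pairing (V := Empty) (ρ := fun v => v.elim) fun v => v.elim
  rw [CST.pairing] at this
  simp only [sat_allF, sat_exF, sat_iff, sat_mem, sat_or, sat_eq, cons_old, cons_new] at this
  obtain ⟨p, hp, h⟩ := this w le_rfl a ha w le_rfl b hb
  refine ⟨p, frc_isPairF.2 ⟨(h w le_rfl a ha w le_rfl).2 (.inl ha.refl),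
    (h w le_rfl b hb w le_rfl).2 (.inr hb.refl), fun w' hw x hx => ?_⟩⟩
  exact (h w' hw x hx.dom_left w' le_rfl).1 hx

theorem isSet_union {a : M} (ha : Dom w a) :
    IsSet w fun w' z => ∃ y, w' ⊩ y ∊ a ∧ w' ⊩ z ∊ y := by
  have := sat_axiom (w := w) .union (V := Empty) (ρ := fun v => v.elim) fun v => v.elim
  rw [CST.union] at this
  simp only [sat_allF, sat_exF, sat_iff, sat_mem, sat_bexF, cons_old, cons_new] at this
  obtain ⟨p, hp, h⟩ := this w le_rfl a ha
  exact ⟨p, hp, fun w' hw x => ⟨fun hx => (h w' hw x hx.dom_left w' le_rfl).1 hx,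
    fun ⟨y, hy, hx⟩ => (h w' hw x hx.dom_left w' le_rfl).2 ⟨y, hy, hx⟩⟩⟩

theorem isSet_sep {V : Type} {a : M} (ha : Dom w a) {φ : Fml (Ext V)} (hφ : φ.Restricted)
    {ρ : V → M} (hρ : ∀ v, Dom w (ρ v)) :
    IsSet w fun w' z => w' ⊩ z ∊ a ∧ Sat w' φ (cons ρ z) := by
  have := sat_axiom (w := w) (.separation (φ.rename (Ext.map Ext.old)) (hφ.rename _)) hρ
  rw [CST.separation] at this
  simp only [sat_allF, sat_exF, sat_iff, sat_mem, sat_and, sat_rename', cons_old, cons_new,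
    cons_comp_map', cons_comp_old] at this
  obtain ⟨p, hp, h⟩ := this w le_rfl a ha
  exact ⟨p, hp, fun w' hw x => ⟨fun hx => (h w' hw x hx.dom_left w' le_rfl).1 hx,
    fun hx => (h w' hw x hx.1.dom_left w' le_rfl).2 hx⟩⟩

/-- Union of a family of definable sets: Replacement collects the sets {z | P x z} for x ∈ a, and
Union merges them. Replacement holds for arbitrary formulas, so P need not be restricted. -/
theorem isSet_bex {a : M} (ha : Dom w a) {P : W → M → M → Prop} (hP : Definable w P)
    (h : ∀ w', w ≤ w' → ∀ x, w' ⊩ x ∊ a → IsSet w' fun w'' z => P w'' x z) :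
    IsSet w fun w' z => ∃ x, w' ⊩ x ∊ a ∧ P w' x z := by
  obtain ⟨φ, hφ⟩ := hP
  let τ : Ext (Ext (Elt w)) → Ext (Ext (Ext (Ext (Elt w)))) := fun
    | .new => .new
    | .old .new => .old (.old .new)
    | .old (.old v) => .old (.old (.old (.old v)))
  -- The functional relation for Replacement is "s is the set of all z with P x z", whose uniqueness
  -- is Extensionality. The renaming τ skips the slots of s and of the domain a.
  let ψ : Fml (Ext (Ext (Ext (Elt w)))) := allF fun z => z ∊ .old .new ⟺ₛ φ.rename τ
  have hψ : ∀ (ρ : Ext (Ext (Ext (Elt w))) → M) (v : W), w ≤ v → Dom v (ρ (.old .new)) →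
      (∀ u, ρ (.old (.old (.old u))) = u.1) → (Sat v ψ ρ ↔ ∀ v', v ≤ v' → ∀ z,
        Dom v' z → (v' ⊩ z ∊ ρ .new ↔ P v' (ρ (.old .new)) z)) := by
    intro ρ v hv hx hρ
    have hτ : ∀ z, cons ρ z ∘ τ = cons (cons Subtype.val (ρ (.old .new))) z := by
      intro z; funext u
      rcases u with _ | _ | u <;> [rfl; rfl; exact hρ u]
    simp only [ψ, sat_allF, sat_iff, sat_mem, sat_rename', cons_old, cons_new, hτ]
    constructor
    · intro H v' hv' z hz
      rw [H v' hv' z hz v' le_rfl, hφ v' (hv.trans hv') _ z (hx.up hv') hz]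
    · intro H v' hv' z hz v'' hv''
      rw [H v'' (hv'.trans hv'') z (hz.up hv''),
        hφ v'' (hv.trans (hv'.trans hv'')) _ z (hx.up (hv'.trans hv'')) (hz.up hv'')]
  have := sat_axiom (w := w) (.replacement ψ) (ρ := Subtype.val) fun v => v.2
  rw [replacement] at this
  simp only [sat_allF, sat_ballF, sat_bexF, sat_exF, sat_iff, sat_mem, sat_imp, sat_and,
    sat_rename', cons_old, cons_new, cons_comp_map', cons_comp_old, sat_eq] at this
  obtain ⟨b, hb, hb'⟩ := this w le_rfl a ha w le_rfl (by
    intro w₁ h₁ x hx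
    obtain ⟨s, hs, hsP⟩ := h w₁ h₁ x hx
    refine ⟨s, hs, (hψ _ w₁ h₁ hx.dom_left fun u => rfl).2 fun v hv z hz => hsP v hv z, ?_⟩
    intro w₂ h₂ t ht w₃ h₃ hst
    refine ext (ht.up h₃) (hs.up (h₂.trans h₃)) fun v hv z => ?_
    have := (hψ _ w₃ (h₁.trans (h₂.trans h₃)) (hx.dom_left.up (h₂.trans h₃)) fun u => rfl).1 hst
    refine ⟨fun hz => ?_, fun hz => ?_⟩
    · exact (hsP v (h₂.trans (h₃.trans hv)) z).2 ((this v hv z hz.dom_left).1 hz)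
    · exact (this v hv z hz.dom_left).2 ((hsP v (h₂.trans (h₃.trans hv)) z).1 hz))
  obtain ⟨u, hu, hu'⟩ := isSet_union hb
  refine ⟨u, hu, fun w₁ h₁ z => (hu' w₁ h₁ z).trans ⟨?_, ?_⟩⟩
  · rintro ⟨s, hs, hz⟩
    obtain ⟨x, hx, hxs⟩ := (hb' w₁ h₁ s hs.dom_left w₁ le_rfl).1 hs
    refine ⟨x, hx, ?_⟩
    exact ((hψ _ w₁ h₁ hx.dom_left (by intro; rfl)).1 hxs w₁ le_rfl z hz.dom_left).1 hz
  · rintro ⟨x, hx, hz⟩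
    obtain ⟨s, hs, hsP⟩ := h w₁ h₁ x hx
    refine ⟨s, (hb' w₁ h₁ s hs w₁ le_rfl).2 ⟨x, hx, ?_⟩, (hsP w₁ le_rfl z).2 hz⟩
    exact (hψ _ w₁ h₁ hx.dom_left (by intro; rfl)).2 fun v hv z hz => hsP v hv z

/-- Invariance under the equality of the model, read off from `Sat.congr` by regarding the
parameters as values of finitely many variables. The same device gives the next statements. -/
theorem isPairF_congr {p x y p' x' y' : M} (h : w ⊩ isPairF p x y) (hp : w ⊩ p ≐ p')
    (hx : w ⊩ x ≐ x') (hy : w ⊩ y ≐ y') : w ⊩ isPairF p' x' y' :=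
  Sat.congr (φ := isPairF (0 : Fin 3) 1 2) (ρ := ![p, x, y]) (ρ' := ![p', x', y']) h
    (by intro v; fin_cases v <;> assumption)

theorem isOPairF_congr {p x y p' x' y' : M} (h : w ⊩ isOPairF p x y) (hp : w ⊩ p ≐ p')
    (hx : w ⊩ x ≐ x') (hy : w ⊩ y ≐ y') : w ⊩ isOPairF p' x' y' :=
  Sat.congr (φ := isOPairF (0 : Fin 3) 1 2) (ρ := ![p, x, y]) (ρ' := ![p', x', y']) h
    (by intro v; fin_cases v <;> assumption)

theorem relF_congr {r x y x' y' : M} (h : w ⊩ relF r x y)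
    (hx : w ⊩ x ≐ x') (hy : w ⊩ y ≐ y') : w ⊩ relF r x' y' :=
  have hr := (dom_of_relF h).1.refl
  Sat.congr (φ := relF (0 : Fin 3) 1 2) (ρ := ![r, x, y]) (ρ' := ![r, x', y']) h
    (by intro v; fin_cases v <;> assumption)

theorem subF_congr {x y x' y' : M} (h : w ⊩ subF x y)
    (hx : w ⊩ x ≐ x') (hy : w ⊩ y ≐ y') : w ⊩ subF x' y' :=
  Sat.congr (φ := subF (0 : Fin 2) 1) (ρ := ![x, y]) (ρ' := ![x', y']) h
    (by intro v; fin_cases v <;> assumption)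

theorem isFinEnumF_congr {x x' : M} (h : w ⊩ isFinEnumF x) (hx : w ⊩ x ≐ x') :
    w ⊩ isFinEnumF x' :=
  Sat.congr (φ := isFinEnumF (0 : Fin 1)) (ρ := ![x]) (ρ' := ![x']) h
    (by intro v; fin_cases v; assumption)

/-! ### Pairs -/

theorem mem_pair {p a b x : M} (h : w ⊩ isPairF p a b) : w ⊩ x ∊ p ↔ w ⊩ x ≐ a ∨ w ⊩ x ≐ b := by
  rw [frc_isPairF] at h
  refine ⟨h.2.2 w le_rfl x, ?_⟩
  rintro (hx | hx)
  · exact hx.symm.eq_mem h.1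
  · exact hx.symm.eq_mem h.2.1

theorem mem_singleton {p a x : M} (h : w ⊩ isPairF p a a) : w ⊩ x ∊ p ↔ w ⊩ x ≐ a := by
  rw [mem_pair h, or_self]

theorem pair_unique {p q a b : M} (hp : w ⊩ isPairF p a b) (hq : w ⊩ isPairF q a b) :
    w ⊩ p ≐ q :=
  ext (dom_of_isPairF hp).1 (dom_of_isPairF hq).1 fun _ hw _ => by
    rw [mem_pair (hp.up hw), mem_pair (hq.up hw)]

theorem isOPairF_intro {p s t a b : M} (hs : w ⊩ isPairF s a a) (ht : w ⊩ isPairF t a b)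
    (hp : w ⊩ isPairF p s t) : w ⊩ isOPairF p a b :=
  frc_isOPairF.2 ⟨s, (frc_isPairF.1 hp).1, t, (frc_isPairF.1 hp).2.1, hs, ht, hp⟩

theorem isOPairF_elim {p a b : M} (h : w ⊩ isOPairF p a b) :
    ∃ s t, w ⊩ isPairF s a a ∧ w ⊩ isPairF t a b ∧ w ⊩ isPairF p s t := by
  obtain ⟨s, -, t, -, h⟩ := frc_isOPairF.1 h
  exact ⟨s, t, h⟩

theorem opair_exists {a b : M} (ha : Dom w a) (hb : Dom w b) : ∃ p, w ⊩ isOPairF p a b := by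
  obtain ⟨s, hs⟩ := pairing_exists ha ha
  obtain ⟨t, ht⟩ := pairing_exists ha hb
  obtain ⟨p, hp⟩ := pairing_exists (dom_of_isPairF hs).1 (dom_of_isPairF ht).1
  exact ⟨p, isOPairF_intro hs ht hp⟩

theorem opair_unique {p q a b : M} (hp : w ⊩ isOPairF p a b) (hq : w ⊩ isOPairF q a b) :
    w ⊩ p ≐ q := by
  obtain ⟨s, t, hs, ht, hp⟩ := isOPairF_elim hp
  obtain ⟨s', t', hs', ht', hq⟩ := isOPairF_elim hq
  exact pair_unique (isPairF_congr hp (dom_of_isPairF hp).1.refl (pair_unique hs hs')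
    (pair_unique ht ht')) hq

theorem opair_inj {p a b a' b' : M} (hp : w ⊩ isOPairF p a b) (hq : w ⊩ isOPairF p a' b') :
    w ⊩ a ≐ a' ∧ w ⊩ b ≐ b' := by
  obtain ⟨s, t, hs, ht, hp⟩ := isOPairF_elim hp
  obtain ⟨s', t', hs', ht', hq⟩ := isOPairF_elim hq
  have has := (mem_singleton hs).2 (dom_of_isPairF hs).2.1.refl
  have hat := (mem_pair ht).2 (.inl (dom_of_isPairF ht).2.1.refl)
  have hbt := (mem_pair ht).2 (.inr (dom_of_isPairF ht).2.2.refl)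
  have hbt' := (mem_pair ht').2 (.inr (dom_of_isPairF ht').2.2.refl)
  have hsp := (mem_pair hq).2 (.inl (dom_of_isPairF hq).2.1.refl)
  have htp := (mem_pair hq).2 (.inr (dom_of_isPairF hq).2.2.refl)
  have haa : w ⊩ a ≐ a' := by
    rcases (mem_pair hp).1 hsp with h | h
    · exact (mem_singleton hs').1 (has.mem_eq h.symm)
    · exact (mem_singleton hs').1 (hat.mem_eq h.symm)
  refine ⟨haa, ?_⟩
  -- The degenerate case: when b equals a, the pair {a,b} is a singleton, and b' is identified
  -- through its membership in one of the two components of p.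
  have key : w ⊩ b ≐ a → w ⊩ b ≐ b' := by
    intro hba
    rcases (mem_pair hp).1 htp with h | h
    · exact hba.trans ((mem_singleton hs).1 (hbt'.mem_eq h)).symm
    · rcases (mem_pair ht).1 (hbt'.mem_eq h) with h | h
      exacts [hba.trans h.symm, h.symm]
  have htq : w ⊩ t ∊ p := (mem_pair hp).2 (.inr (dom_of_isPairF hp).2.2.refl)
  rcases (mem_pair hq).1 htq with h | h
  · exact key (((mem_singleton hs').1 (hbt.mem_eq h)).trans haa.symm)
  · rcases (mem_pair ht').1 (hbt.mem_eq h) with h | h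
    exacts [key (h.trans haa.symm), h]

theorem relF_intro {r p a b : M} (hp : w ⊩ isOPairF p a b) (h : w ⊩ p ∊ r) : w ⊩ relF r a b :=
  frc_relF.2 ⟨p, h, hp⟩

/-! ### Existence of sets -/

theorem isSet_mem {a : M} (ha : Dom w a) : IsSet w fun w' z => w' ⊩ z ∊ a :=
  ⟨a, ha, fun _ _ _ => Iff.rfl⟩

theorem isSet_eq {a : M} (ha : Dom w a) : IsSet w fun w' z => w' ⊩ z ≐ a := by
  obtain ⟨p, hp⟩ := pairing_exists ha ha
  exact ⟨p, (dom_of_isPairF hp).1, fun w' hw z => mem_singleton (hp.up hw)⟩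

theorem isSet_or {P Q : W → M → Prop} (hP : IsSet w P) (hQ : IsSet w Q) :
    IsSet w fun w' z => P w' z ∨ Q w' z := by
  obtain ⟨a, ha, haP⟩ := hP
  obtain ⟨b, hb, hbQ⟩ := hQ
  obtain ⟨p, hp⟩ := pairing_exists ha hb
  refine (isSet_union (dom_of_isPairF hp).1).congr fun w' hw z => ?_
  rw [← haP w' hw, ← hbQ w' hw]
  constructor
  · rintro ⟨y, hy, hz⟩
    exact ((mem_pair (hp.up hw)).1 hy).imp (hz.mem_eq ·) (hz.mem_eq ·)
  · rintro (h | h)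
    exacts [⟨a, (mem_pair (hp.up hw)).2 (.inl (ha.up hw).refl), h⟩,
      ⟨b, (mem_pair (hp.up hw)).2 (.inr (hb.up hw).refl), h⟩]

theorem isSet_restr {P : W → M → M → Prop} (hP : RestrDefinable w P) {w' : W} (hw : w ≤ w')
    {x a : M} (hx : Dom w' x) (ha : Dom w' a) :
    IsSet w' fun v z => v ⊩ z ∊ a ∧ P v x z := by
  obtain ⟨φ, hφ, hφP⟩ := hP
  refine (isSet_sep ha hφ (ρ := cons Subtype.val x) fun v => ?_).congr fun v hv z =>
    and_congr_right fun hz => hφP v (hw.trans hv) x z (hx.up hv) hz.dom_left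
  cases v with
  | new => exact hx
  | old v => exact v.2.up hw

theorem isSet_isOPairF {a b : M} (ha : Dom w a) (hb : Dom w b) :
    IsSet w fun w' z => w' ⊩ isOPairF z a b := by
  obtain ⟨p, hp⟩ := opair_exists ha hb
  exact (isSet_eq (dom_of_isOPairF hp).1).congr fun w' hw z =>
    ⟨fun h => isOPairF_congr (hp.up hw) h.symm (ha.up hw).refl (hb.up hw).refl,
      fun h => opair_unique h (hp.up hw)⟩

/-- A formula in two distinguished variables. -/
abbrev form₂ {V : Type} (φ : Ext (Ext V) → Ext (Ext V) → Fml (Ext (Ext V))) :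
    Fml (Ext (Ext V)) := φ (.old .new) .new

/-- The set `{(x, y) | x ∈ a, y ∈ b}`. -/
theorem isSet_prod {a b : M} (ha : Dom w a) (hb : Dom w b) :
    IsSet w fun w' z => ∃ x, w' ⊩ x ∊ a ∧ ∃ y, w' ⊩ y ∊ b ∧ w' ⊩ isOPairF z x y := by
  refine isSet_bex ha ⟨form₂ fun x z => bexF (par hb) fun y => isOPairF z x y,
    fun _ _ _ _ _ _ => by simp⟩ fun w' hw x hx => ?_
  refine isSet_bex (hb.up hw) ⟨form₂ fun y z => isOPairF z (par hx.dom_left) y,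
    fun _ _ _ _ _ _ => by simp⟩ fun w'' hw' y hy => ?_
  exact isSet_isOPairF (hx.dom_left.up hw') hy.dom_left

/-- `U = {y ∈ Y | P y}`. -/
def IsComp (w : W) (U Y : M) (P : W → M → Prop) : Prop :=
  Dom w U ∧ ∀ w', w ≤ w' → ∀ y, w' ⊩ y ∊ U ↔ w' ⊩ y ∊ Y ∧ P w' y

theorem IsComp.up {U Y : M} {P : W → M → Prop} (h : IsComp w U Y P) {w' : W} (hw : w ≤ w') :
    IsComp w' U Y P :=
  ⟨h.1.up hw, fun v hv => h.2 v (hw.trans hv)⟩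

theorem IsComp.unique {U U' Y : M} {P : W → M → Prop} (h : IsComp w U Y P)
    (h' : IsComp w U' Y P) : w ⊩ U ≐ U' :=
  ext h.1 h'.1 fun v hv y => by rw [h.2 v hv, h'.2 v hv]

theorem IsComp.congr {U U' Y : M} {P : W → M → Prop} (h : IsComp w U Y P)
    (h' : w ⊩ U ≐ U') : IsComp w U' Y P :=
  ⟨h'.dom_eq_right, fun v hv y => by
    rw [← h.2 v hv]
    exact ⟨fun hy => hy.mem_eq (h'.up hv).symm, fun hy => hy.mem_eq (h'.up hv)⟩⟩

theorem exists_isComp {P : W → M → M → Prop} (hP : RestrDefinable w P) {w' : W} (hw : w ≤ w')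
    {x Y : M} (hx : Dom w' x) (hY : Dom w' Y) : ∃ U, IsComp w' U Y fun v y => P v x y :=
  isSet_restr hP hw hx hY

/-- The defining formula quantifies over all y without bound. It is used only for Replacement, where
this is allowed, whereas P itself must be restricted for the comprehension to exist. -/
theorem definable_isComp {P : W → M → M → Prop} (hP : RestrDefinable w P) {Y : M}
    (hY : Dom w Y) : Definable w fun w' x U => IsComp w' U Y fun v y => P v x y := by
  obtain ⟨φ, -, hφP⟩ := hP
  let τ : Ext (Ext (Elt w)) → Ext (Ext (Ext (Elt w))) := fun
    | .new => .new
    | .old .new => .old (.old .new)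
    | .old (.old v) => .old (.old (.old v))
  refine ⟨form₂ fun x U => allF fun y => y ∊ U ⟺ₛ y ∊ par hY ⋏ φ.rename τ, ?_⟩
  intro w' hw x U hx hU
  have hτ : ∀ y, cons (cons (cons Subtype.val x) U) y ∘ τ = cons (cons Subtype.val x) y := by
    intro z; funext u
    rcases u with _ | _ | u <;> rfl
  simp only [sat_allF, sat_iff, sat_mem, sat_and, sat_rename', cons_old, cons_new, hτ]
  constructor
  · intro h
    refine ⟨hU, fun v hv y => ⟨fun hy => ?_, fun hy => ?_⟩⟩
    · have := (h v hv y hy.dom_left v le_rfl).1 hy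
      exact ⟨this.1, (hφP v (hw.trans hv) x y (hx.up hv) hy.dom_left).1 this.2⟩
    · exact (h v hv y hy.1.dom_left v le_rfl).2
        ⟨hy.1, (hφP v (hw.trans hv) x y (hx.up hv) hy.1.dom_left).2 hy.2⟩
  · intro h v hv y hy v' hv'
    rw [h.2 v' (hv.trans hv'), hφP v' (hw.trans (hv.trans hv')) x y (hx.up (hv.trans hv'))
      (hy.up hv')]

/-- The set `{{y ∈ Y | P x y} | x ∈ A}`. -/
theorem isSet_comp {A Y : M} (hA : Dom w A) (hY : Dom w Y) {P : W → M → M → Prop}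
    (hP : RestrDefinable w P) :
    IsSet w fun w' U => ∃ x, w' ⊩ x ∊ A ∧ IsComp w' U Y fun v y => P v x y := by
  refine isSet_bex hA (definable_isComp hP hY) fun w' hw x hx => ?_
  obtain ⟨U, hU⟩ := exists_isComp hP hw hx.dom_left (hY.up hw)
  exact (isSet_eq hU.1).congr fun v hv z =>
    ⟨fun h => (hU.up hv).congr h.symm, fun h => h.unique (hU.up hv)⟩

/-- The set `{({y ∈ Y | P x y}, {y ∈ Y | Q x y}) | x ∈ A}`. -/
theorem isSet_opair_comp {A Y : M} (hA : Dom w A) (hY : Dom w Y) {P Q : W → M → M → Prop}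
    (hP : RestrDefinable w P) (hQ : RestrDefinable w Q) :
    IsSet w fun w' z => ∃ x, w' ⊩ x ∊ A ∧ ∃ U V, w' ⊩ isOPairF z U V ∧
      IsComp w' U Y (fun v y => P v x y) ∧ IsComp w' V Y fun v y => Q v x y := by
  refine isSet_bex hA ?_ fun w' hw x hx => ?_
  · obtain ⟨φ, hφ⟩ := definable_isComp hP hY
    obtain ⟨ψ, hψ⟩ := definable_isComp hQ hY
    let τ : Ext (Ext (Elt w)) → Ext (Ext (Ext (Ext (Elt w)))) := fun
      | .new => .old .new
      | .old .new => .old (.old (.old .new))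
      | .old (.old v) => .old (.old (.old (.old v)))
    let σ : Ext (Ext (Elt w)) → Ext (Ext (Ext (Ext (Elt w)))) := fun
      | .new => .new
      | .old .new => .old (.old (.old .new))
      | .old (.old v) => .old (.old (.old (.old v)))
    refine ⟨form₂ fun x z => exF fun U => exF fun V => isOPairF z U V ⋏ φ.rename τ ⋏ ψ.rename σ, ?_⟩
    intro w' hw x z hx hz
    have hτ : ∀ U V, cons (cons (cons (cons Subtype.val x) z) U) V ∘ τ =
        cons (cons Subtype.val x) U := by
      intro U V; funext u
      rcases u with _ | _ | u <;> rfl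
    have hσ : ∀ U V, cons (cons (cons (cons Subtype.val x) z) U) V ∘ σ =
        cons (cons Subtype.val x) V := by
      intro U V; funext u
      rcases u with _ | _ | u <;> rfl
    simp only [sat_exF, sat_and, sat_rename', sat_isOPairF, cons_old, cons_new, hτ, hσ]
    constructor
    · rintro ⟨U, hU, V, hV, h₁, h₂, h₃⟩
      exact ⟨U, V, h₁, (hφ w' hw x U hx hU).1 h₂, (hψ w' hw x V hx hV).1 h₃⟩
    · rintro ⟨U, V, h₁, h₂, h₃⟩
      exact ⟨U, h₂.1, V, h₃.1, h₁, (hφ w' hw x U hx h₂.1).2 h₂, (hψ w' hw x V hx h₃.1).2 h₃⟩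
  · obtain ⟨U, hU⟩ := exists_isComp hP hw hx.dom_left (hY.up hw)
    obtain ⟨V, hV⟩ := exists_isComp hQ hw hx.dom_left (hY.up hw)
    refine (isSet_isOPairF hU.1 hV.1).congr fun v hv z => ⟨fun h => ?_, ?_⟩
    · exact ⟨U, V, h, hU.up hv, hV.up hv⟩
    · rintro ⟨U', V', h, hU', hV'⟩
      exact isOPairF_congr h (dom_of_isOPairF h).1.refl (hU'.unique (hU.up hv))
        (hV'.unique (hV.up hv))

/-- The family `({y ∈ Y | P x y})` indexed by `x ∈ A`, as a set of pairs. -/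
theorem isSet_family {A Y : M} (hA : Dom w A) (hY : Dom w Y) {P : W → M → M → Prop}
    (hP : RestrDefinable w P) :
    IsSet w fun w' z => ∃ x, w' ⊩ x ∊ A ∧ ∃ U, w' ⊩ isOPairF z x U ∧
      IsComp w' U Y fun v y => P v x y := by
  refine isSet_bex hA ?_ fun w' hw x hx => ?_
  · obtain ⟨φ, hφ⟩ := definable_isComp hP hY
    let τ : Ext (Ext (Elt w)) → Ext (Ext (Ext (Elt w))) := fun
      | .new => .new
      | .old .new => .old (.old .new)
      | .old (.old v) => .old (.old (.old v))
    refine ⟨form₂ fun x z => exF fun U => isOPairF z x U ⋏ φ.rename τ, ?_⟩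
    intro w' hw x z hx hz
    have hτ : ∀ U, cons (cons (cons Subtype.val x) z) U ∘ τ = cons (cons Subtype.val x) U := by
      intro U; funext u
      rcases u with _ | _ | u <;> rfl
    simp only [sat_exF, sat_and, sat_rename', sat_isOPairF, cons_old, cons_new, hτ]
    constructor
    · rintro ⟨U, hU, h₁, h₂⟩
      exact ⟨U, h₁, (hφ w' hw x U hx hU).1 h₂⟩
    · rintro ⟨U, h₁, h₂⟩
      exact ⟨U, h₂.1, h₁, (hφ w' hw x U hx h₂.1).2 h₂⟩
  · obtain ⟨U, hU⟩ := exists_isComp hP hw hx.dom_left (hY.up hw)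
    refine (isSet_isOPairF (hx.dom_left) hU.1).congr fun v hv z => ⟨fun h => ?_, ?_⟩
    · exact ⟨U, h, hU.up hv⟩
    · rintro ⟨U', h, hU'⟩
      exact isOPairF_congr h (dom_of_isOPairF h).1.refl (dom_of_isOPairF h).2.1.refl
        (hU'.unique (hU.up hv))

/-! ### Restricted formulas -/

section restricted
variable {V : Type} (a b c d : V)

@[simp] theorem restricted_bot : (.bot : Fml V).Restricted := .bot
@[simp] theorem restricted_mem : (a ∊ b).Restricted := .mem _ _
@[simp] theorem restricted_eq : (a ≐ b).Restricted := .eq _ _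

@[simp] theorem restricted_and {φ ψ : Fml V} :
    (φ ⋏ ψ).Restricted ↔ φ.Restricted ∧ ψ.Restricted :=
  ⟨fun h => by cases h with | and h₁ h₂ => exact ⟨h₁, h₂⟩, fun h => .and h.1 h.2⟩

@[simp] theorem restricted_or {φ ψ : Fml V} :
    (φ ⋎ ψ).Restricted ↔ φ.Restricted ∧ ψ.Restricted :=
  ⟨fun h => by cases h with | or h₁ h₂ => exact ⟨h₁, h₂⟩, fun h => .or h.1 h.2⟩

@[simp] theorem restricted_imp {φ ψ : Fml V} :
    (φ ⟾ ψ).Restricted ↔ φ.Restricted ∧ ψ.Restricted :=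
  ⟨fun h => by cases h with | imp h₁ h₂ => exact ⟨h₁, h₂⟩, fun h => .imp h.1 h.2⟩

@[simp] theorem restricted_ballF {φ : Ext V → Fml (Ext V)} :
    (ballF a φ).Restricted ↔ (φ .new).Restricted :=
  ⟨fun h => by cases h with | ball _ h => exact h, fun h => .ball _ h⟩

@[simp] theorem restricted_bexF {φ : Ext V → Fml (Ext V)} :
    (bexF a φ).Restricted ↔ (φ .new).Restricted :=
  ⟨fun h => by cases h with | bex _ h => exact h, fun h => .bex _ h⟩

@[simp] theorem restricted_subF : (subF a b).Restricted := by simp [subF]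
@[simp] theorem restricted_isPairF : (isPairF a b c).Restricted := by simp [isPairF]
@[simp] theorem restricted_isOPairF : (isOPairF a b c).Restricted := by simp [isOPairF]
@[simp] theorem restricted_relF : (relF a b c).Restricted := by simp [relF]
@[simp] theorem restricted_isRelF : (isRelF a b c).Restricted := by simp [isRelF]
@[simp] theorem restricted_isFunF : (isFunF a b c).Restricted := by simp [isFunF]
@[simp] theorem restricted_isSurjF : (isSurjF a b c).Restricted := by simp [isSurjF]
@[simp] theorem restricted_memFamF : (memFamF a b c).Restricted := by simp [memFamF]
@[simp] theorem restricted_memFam₂F : (memFam₂F a b c d).Restricted := by simp [memFam₂F]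

end restricted

/-! ### Natural numbers -/

theorem frc_sub {a b x : M} (h : w ⊩ subF a b) (hx : w ⊩ x ∊ a) : w ⊩ x ∊ b :=
  frc_subF.1 h w le_rfl x hx

theorem omega_exists (w : W) : ∃ o, Dom w o ∧ w ⊩ isOmegaF o := by
  have := sat_axiom (w := w) .strongInfinity (V := Empty) (ρ := fun v => v.elim) fun v => v.elim
  rw [strongInfinity] at this
  simpa using this

theorem mem_succ {m n x : M} (h : w ⊩ isSuccF m n) : w ⊩ x ∊ m ↔ w ⊩ x ∊ n ∨ w ⊩ x ≐ n := by
  rw [frc_isSuccF] at h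
  refine ⟨h.2.2 w le_rfl x, ?_⟩
  rintro (hx | hx)
  exacts [frc_sub h.1 hx, hx.symm.eq_mem h.2.1]

theorem omega_sub {o a : M} (ho : w ⊩ isOmegaF o) (ha : Dom w a) (h : w ⊩ isInductiveF a) :
    w ⊩ subF o a :=
  (frc_isOmegaF.1 ho).2 w le_rfl a ha w le_rfl h

theorem dom_omega {o : M} (ho : w ⊩ isOmegaF o) : Dom w o := by
  obtain ⟨⟨⟨z, hz, -⟩, -⟩, -⟩ := (frc_isOmegaF.1 ho).imp frc_isInductiveF.1 id
  exact hz.dom_right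

theorem exists_zero {o : M} (ho : w ⊩ isOmegaF o) : ∃ z, w ⊩ z ∊ o ∧ w ⊩ isEmptyF z :=
  (frc_isInductiveF.1 (frc_isOmegaF.1 ho).1).1

theorem exists_succ {o n : M} (ho : w ⊩ isOmegaF o) (hn : w ⊩ n ∊ o) :
    ∃ m, w ⊩ m ∊ o ∧ w ⊩ isSuccF m n :=
  (frc_isInductiveF.1 (frc_isOmegaF.1 ho).1).2 w le_rfl n hn

/-- Restricted Separation makes {n ∈ ω | P n} a set. It is inductive, and ω is the least inductive
set. -/
theorem omega_induction {o : M} (ho : w ⊩ isOmegaF o) {P : W → M → Prop}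
    (hP : RestrDefinable w fun v _ n => P v n)
    (zero : ∀ w', w ≤ w' → ∀ n, w' ⊩ n ∊ o → w' ⊩ isEmptyF n → P w' n)
    (succ : ∀ w', w ≤ w' → ∀ n m, w' ⊩ n ∊ o → w' ⊩ m ∊ o → w' ⊩ isSuccF m n → P w' n → P w' m)
    {n : M} (hn : w ⊩ n ∊ o) : P w n := by
  -- The first argument of the binary class is a dummy; any existing element can fill it.
  obtain ⟨s, hs, hsP⟩ := isSet_restr hP le_rfl (dom_omega ho) (dom_omega ho)
  refine ((hsP w le_rfl n).1 (frc_sub (omega_sub ho hs (frc_isInductiveF.2 ⟨?_, ?_⟩)) hn)).2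
  · obtain ⟨z, hz, hz'⟩ := exists_zero ho
    exact ⟨z, (hsP w le_rfl z).2 ⟨hz, zero w le_rfl z hz hz'⟩, hz'⟩
  · intro w' hw x hx
    obtain ⟨hx, hPx⟩ := (hsP w' hw x).1 hx
    obtain ⟨y, hy, hyx⟩ := exists_succ (ho.up hw) hx
    exact ⟨y, (hsP w' hw y).2 ⟨hy, succ w' hw x y hx hy hyx hPx⟩, hyx⟩

/-- There is no Foundation axiom, so this needs induction. The statement is strengthened by
transitivity of n, without which n + 1 ∈ n + 1 could not be reduced to n ∈ n. -/
theorem nat_irrefl {o n : M} (ho : w ⊩ isOmegaF o) (hn : w ⊩ n ∊ o) : ¬ w ⊩ n ∊ n := by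
  have := omega_induction ho (P := fun v n => (∀ v', v ≤ v' → ∀ x, v' ⊩ x ∊ n → v' ⊩ subF x n) ∧
    ∀ v', v ≤ v' → v' ⊩ n ∊ n → False)
    ⟨form₂ fun _ n => (ballF n fun x => subF x n) ⋏ (n ∊ n ⟾ .bot), by simp,
      fun _ _ _ _ _ _ => by simp⟩ ?_ ?_ hn
  · exact this.2 w le_rfl
  · intro w' hw n hn h
    rw [frc_isEmptyF] at h
    exact ⟨fun v hv x hx => (h v hv x hx).elim, fun v hv hx => h v hv n hx⟩
  · intro w' hw n m hn hm hmn ⟨h₁, h₂⟩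
    have hsub : w' ⊩ subF n m := (frc_isSuccF.1 hmn).1
    have hnm : w' ⊩ n ∊ m := (frc_isSuccF.1 hmn).2.1
    refine ⟨fun v hv x hx => ?_, fun v hv hx => ?_⟩
    · rcases (mem_succ (hmn.up hv)).1 hx with hx | hx
      · exact frc_subF.2 fun v' hv' y hy => frc_sub (hsub.up (hv.trans hv'))
          (frc_sub ((h₁ v hv x hx).up hv') hy)
      · exact subF_congr (hsub.up hv) hx.symm (hm.dom_left.up hv).refl
    · rcases (mem_succ (hmn.up hv)).1 hx with hx | hx
      · exact h₂ v hv (frc_sub (h₁ v hv m hx) (hnm.up hv))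
      · exact h₂ v hv ((hnm.up hv).mem_eq hx)

/-! ### Finitely enumerable subsets -/

/-- `b = a ∪ {x}`. -/
def IsInsert (w : W) (b a x : M) : Prop :=
  ∀ w', w ≤ w' → ∀ y, w' ⊩ y ∊ b ↔ w' ⊩ y ∊ a ∨ w' ⊩ y ≐ x

/-- The only appeal to the content of the Finite Powers Axiom. -/
theorem isSet_fun {o n S : M} (ho : w ⊩ isOmegaF o) (hn : w ⊩ n ∊ o) (hS : Dom w S) :
    IsSet w fun w' f => Dom w' f ∧ w' ⊩ isFunF f n S := by
  have : Sat w (finitePowers : Fml Empty) (fun v => v.elim) :=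
    K.models w (.inr rfl) fun v => v.elim
  rw [finitePowers] at this
  simp only [sat_allF, sat_imp, sat_ballF, sat_exF, sat_iff, sat_mem, sat_isFunF, sat_isOmegaF,
    cons_old, cons_new] at this
  obtain ⟨p, hp, h⟩ := this w le_rfl o (dom_omega ho) w le_rfl ho w le_rfl S hS w le_rfl n hn
  exact ⟨p, hp, fun w' hw f => ⟨fun hf => ⟨hf.dom_left, (h w' hw f hf.dom_left w' le_rfl).1 hf⟩,
    fun hf => (h w' hw f hf.1 w' le_rfl).2 hf.2⟩⟩

theorem isSet_finSeq {o S : M} (ho : w ⊩ isOmegaF o) (hS : Dom w S) :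
    IsSet w fun w' f => ∃ n, w' ⊩ n ∊ o ∧ Dom w' f ∧ w' ⊩ isFunF f n S :=
  isSet_bex (dom_omega ho) ⟨form₂ fun n f => isFunF f n (par hS), fun _ _ _ _ _ hz => by simp [hz]⟩
    fun _ hw _ hn => isSet_fun (ho.up hw) hn (hS.up hw)

theorem rel_right {r a b x y : M} (h : w ⊩ isRelF r a b) (hxy : w ⊩ relF r x y) :
    w ⊩ x ∊ a ∧ w ⊩ y ∊ b := by
  obtain ⟨p, hp, hpxy⟩ := frc_relF.1 hxy
  obtain ⟨x', hx', y', hy', hp'⟩ := frc_isRelF.1 h w le_rfl p hp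
  have := opair_inj hp' hpxy
  exact ⟨this.1.eq_mem hx', this.2.eq_mem hy'⟩

theorem isFunF_mono {f a b c : M} (h : w ⊩ isFunF f a b) (hbc : w ⊩ subF b c) :
    w ⊩ isFunF f a c := by
  rw [frc_isFunF] at h ⊢
  refine ⟨frc_isRelF.2 fun w' hw p hp => ?_, fun w' hw x hx => ?_⟩
  · obtain ⟨x, hx, y, hy, hp⟩ := frc_isRelF.1 h.1 w' hw p hp
    exact ⟨x, hx, y, frc_sub (hbc.up hw) hy, hp⟩
  · obtain ⟨y, hy, hxy, huniq⟩ := h.2 w' hw x hx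
    refine ⟨y, frc_sub (hbc.up hw) hy, hxy, fun w'' hw' z hz hxz => ?_⟩
    exact huniq w'' hw' z (rel_right (h.1.up (hw.trans hw')) hxz).2 hxz

/-- Every finitely enumerable subset is the range of a finite sequence in S. The finite sequences
form a set, so the ranges are collected by Replacement. -/
theorem isSet_finEnum {S : M} (hS : Dom w S) :
    IsSet w fun w' u => Dom w' u ∧ w' ⊩ subF u S ∧ w' ⊩ isFinEnumF u := by
  obtain ⟨o, -, ho⟩ := omega_exists w
  obtain ⟨F, hF, hF'⟩ := isSet_finSeq ho hS
  have : IsSet w fun w' u => ∃ n, w' ⊩ n ∊ o ∧ ∃ f, w' ⊩ f ∊ F ∧ Dom w' u ∧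
      w' ⊩ isSurjF f n u ∧ w' ⊩ subF u S := by
    refine isSet_bex (dom_omega ho) ⟨form₂ fun n u => bexF (par hF) fun f => isSurjF f n u ⋏
      subF u (par hS), fun _ _ _ _ _ h => by simp [h]⟩ fun w₁ h₁ n hn => ?_
    refine isSet_bex (hF.up h₁) ⟨form₂ fun f u => isSurjF f (par hn.dom_left) u ⋏
      subF u (par (hS.up h₁)), fun _ _ _ _ _ h => by simp [h]⟩ fun w₂ h₂ f hf => ?_
    have hn := hn.up h₂
    have hS := hS.up (h₁.trans h₂)
    obtain ⟨r, hr, hr'⟩ := isSet_restr (w := w₂) (P := fun v _ y => ∃ k, v ⊩ k ∊ n ∧ v ⊩ relF f k y)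
      ⟨form₂ fun _ y => bexF (par hn.dom_left) fun k => relF (par hf.dom_left) k y, by simp,
        fun _ _ _ _ _ _ => by simp⟩ le_rfl hS hS
    -- For fixed n and f the only candidate for u is the range r, so the sets u in question form a
    -- subset of s = {r}, separated by a restricted formula.
    obtain ⟨s, hs⟩ := pairing_exists hr hr
    refine (isSet_restr (w := w₂) (P := fun v _ u => Dom v u ∧ v ⊩ isSurjF f n u ∧ v ⊩ subF u S)
      ⟨form₂ fun _ u => isSurjF (par hf.dom_left) (par hn.dom_left) u ⋏ subF u (par hS), by simp,
        fun _ _ _ _ _ h => by simp [h]⟩ le_rfl hS (dom_of_isPairF hs).1).congr fun v hv u => ?_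
    rw [and_iff_right_iff_imp]
    rintro ⟨hu_dom, hu, huS⟩
    rw [mem_singleton (hs.up hv)]
    have hfu := (frc_isFunF.1 (frc_isSurjF.1 hu).1).1
    refine ext hu_dom (hr.up hv) fun v' hv' y => ⟨fun hy => ?_, fun hy => ?_⟩
    · exact (hr' v' (hv.trans hv') y).2 ⟨frc_sub (huS.up hv') hy,
        (frc_isSurjF.1 hu).2 v' hv' y hy⟩
    · obtain ⟨-, k, hk, hky⟩ := (hr' v' (hv.trans hv') y).1 hy
      exact (rel_right (hfu.up hv') hky).2
  refine this.congr fun w' hw u => ⟨?_, ?_⟩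
  · rintro ⟨n, hn, f, hf, hud, hu, huS⟩
    exact ⟨hud, huS, frc_isFinEnumF.2
      ⟨o, (dom_omega ho).up hw, ho.up hw, n, hn, f, hf.dom_left, hu⟩⟩
  · rintro ⟨hud, huS, hu⟩
    obtain ⟨o', ho'd, ho', n, hn, f, hf, hu⟩ := frc_isFinEnumF.1 hu
    -- The enumeration comes with its own copy of ω, which is included in o because o is inductive.
    have hn := frc_sub (omega_sub ho' ((dom_omega ho).up hw) (frc_isOmegaF.1 (ho.up hw)).1) hn
    refine ⟨n, hn, f, (hF' w' hw f).2 ⟨n, hn, hf, ?_⟩, hud, hu, huS⟩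
    exact isFunF_mono (frc_isSurjF.1 hu).1 huS

/-- `T` is the set of finitely enumerable subsets of `S`. -/
def IsFinSet (w : W) (T S : M) : Prop :=
  Dom w S ∧ Dom w T ∧ ∀ w', w ≤ w' → ∀ u, w' ⊩ u ∊ T ↔ Dom w' u ∧ w' ⊩ subF u S ∧ w' ⊩ isFinEnumF u

theorem IsFinSet.up {T S : M} (h : IsFinSet w T S) {w' : W} (hw : w ≤ w') : IsFinSet w' T S :=
  ⟨h.1.up hw, h.2.1.up hw, fun v hv => h.2.2 v (hw.trans hv)⟩

theorem finSet_exists {S : M} (hS : Dom w S) : ∃ T, IsFinSet w T S := by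
  obtain ⟨T, hT, h⟩ := isSet_finEnum hS
  exact ⟨T, hS, hT, h⟩

theorem IsFinSet.sub {T S u : M} (h : IsFinSet w T S) (hu : w ⊩ u ∊ T) : w ⊩ subF u S :=
  ((h.2.2 w le_rfl u).1 hu).2.1

theorem insert_exists {a x : M} (ha : Dom w a) (hx : Dom w x) :
    ∃ b, Dom w b ∧ IsInsert w b a x :=
  isSet_or (isSet_mem ha) (isSet_eq hx)

theorem isFinEnumF_empty {u : M} (hu : Dom w u) (h : w ⊩ isEmptyF u) : w ⊩ isFinEnumF u := by
  obtain ⟨o, hod, ho⟩ := omega_exists w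
  obtain ⟨z, hz, hz'⟩ := exists_zero ho
  rw [frc_isEmptyF] at h hz'
  refine frc_isFinEnumF.2 ⟨o, hod, ho, z, hz, u, hu, frc_isSurjF.2 ⟨frc_isFunF.2 ⟨?_, ?_⟩, ?_⟩⟩
  · exact frc_isRelF.2 fun v hv p hp => (h v hv p hp).elim
  · exact fun v hv p hp => (hz' v hv p hp).elim
  · exact fun v hv p hp => (h v hv p hp).elim

theorem empty_mem_finSet {T S : M} (hT : IsFinSet w T S) :
    ∃ u, w ⊩ u ∊ T ∧ w ⊩ isEmptyF u := by
  obtain ⟨o, -, ho⟩ := omega_exists w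
  obtain ⟨z, hz, hz'⟩ := exists_zero ho
  refine ⟨z, (hT.2.2 w le_rfl z).2 ⟨hz.dom_left, frc_subF.2 fun v hv x hx => ?_,
    isFinEnumF_empty hz.dom_left hz'⟩, hz'⟩
  exact (frc_isEmptyF.1 hz' v hv x hx).elim

/-- An enumeration f on n is extended to n + 1 by the pair (n, x). The extension is single-valued
because n is not an element of n. -/
theorem isFinEnumF_insert {u v x : M} (hx : Dom w x) (hu : w ⊩ isFinEnumF u)
    (h : IsInsert w v u x) : w ⊩ isFinEnumF v := by
  obtain ⟨o, hod, ho, n, hn, f, hf, hfu⟩ := frc_isFinEnumF.1 hu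
  obtain ⟨m, hm, hmn⟩ := exists_succ ho hn
  obtain ⟨p, hp⟩ := opair_exists hn.dom_left hx
  obtain ⟨g, hg, hgf⟩ := insert_exists hf (dom_of_isOPairF hp).1
  rw [frc_isSurjF, frc_isFunF] at hfu
  obtain ⟨⟨hrel, hfun⟩, hsurj⟩ := hfu
  have hgrel : ∀ w', w ≤ w' → ∀ k y, w' ⊩ relF g k y →
      w' ⊩ relF f k y ∨ (w' ⊩ k ≐ n ∧ w' ⊩ y ≐ x) := by
    intro w' hw k y hky
    obtain ⟨q, hq, hqky⟩ := frc_relF.1 hky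
    rcases (hgf w' hw q).1 hq with hq | hq
    · exact .inl (relF_intro hqky hq)
    · exact .inr (opair_inj hqky (isOPairF_congr (hp.up hw) hq.symm (hn.dom_left.up hw).refl
        (hx.up hw).refl))
  have hgf' : ∀ w', w ≤ w' → ∀ k y, w' ⊩ relF f k y → w' ⊩ relF g k y := by
    intro w' hw k y hky
    obtain ⟨q, hq, hqky⟩ := frc_relF.1 hky
    exact relF_intro hqky ((hgf w' hw q).2 (.inl hq))
  have hgn : w ⊩ relF g n x :=
    relF_intro hp ((hgf w le_rfl p).2 (.inr (dom_of_isOPairF hp).1.refl))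
  have hnn : ∀ w', w ≤ w' → ¬ w' ⊩ n ∊ n := fun w' hw => nat_irrefl (ho.up hw) (hn.up hw)
  refine frc_isFinEnumF.2 ⟨o, hod, ho, m, hm, g, hg, frc_isSurjF.2 ⟨frc_isFunF.2 ⟨?_, ?_⟩, ?_⟩⟩
  · refine frc_isRelF.2 fun w' hw q hq => ?_
    rcases (hgf w' hw q).1 hq with hq | hq
    · obtain ⟨k, hk, y, hy, hqky⟩ := frc_isRelF.1 hrel w' hw q hq
      exact ⟨k, (mem_succ (hmn.up hw)).2 (.inl hk), y, (h w' hw y).2 (.inl hy), hqky⟩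
    · exact ⟨n, (mem_succ (hmn.up hw)).2 (.inr (hn.dom_left.up hw).refl), x,
        (h w' hw x).2 (.inr (hx.up hw).refl),
        isOPairF_congr (hp.up hw) hq.symm (hn.dom_left.up hw).refl (hx.up hw).refl⟩
  · intro w' hw k hk
    rcases (mem_succ (hmn.up hw)).1 hk with hk | hk
    · obtain ⟨y, hy, hky, huniq⟩ := hfun w' hw k hk
      refine ⟨y, (h w' hw y).2 (.inl hy), hgf' w' hw k y hky, fun w'' hw' z hz hkz => ?_⟩
      rcases hgrel w'' (hw.trans hw') k z hkz with hkz | hkz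
      · exact huniq w'' hw' z (rel_right (hrel.up (hw.trans hw')) hkz).2 hkz
      · exact (hnn w'' (hw.trans hw') (hkz.1.eq_mem (hk.up hw'))).elim
    · refine ⟨x, (h w' hw x).2 (.inr (hx.up hw).refl),
        relF_congr (hgn.up hw) hk.symm (hx.up hw).refl, fun w'' hw' z hz hkz => ?_⟩
      rcases hgrel w'' (hw.trans hw') k z hkz with hkz | hkz
      · exact (hnn w'' (hw.trans hw') ((hk.up hw').eq_mem
          (rel_right (hrel.up (hw.trans hw')) hkz).1)).elim
      · exact hkz.2
  · intro w' hw y hy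
    rcases (h w' hw y).1 hy with hy | hy
    · obtain ⟨k, hk, hky⟩ := hsurj w' hw y hy
      exact ⟨k, (mem_succ (hmn.up hw)).2 (.inl hk), hgf' w' hw k y hky⟩
    · exact ⟨n, (mem_succ (hmn.up hw)).2 (.inr (hn.dom_left.up hw).refl),
        relF_congr (hgn.up hw) (hn.dom_left.up hw).refl hy.symm⟩

theorem insert_mem_finSet {T S u x : M} (hT : IsFinSet w T S) (hu : w ⊩ u ∊ T)
    (hx : w ⊩ x ∊ S) : ∃ v, w ⊩ v ∊ T ∧ IsInsert w v u x := by
  obtain ⟨v, hv, hvu⟩ := insert_exists hu.dom_left hx.dom_left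
  refine ⟨v, (hT.2.2 w le_rfl v).2 ⟨hv, frc_subF.2 fun w' hw y hy => ?_,
    isFinEnumF_insert hx.dom_left ((hT.2.2 w le_rfl u).1 hu).2.2 hvu⟩, hvu⟩
  rcases (hvu w' hw y).1 hy with hy | hy
  exacts [frc_sub ((hT.sub hu).up hw) hy, hy.symm.eq_mem (hx.up hw)]

/-- Induction on the length of an enumeration. The hypothesis quantifies over all enumerations f and
all u, which stays a restricted formula because f ranges over the set F of finite sequences and u
over the set T. -/
theorem finSet_induction {T S : M} (hT : IsFinSet w T S) {P : W → M → Prop}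
    (hP : RestrDefinable w fun v _ u => P v u)
    (empty : ∀ w', w ≤ w' → ∀ u, w' ⊩ u ∊ T → w' ⊩ isEmptyF u → P w' u)
    (insert : ∀ w', w ≤ w' → ∀ u x v, w' ⊩ u ∊ T → w' ⊩ x ∊ S → w' ⊩ v ∊ T → IsInsert w' v u x →
      P w' u → P w' v) {u : M} (hu : w ⊩ u ∊ T) : P w u := by
  obtain ⟨Y, hY, hYP⟩ := isSet_restr hP le_rfl hT.1 hT.2.1
  obtain ⟨o, -, ho⟩ := omega_exists w
  obtain ⟨F, hF, hF'⟩ := isSet_finSeq ho hT.1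
  -- The conclusion P u is expressed as membership in Y = {u ∈ T | P u}, an atomic formula.
  have key : ∀ n, w ⊩ n ∊ o → ∀ w', w ≤ w' → ∀ f, w' ⊩ f ∊ F → ∀ w'', w' ≤ w'' → ∀ u, w'' ⊩ u ∊ T →
      ∀ v, w'' ≤ v → v ⊩ isSurjF f n u → v ⊩ u ∊ Y := by
    intro n hn
    refine omega_induction ho (P := fun w n => ∀ w', w ≤ w' → ∀ f, w' ⊩ f ∊ F → ∀ w'', w' ≤ w'' →
      ∀ u, w'' ⊩ u ∊ T → ∀ v, w'' ≤ v → v ⊩ isSurjF f n u → v ⊩ u ∊ Y)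
      ⟨form₂ fun _ n => ballF (par hF) fun f => ballF (par hT.2.1) fun u =>
        isSurjF f n u ⟾ u ∊ par hY, by simp, fun _ _ _ _ _ _ => by simp⟩ ?_ ?_ hn
    · intro w₀ h₀ n hn hn0 w₁ h₁ f hf w₂ h₂ u hu w₃ h₃ hfu
      have h₀₃ := h₁.trans (h₂.trans h₃)
      refine (hYP w₃ (h₀.trans h₀₃) u).2 ⟨hu.up h₃, empty w₃ (h₀.trans h₀₃) u (hu.up h₃) ?_⟩
      rw [frc_isEmptyF]
      intro v hv y hy
      obtain ⟨k, hk, -⟩ := (frc_isSurjF.1 hfu).2 v hv y hy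
      exact frc_isEmptyF.1 hn0 v (h₀₃.trans hv) k hk
    · intro w₀ h₀ n m hn hm hmn ih w₁ h₁ f hf w₂ h₂ u hu w₃ h₃ hfu
      have h₀₃ := h₁.trans (h₂.trans h₃)
      have hw := h₀.trans h₀₃
      have hmn := hmn.up h₀₃
      have hn := hn.up h₀₃
      have hu := hu.up h₃
      have hT := hT.up hw
      have hf := hf.up (h₂.trans h₃)
      rw [frc_isSurjF, frc_isFunF] at hfu
      obtain ⟨⟨hrel, hfun⟩, hsurj⟩ := hfu
      have hnm : w₃ ⊩ n ∊ m := (mem_succ hmn).2 (.inr hn.dom_left.refl)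
      obtain ⟨x, hx, hnx, hxuniq⟩ := hfun w₃ le_rfl n hnm
      -- With f defined on n + 1 and x = f(n), let u₀ be the image of n and f₀ the restriction of f
      -- to n. Then f₀ enumerates u₀, and u is u₀ with x inserted.
      obtain ⟨u₀, hu₀, hu₀'⟩ := isSet_restr (w := w₃) (P := fun v _ y => ∃ k, v ⊩ k ∊ n ∧
        v ⊩ relF f k y) ⟨form₂ fun _ y => bexF (par hn.dom_left) fun k =>
          relF (par hf.dom_left) k y, by simp, fun _ _ _ _ _ _ => by simp⟩ le_rfl hT.1 hu.dom_left
      obtain ⟨f₀, hf₀, hf₀'⟩ := isSet_restr (w := w₃) (P := fun v _ p => ∃ k, v ⊩ k ∊ n ∧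
        ∃ y, v ⊩ y ∊ u ∧ v ⊩ isOPairF p k y) ⟨form₂ fun _ p => bexF (par hn.dom_left) fun k =>
          bexF (par hu.dom_left) fun y => isOPairF p k y, by simp, fun _ _ _ _ _ _ => by simp⟩
          le_rfl hT.1 hf.dom_left
      have hsub : ∀ v, w₃ ≤ v → ∀ k, v ⊩ k ∊ n → v ⊩ k ∊ m := fun v hv k hk =>
        (mem_succ (hmn.up hv)).2 (.inl hk)
      have hrel₀ : ∀ v, w₃ ≤ v → ∀ k y, v ⊩ relF f₀ k y ↔ v ⊩ k ∊ n ∧ v ⊩ relF f k y := by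
        intro v hv k y
        constructor
        · intro h
          obtain ⟨p, hp, hpky⟩ := frc_relF.1 h
          obtain ⟨hp, k', hk', y', hy', hpky'⟩ := (hf₀' v hv p).1 hp
          exact ⟨(opair_inj hpky' hpky).1.eq_mem hk', relF_intro hpky hp⟩
        · rintro ⟨hk, h⟩
          obtain ⟨p, hp, hpky⟩ := frc_relF.1 h
          exact relF_intro hpky ((hf₀' v hv p).2
            ⟨hp, k, hk, y, (rel_right (hrel.up hv) h).2, hpky⟩)
      have hsurj₀ : w₃ ⊩ isSurjF f₀ n u₀ := by
        refine frc_isSurjF.2 ⟨frc_isFunF.2 ⟨frc_isRelF.2 ?_, ?_⟩, ?_⟩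
        · intro v hv p hp
          obtain ⟨hp, k, hk, y, hy, hpky⟩ := (hf₀' v hv p).1 hp
          exact ⟨k, hk, y, (hu₀' v hv y).2 ⟨hy, k, hk, relF_intro hpky hp⟩, hpky⟩
        · intro v hv k hk
          obtain ⟨y, hy, hky, huniq⟩ := hfun v hv k (hsub v hv k hk)
          refine ⟨y, (hu₀' v hv y).2 ⟨hy, k, hk, hky⟩, (hrel₀ v hv k y).2 ⟨hk, hky⟩, ?_⟩
          intro v' hv' z hz hkz
          exact huniq v' hv' z ((hu₀' v' (hv.trans hv') z).1 hz).1
            ((hrel₀ v' (hv.trans hv') k z).1 hkz).2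
        · intro v hv y hy
          obtain ⟨-, k, hk, hky⟩ := (hu₀' v hv y).1 hy
          exact ⟨k, hk, (hrel₀ v hv k y).2 ⟨hk, hky⟩⟩
      have hsubS : w₃ ⊩ subF u₀ S := frc_subF.2 fun v hv y hy =>
        frc_sub ((hT.sub hu).up hv) ((hu₀' v hv y).1 hy).1
      have hu₀T : w₃ ⊩ u₀ ∊ T := (hT.2.2 w₃ le_rfl u₀).2 ⟨hu₀, hsubS, frc_isFinEnumF.2
        ⟨o, (dom_omega ho).up hw, ho.up hw, n, hn, f₀, hf₀, hsurj₀⟩⟩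
      have hf₀F : w₃ ⊩ f₀ ∊ F := (hF' w₃ hw f₀).2
        ⟨n, hn, hf₀, isFunF_mono (frc_isSurjF.1 hsurj₀).1 hsubS⟩
      have hu₀Y := ih w₃ h₀₃ f₀ hf₀F w₃ le_rfl u₀ hu₀T w₃ le_rfl hsurj₀
      refine (hYP w₃ hw u).2 ⟨hu, insert w₃ hw u₀ x u hu₀T (frc_sub (hT.sub hu) hx) hu ?_
        ((hYP w₃ hw u₀).1 hu₀Y).2⟩
      intro v hv y
      constructor
      · intro hy
        obtain ⟨k, hk, hky⟩ := hsurj v hv y hy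
        rcases (mem_succ (hmn.up hv)).1 hk with hk | hk
        · exact .inl ((hu₀' v hv y).2 ⟨hy, k, hk, hky⟩)
        · exact .inr (hxuniq v hv y hy (relF_congr hky hk hy.dom_left.refl))
      · rintro (hy | hy)
        exacts [((hu₀' v hv y).1 hy).1, hy.symm.eq_mem (hx.up hv)]
  obtain ⟨hud, huS, hufin⟩ := (hT.2.2 w le_rfl u).1 hu
  obtain ⟨o', ho'd, ho', n, hn, f, hf, hfu⟩ := frc_isFinEnumF.1 hufin
  have hn := frc_sub (omega_sub ho' (dom_omega ho) (frc_isOmegaF.1 ho).1) hn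
  have hfF := (hF' w le_rfl f).2 ⟨n, hn, hf, isFunF_mono (frc_isSurjF.1 hfu).1 huS⟩
  exact ((hYP w le_rfl u).1 (key n hn w le_rfl f hfF w le_rfl u hu w le_rfl hfu)).2

end model

/-! ### Forcing clauses for covers, formal topology maps and set-generation -/

section forcing
variable {W : Type 1} {M : Type} [K : Kripke W M] {w : W} {V : Type} {ρ : V → M}

/-- `i ∈ J = I(a)`, where `J` is reached through the elements `p` of `I` and `t` of `p`. -/
def FamWit (w : W) (I a p t J i : M) : Prop :=
  w ⊩ p ∊ I ∧ w ⊩ t ∊ p ∧ w ⊩ J ∊ t ∧ w ⊩ isOPairF p a J ∧ w ⊩ i ∊ J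

@[simp] theorem exists_famWit {I a : M} {R : M → Prop} :
    (∃ p t J i, FamWit w I a p t J i ∧ R i) ↔ ∃ i, w ⊩ memFamF I a i ∧ R i := by
  simp only [frc_memFamF, FamWit]
  constructor
  · rintro ⟨p, t, J, i, ⟨h₁, h₂, h₃, h₄, h₅⟩, h⟩
    exact ⟨i, ⟨p, h₁, t, h₂, J, h₃, h₄, h₅⟩, h⟩
  · rintro ⟨i, ⟨p, h₁, t, h₂, J, h₃, h₄, h₅⟩, h⟩
    exact ⟨p, t, J, i, ⟨h₁, h₂, h₃, h₄, h₅⟩, h⟩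

@[simp] theorem sat_exFamF (I a : V)
    (φ : Ext (Ext (Ext (Ext V))) → Fml (Ext (Ext (Ext (Ext V))))) :
    Sat w (exFamF I a φ) ρ ↔ ∃ p t J i, FamWit w (ρ I) (ρ a) p t J i ∧
      Sat w (φ .new) (cons (cons (cons (cons ρ p) t) J) i) := by
  rw [exFamF]
  simp only [sat_bexF, sat_and, sat_isOPairF, cons_old, cons_new, FamWit]
  constructor
  · rintro ⟨p, h₁, t, h₂, J, h₃, h₄, i, h₅, h⟩
    exact ⟨p, t, J, i, ⟨h₁, h₂, h₃, h₄, h₅⟩, h⟩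
  · rintro ⟨p, t, J, i, ⟨h₁, h₂, h₃, h₄, h₅⟩, h⟩
    exact ⟨p, h₁, t, h₂, J, h₃, h₄, i, h₅, h⟩

@[simp] theorem sat_coverF (S I C a : V) (φ : Ext (Ext (Ext (Ext (Ext V)))) →
    Fml (Ext (Ext (Ext (Ext (Ext V)))))) :
    Sat w (coverF S I C a φ) ρ ↔ ∃ p t J i, FamWit w (ρ I) (ρ a) p t J i ∧
      ∀ w', w ≤ w' → ∀ c, w' ⊩ c ∊ ρ S → w' ⊩ memFam₂F (ρ C) (ρ a) i c →
        Sat w' (φ .new) (cons (cons (cons (cons (cons ρ p) t) J) i) c) := by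
  rw [coverF, sat_exFamF]
  simp only [sat_ballF, sat_imp, sat_memFam₂F, cons_old, cons_new]
  refine exists_congr fun p => exists_congr fun t => exists_congr fun J => exists_congr fun i =>
    and_congr_right fun _ => ⟨fun h w₁ h₁ c hc => h w₁ h₁ c hc w₁ le_rfl, ?_⟩
  exact fun h w₁ h₁ c hc w₂ h₂ => h w₂ (h₁.trans h₂) c (hc.up h₂)

/-- `a ◁ {c ∈ S | Q c}` for the relation presented by `(I, C)`. -/
def Cover (w : W) (S I C a : M) (Q : W → M → Prop) : Prop :=
  ∃ i, w ⊩ memFamF I a i ∧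
    ∀ w', w ≤ w' → ∀ c, w' ⊩ c ∊ S → w' ⊩ memFam₂F C a i c → Q w' c

theorem Cover.mono {S I C a : M} {Q Q' : W → M → Prop} (h : Cover w S I C a Q)
    (hQ : ∀ w', w ≤ w' → ∀ c, w' ⊩ c ∊ S → Q w' c → Q' w' c) : Cover w S I C a Q' :=
  h.imp fun _ h => ⟨h.1, fun w' hw c hc hc' => hQ w' hw c hc (h.2 w' hw c hc hc')⟩

theorem Cover.up {S I C a : M} {Q : W → M → Prop} (h : Cover w S I C a Q) {w' : W}
    (hw : w ≤ w') : Cover w' S I C a Q :=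
  h.imp fun _ h => ⟨h.1.up hw, fun v hv => h.2 v (hw.trans hv)⟩

/-- Here and in the next statements, the chain of future worlds created by nested quantifiers and
implications is replaced by its last member, to which all hypotheses persist. -/
theorem frc_isSigmaF {D S I : M} : w ⊩ isSigmaF D S I ↔
    (∀ w', w ≤ w' → ∀ p, w' ⊩ p ∊ D →
      ∃ a, w' ⊩ a ∊ S ∧ ∃ i, w' ⊩ memFamF I a i ∧ w' ⊩ isOPairF p a i) ∧
    ∀ w', w ≤ w' → ∀ a, w' ⊩ a ∊ S → ∀ i, w' ⊩ memFamF I a i →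
      ∃ p, w' ⊩ p ∊ D ∧ w' ⊩ isOPairF p a i := by
  rw [Frc, isSigmaF]
  simp only [sat_and, sat_ballF, sat_bexF, sat_exFamF, sat_isOPairF, sat_allF, sat_imp,
    sat_memFamF, cons_old, cons_new, id, exists_famWit]
  refine and_congr_right fun _ => ⟨fun h w₁ h₁ a ha i hi => ?_, fun h => ?_⟩
  · have : Dom w₁ i := by
      obtain ⟨p, -, t, -, u, -, -, h⟩ := frc_memFamF.1 hi
      exact h.dom_left
    exact h w₁ h₁ a ha w₁ le_rfl i this w₁ le_rfl hi
  · intro w₁ h₁ a ha w₂ h₂ i _ w₃ h₃ hi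
    exact h w₃ (h₁.trans (h₂.trans h₃)) a (ha.up (h₂.trans h₃)) i hi

theorem frc_isAxiomSetF {S I C : M} : w ⊩ isAxiomSetF S I C ↔ w ⊩ isFamilyF I S ∧
    (∃ D, Dom w D ∧ w ⊩ isSigmaF D S I ∧ w ⊩ isFamilyF C D) ∧
    ∀ w', w ≤ w' → ∀ a i c, w' ⊩ memFam₂F C a i c → w' ⊩ c ∊ S := by
  rw [Frc, isAxiomSetF]
  simp only [sat_and, sat_isFamilyF, sat_exF, sat_isSigmaF, sat_allF, sat_imp, sat_memFam₂F,
    sat_mem, cons_old, cons_new, id]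
  refine and_congr_right fun _ => and_congr_right fun _ => ⟨fun h w₁ h₁ a i c hc => ?_, fun h => ?_⟩
  · obtain ⟨p, -, t, -, q, -, u, -, hq, -, hcu⟩ := frc_memFam₂F.1 hc
    exact h w₁ h₁ a (dom_of_isOPairF hq).2.1 w₁ le_rfl i (dom_of_isOPairF hq).2.2 w₁ le_rfl c
      hcu.dom_left w₁ le_rfl hc
  · intro w₁ h₁ a _ w₂ h₂ i _ w₃ h₃ c _ w₄ h₄ hc
    exact h w₄ (h₁.trans (h₂.trans (h₃.trans h₄))) a i c hc

theorem frc_isFTopMapF {S le I C T le' J D r : M} : w ⊩ isFTopMapF S le I C T le' J D r ↔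
    w ⊩ isRelF r S T ∧
    (∀ w', w ≤ w' → ∀ a, w' ⊩ a ∊ S → Cover w' S I C a fun v c =>
      ∃ d, v ⊩ d ∊ T ∧ v ⊩ relF r c d) ∧
    (∀ w', w ≤ w' → ∀ b₁ b₂ a x y, w' ⊩ b₁ ∊ T → w' ⊩ b₂ ∊ T → w' ⊩ a ∊ S → w' ⊩ x ∊ S →
      w' ⊩ y ∊ S → w' ⊩ relF r x b₁ → w' ⊩ relF r y b₂ → w' ⊩ relF le a x → w' ⊩ relF le a y →
      Cover w' S I C a fun v c =>
        ∃ d, v ⊩ d ∊ T ∧ v ⊩ relF le' d b₁ ∧ v ⊩ relF le' d b₂ ∧ v ⊩ relF r c d) ∧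
    (∀ w', w ≤ w' → ∀ b₁ b₂ a, w' ⊩ b₁ ∊ T → w' ⊩ b₂ ∊ T → w' ⊩ relF le' b₁ b₂ → w' ⊩ a ∊ S →
      w' ⊩ relF r a b₁ → Cover w' S I C a fun v c => v ⊩ relF r c b₂) ∧
    ∀ w', w ≤ w' → ∀ b j a, w' ⊩ b ∊ T → w' ⊩ memFamF J b j → w' ⊩ a ∊ S → w' ⊩ relF r a b →
      Cover w' S I C a fun v c => ∃ d, v ⊩ d ∊ T ∧ v ⊩ memFam₂F D b j d ∧ v ⊩ relF r c d := by
  rw [Frc, isFTopMapF]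
  simp only [sat_and, sat_isRelF, sat_ballF, sat_bexF, sat_coverF, sat_relF, sat_allF, sat_imp,
    sat_memFamF, sat_memFam₂F, cons_old, cons_new, id, exists_famWit]
  refine and_congr_right fun _ => and_congr_right fun _ => and_congr ?_ (and_congr ?_ ?_)
  · constructor
    · intro h w₁ h₁ b₁ b₂ a x y hb₁ hb₂ ha hx hy hxb hyb hax hay
      exact h w₁ h₁ b₁ hb₁ w₁ le_rfl b₂ hb₂ w₁ le_rfl a ha w₁ le_rfl
        ⟨x, hx, y, hy, hxb, hyb, hax, hay⟩
    · rintro h w₁ h₁ b₁ hb₁ w₂ h₂ b₂ hb₂ w₃ h₃ a ha w₄ h₄ ⟨x, hx, y, hy, hxb, hyb, hax, hay⟩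
      exact h w₄ (h₁.trans (h₂.trans (h₃.trans h₄))) b₁ b₂ a x y (hb₁.up (h₂.trans (h₃.trans h₄)))
        (hb₂.up (h₃.trans h₄)) (ha.up h₄) hx hy hxb hyb hax hay
  · constructor
    · intro h w₁ h₁ b₁ b₂ a hb₁ hb₂ hb ha hab
      exact h w₁ h₁ b₁ hb₁ w₁ le_rfl b₂ hb₂ w₁ le_rfl hb w₁ le_rfl a ha w₁ le_rfl hab
    · intro h w₁ h₁ b₁ hb₁ w₂ h₂ b₂ hb₂ w₃ h₃ hb w₄ h₄ a ha w₅ h₅ hab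
      have h₃₅ := h₄.trans h₅
      exact h w₅ (h₁.trans (h₂.trans (h₃.trans h₃₅))) b₁ b₂ a (hb₁.up (h₂.trans (h₃.trans h₃₅)))
        (hb₂.up (h₃.trans h₃₅)) (hb.up h₃₅) (ha.up h₅) hab
  · constructor
    · intro h w₁ h₁ b j a hb hj ha hab
      have : Dom w₁ j := by
        obtain ⟨p, -, t, -, u, -, -, h⟩ := frc_memFamF.1 hj
        exact h.dom_left
      exact h w₁ h₁ b hb w₁ le_rfl j this w₁ le_rfl hj w₁ le_rfl a ha w₁ le_rfl hab
    · intro h w₁ h₁ b hb w₂ h₂ j _ w₃ h₃ hj w₄ h₄ a ha w₅ h₅ hab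
      have h₃₅ := h₄.trans h₅
      exact h w₅ (h₁.trans (h₂.trans (h₃.trans h₃₅))) b j a (hb.up (h₂.trans (h₃.trans h₃₅)))
        (hj.up h₃₅) (ha.up h₅) hab

theorem isSetPresentedFTopF_intro {S le I C : M} (hle : w ⊩ isPreorderF S le)
    (hIC : w ⊩ isAxiomSetF S I C)
    (refl : ∀ w', w ≤ w' → ∀ U, w' ⊩ subF U S → ∀ a, w' ⊩ a ∊ U →
      Cover w' S I C a fun v c => v ⊩ c ∊ U)
    (trans : ∀ w', w ≤ w' → ∀ U U' a, w' ⊩ subF U S → w' ⊩ subF U' S → w' ⊩ a ∊ S →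
      Cover w' S I C a (fun v c => v ⊩ c ∊ U) →
      (∀ w'', w' ≤ w'' → ∀ b, w'' ⊩ b ∊ U → Cover w'' S I C b fun v c => v ⊩ c ∊ U') →
        Cover w' S I C a fun v c => v ⊩ c ∊ U')
    (down : ∀ w', w ≤ w' → ∀ U U' a, w' ⊩ subF U S → w' ⊩ subF U' S → w' ⊩ a ∊ S →
      Cover w' S I C a (fun v c => v ⊩ c ∊ U) → Cover w' S I C a (fun v c => v ⊩ c ∊ U') →
        Cover w' S I C a fun v c => ∃ u, v ⊩ u ∊ U ∧ ∃ u', v ⊩ u' ∊ U' ∧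
          v ⊩ relF le c u ∧ v ⊩ relF le c u')
    (le_cover : ∀ w', w ≤ w' → ∀ a b, w' ⊩ a ∊ S → w' ⊩ b ∊ S → w' ⊩ relF le a b →
      Cover w' S I C a fun v c => v ⊩ c ≐ b) : w ⊩ isSetPresentedFTopF S le I C := by
  rw [Frc, isSetPresentedFTopF]
  simp only [sat_and, sat_isPreorderF, sat_isAxiomSetF, sat_subF, sat_mem, sat_eq, sat_ballF,
    sat_bexF, sat_coverF, sat_relF, sat_allF, sat_imp, cons_old, cons_new, id, exists_famWit]
  refine ⟨hle, hIC, ?_, ?_, ?_, ?_⟩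
  · intro w₁ h₁ U _ w₂ h₂ hU w₃ h₃ a ha
    exact refl w₃ (h₁.trans (h₂.trans h₃)) U (hU.up h₃) a ha
  · intro w₁ h₁ U _ w₂ h₂ U' _ w₃ h₃ hU w₄ h₄ hU' w₅ h₅ a ha w₆ h₆ haU w₇ h₇ hUU'
    have h₅₇ := h₆.trans h₇
    have h₄₇ := h₅.trans h₅₇
    have h₃₇ := h₄.trans h₄₇
    exact trans w₇ (h₁.trans (h₂.trans (h₃.trans h₃₇))) U U' a (hU.up h₃₇) (hU'.up h₄₇)
      (ha.up h₅₇) (Cover.up haU h₇) hUU'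
  · intro w₁ h₁ U _ w₂ h₂ U' _ w₃ h₃ hU w₄ h₄ hU' w₅ h₅ a ha w₆ h₆ haU w₇ h₇ haU'
    have h₅₇ := h₆.trans h₇
    have h₄₇ := h₅.trans h₅₇
    have h₃₇ := h₄.trans h₄₇
    exact down w₇ (h₁.trans (h₂.trans (h₃.trans h₃₇))) U U' a (hU.up h₃₇) (hU'.up h₄₇)
      (ha.up h₅₇) (Cover.up haU h₇) haU'
  · intro w₁ h₁ a ha w₂ h₂ b hb w₃ h₃ hab
    exact le_cover w₃ (h₁.trans (h₂.trans h₃)) a b (ha.up (h₂.trans h₃)) (hb.up h₃) hab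

theorem sat_setGeneratedF (φ : Ext V → Fml (Ext V)) : Sat w (setGeneratedF φ) ρ ↔
    ∃ G, Dom w G ∧ (∀ w', w ≤ w' → ∀ β, w' ⊩ β ∊ G → Sat w' (φ .new) (cons ρ β)) ∧
      ∀ w', w ≤ w' → ∀ α, Dom w' α → Sat w' (φ .new) (cons ρ α) → ∀ x, w' ⊩ x ∊ α →
        ∃ β, w' ⊩ β ∊ G ∧ w' ⊩ x ∊ β ∧ w' ⊩ subF β α := by
  rw [setGeneratedF]
  simp only [sat_exF, sat_and, sat_ballF, sat_rename', sat_allF, sat_imp, sat_bexF, sat_mem,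
    sat_subF, cons_old, cons_new, cons_comp_map', cons_comp_old]
  refine exists_congr fun G => and_congr_right fun _ => and_congr_right fun _ => ⟨?_, ?_⟩
  · exact fun h w₁ h₁ α hα hφ x hx => h w₁ h₁ α hα w₁ le_rfl hφ w₁ le_rfl x hx
  · exact fun h w₁ h₁ α hα w₂ h₂ hφ w₃ h₃ x hx =>
      h w₃ (h₁.trans (h₂.trans h₃)) α (hα.up (h₂.trans h₃)) (hφ.up h₃) x hx

/-- The class `P` is set-generated at the world `w`. -/
def SetGenerated (w : W) (P : W → M → Prop) : Prop :=
  ∃ G, Dom w G ∧ (∀ w', w ≤ w' → ∀ β, w' ⊩ β ∊ G → P w' β) ∧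
    ∀ w', w ≤ w' → ∀ α, Dom w' α → P w' α → ∀ x, w' ⊩ x ∊ α →
      ∃ β, w' ⊩ β ∊ G ∧ w' ⊩ x ∊ β ∧ w' ⊩ subF β α

theorem sat_finitaryNID : Sat w (finitaryNID : Fml V) ρ ↔ ∀ w', w ≤ w' → ∀ S R, Dom w' S →
    Dom w' R → w' ⊩ isFinitaryRuleSetF S R →
      SetGenerated w' fun v α => v ⊩ isClosedSubsetF S R α := by
  rw [finitaryNID]
  simp only [sat_allF, sat_imp, sat_setGeneratedF, sat_isFinitaryRuleSetF, sat_isClosedSubsetF,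
    cons_old, cons_new]
  constructor
  · exact fun h w₁ h₁ S R hS hR hSR => h w₁ h₁ S hS w₁ le_rfl R hR w₁ le_rfl hSR
  · exact fun h w₁ h₁ S hS w₂ h₂ R hR w₃ h₃ hSR =>
      h w₃ (h₁.trans (h₂.trans h₃)) S R (hS.up (h₂.trans h₃)) (hR.up h₃) hSR

theorem sat_formalTopologyMapsSetGenerated :
    Sat w (formalTopologyMapsSetGenerated : Fml V) ρ ↔
    ∀ w', w ≤ w' → ∀ S le I C T le' J D, Dom w' S → Dom w' le → Dom w' I → Dom w' C → Dom w' T →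
      Dom w' le' → Dom w' J → Dom w' D → w' ⊩ isSetPresentedFTopF S le I C →
      w' ⊩ isPreorderF T le' → w' ⊩ isAxiomSetF T J D →
      SetGenerated w' fun v r => v ⊩ isFTopMapF S le I C T le' J D r := by
  rw [formalTopologyMapsSetGenerated]
  simp only [sat_allF, sat_imp, sat_setGeneratedF, sat_isSetPresentedFTopF, sat_isFTopMapF,
    sat_isPreorderF, sat_isAxiomSetF, cons_old, cons_new]
  constructor
  · exact fun h w₁ h₁ S le I C T le' J D hS hle hI hC hT hle' hJ hD h₂ h₃ h₄ =>
      h w₁ h₁ S hS w₁ le_rfl le hle w₁ le_rfl I hI w₁ le_rfl C hC w₁ le_rfl T hT w₁ le_rfl le' hle'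
        w₁ le_rfl J hJ w₁ le_rfl D hD w₁ le_rfl h₂ w₁ le_rfl h₃ w₁ le_rfl h₄
  · intro h w₁ h₁ S hS w₂ h₂ le hle w₃ h₃ I hI w₄ h₄ C hC w₅ h₅ T hT w₆ h₆ le' hle' w₇ h₇ J hJ
      w₈ h₈ D hD w₉ h₉ p₁ w₁₀ h₁₀ p₂ w₁₁ h₁₁ p₃
    have k₁₀ := h₁₀.trans h₁₁
    have k₉ := h₉.trans k₁₀
    have k₈ := h₈.trans k₉
    have k₇ := h₇.trans k₈
    have k₆ := h₆.trans k₇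
    have k₅ := h₅.trans k₆
    have k₄ := h₄.trans k₅
    have k₃ := h₃.trans k₄
    have k₂ := h₂.trans k₃
    exact h w₁₁ (h₁.trans k₂) S le I C T le' J D (hS.up k₂) (hle.up k₃) (hI.up k₄) (hC.up k₅)
      (hT.up k₆) (hle'.up k₇) (hJ.up k₈) (hD.up k₉) (p₁.up k₁₀) (p₂.up h₁₁) p₃

end forcing

section model
variable {W : Type 1} {M : Type} [K : SetModel W M] {w : W}

theorem RestrDefinable.congr {P : W → M → M → Prop} (hP : RestrDefinable w P) {w' : W}
    (hw : w ≤ w') {x x' z z' : M} (hx : w' ⊩ x ≐ x') (hz : w' ⊩ z ≐ z') (h : P w' x z) :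
    P w' x' z' := by
  obtain ⟨φ, -, hφ⟩ := hP
  have := (hφ w' hw x z hx.dom_eq_left hz.dom_eq_left).2 h
  refine (hφ w' hw x' z' hx.dom_eq_right hz.dom_eq_right).1 (this.congr fun v => ?_)
  rcases v with _ | _ | v
  exacts [hz, hx, K.eq_refl (v.2.up hw)]

/-- The component {a, b} of the pair supplies the bound that makes quantification over the two
coordinates restricted. -/
theorem mem_opair_exists {p a b : M} (h : w ⊩ isOPairF p a b) :
    ∃ t, w ⊩ t ∊ p ∧ w ⊩ a ∊ t ∧ w ⊩ b ∊ t := by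
  obtain ⟨s, -, t, ht, -, h, -⟩ := frc_isOPairF.1 h
  exact ⟨t, ht, (frc_isPairF.1 h).1, (frc_isPairF.1 h).2.1⟩

theorem memFamF_iff {I a i : M} :
    w ⊩ memFamF I a i ↔ ∃ J, w ⊩ relF I a J ∧ w ⊩ i ∊ J := by
  rw [frc_memFamF]
  constructor
  · rintro ⟨p, hp, t, -, J, -, h, hi⟩
    exact ⟨J, relF_intro h hp, hi⟩
  · rintro ⟨J, hJ, hi⟩
    obtain ⟨p, hp, h⟩ := frc_relF.1 hJ
    obtain ⟨t, ht, -, hJt⟩ := mem_opair_exists h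
    exact ⟨p, hp, t, ht, J, hJt, h, hi⟩

theorem memFam₂F_iff {C a i c : M} :
    w ⊩ memFam₂F C a i c ↔ ∃ q, w ⊩ isOPairF q a i ∧ w ⊩ memFamF C q c := by
  simp only [memFamF_iff]
  rw [frc_memFam₂F]
  constructor
  · rintro ⟨p, hp, t, -, q, -, J, -, hq, h, hi⟩
    exact ⟨q, hq, J, relF_intro h hp, hi⟩
  · rintro ⟨q, hq, J, hJ, hi⟩
    obtain ⟨p, hp, h⟩ := frc_relF.1 hJ
    obtain ⟨t, ht, hqt, hJt⟩ := mem_opair_exists h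
    exact ⟨p, hp, t, ht, q, hqt, J, hJt, hq, h, hi⟩

/-! ### Construction of families and axiom-sets -/

/-- The family is the graph of x ↦ {y ∈ Y | P x y}, with the set of its values as codomain. -/
theorem family_exists {A Y : M} (hA : Dom w A) (hY : Dom w Y) {P : W → M → M → Prop}
    (hP : RestrDefinable w P) :
    ∃ F, Dom w F ∧ w ⊩ isFamilyF F A ∧
      ∀ w', w ≤ w' → ∀ a i, w' ⊩ memFamF F a i ↔ w' ⊩ a ∊ A ∧ w' ⊩ i ∊ Y ∧ P w' a i := by
  obtain ⟨F, hF, hF'⟩ := isSet_family hA hY hP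
  obtain ⟨B, hB, hB'⟩ := isSet_comp hA hY hP
  have hrel : ∀ w', w ≤ w' → ∀ a U, w' ⊩ relF F a U ↔
      w' ⊩ a ∊ A ∧ IsComp w' U Y fun v y => P v a y := by
    intro w' hw a U
    constructor
    · intro h
      obtain ⟨p, hp, hpaU⟩ := frc_relF.1 h
      obtain ⟨a', ha', U', hp', hU'⟩ := (hF' w' hw p).1 hp
      obtain ⟨haa, hUU⟩ := opair_inj hp' hpaU
      refine ⟨haa.eq_mem ha', (hU'.congr hUU).1, fun v hv y => ?_⟩
      rw [(hU'.congr hUU).2 v hv]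
      refine and_congr_right fun hy => ⟨?_, ?_⟩
      · exact hP.congr (hw.trans hv) (haa.up hv) hy.dom_left.refl
      · exact hP.congr (hw.trans hv) (haa.symm.up hv) hy.dom_left.refl
    · rintro ⟨ha, hU⟩
      obtain ⟨p, hp⟩ := opair_exists ha.dom_left hU.1
      exact relF_intro hp ((hF' w' hw p).2 ⟨a, ha, U, hp, hU⟩)
  refine ⟨F, hF, frc_isFamilyF.2 ⟨B, hB, frc_isFunF.2 ⟨frc_isRelF.2 ?_, ?_⟩⟩, ?_⟩
  · intro w' hw p hp
    obtain ⟨a, ha, U, hp, hU⟩ := (hF' w' hw p).1 hp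
    exact ⟨a, ha, U, (hB' w' hw U).2 ⟨a, ha, hU⟩, hp⟩
  · intro w' hw a ha
    obtain ⟨U, hU⟩ := exists_isComp hP hw ha.dom_left (hY.up hw)
    refine ⟨U, (hB' w' hw U).2 ⟨a, ha, hU⟩, (hrel w' hw a U).2 ⟨ha, hU⟩, fun v hv z _ haz => ?_⟩
    exact ((hrel v (hw.trans hv) a z).1 haz).2.unique (hU.up hv)
  · intro w' hw a i
    rw [memFamF_iff]
    constructor
    · rintro ⟨U, haU, hi⟩
      obtain ⟨ha, hU⟩ := (hrel w' hw a U).1 haU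
      exact ⟨ha, (hU.2 w' le_rfl i).1 hi⟩
    · rintro ⟨ha, hi⟩
      obtain ⟨U, hU⟩ := exists_isComp hP hw ha.dom_left (hY.up hw)
      exact ⟨U, (hrel w' hw a U).2 ⟨ha, hU⟩, (hU.2 w' le_rfl i).2 hi⟩

/-- Axiom-sets with all indices in one set R and covering sets depending on the index only, which
covers both topologies built below. The second family lives on the set of pairs (a, i), and its
condition recovers i from the pair. -/
theorem axiomSet_exists {T R : M} (hT : Dom w T) (hR : Dom w R) {P Q : W → M → M → Prop}
    (hP : RestrDefinable w P) (hQ : RestrDefinable w Q) :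
    ∃ J D, Dom w J ∧ Dom w D ∧ w ⊩ isAxiomSetF T J D ∧ ∀ w', w ≤ w' →
      (∀ a i, w' ⊩ memFamF J a i ↔ w' ⊩ a ∊ T ∧ w' ⊩ i ∊ R ∧ P w' a i) ∧
      ∀ a i c, w' ⊩ memFam₂F D a i c ↔
        (w' ⊩ a ∊ T ∧ w' ⊩ i ∊ R ∧ P w' a i) ∧ w' ⊩ c ∊ T ∧ Q w' i c := by
  obtain ⟨J, hJ, hJfam, hJ'⟩ := family_exists hT hR hP
  obtain ⟨Sg, hSg, hSg'⟩ : IsSet w fun w' q => ∃ a, w' ⊩ a ∊ T ∧ ∃ i, w' ⊩ i ∊ R ∧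
      P w' a i ∧ w' ⊩ isOPairF q a i := by
    obtain ⟨Z, hZ, hZ'⟩ := isSet_prod hT hR
    obtain ⟨φ, hφ, hφP⟩ := hP
    let τ : Ext (Ext (Elt w)) → Ext (Ext (Ext (Ext (Elt w)))) := fun
      | .new => .new
      | .old .new => .old .new
      | .old (.old v) => .old (.old (.old (.old v)))
    refine (isSet_restr (w := w) (P := fun w' _ q => ∃ a, w' ⊩ a ∊ T ∧ ∃ i, w' ⊩ i ∊ R ∧
      P w' a i ∧ w' ⊩ isOPairF q a i) ⟨form₂ fun _ q => bexF (par hT) fun a => bexF (par hR) fun i =>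
        φ.rename τ ⋏ isOPairF q a i, by simpa using hφ.rename τ, fun w' hw x q _ _ => ?_⟩
      le_rfl hZ hZ).congr fun w' hw q => and_iff_right_of_imp ?_
    · have hτ : ∀ a i, cons (cons (cons (cons Subtype.val x) q) a) i ∘ τ =
          cons (cons Subtype.val a) i := by
        intro a i; funext u
        rcases u with _ | _ | u <;> rfl
      simp only [sat_bexF, sat_and, sat_rename', sat_isOPairF, cons_old, cons_new, hτ]
      refine exists_congr fun a => and_congr_right fun ha => exists_congr fun i =>
        and_congr_right fun hi => and_congr_left fun _ => ?_
      exact hφP w' hw a i ha.dom_left hi.dom_left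
    · rintro ⟨a, ha, i, hi, -, hq⟩
      exact (hZ' w' hw q).2 ⟨a, ha, i, hi, hq⟩
  have hQ₂ : RestrDefinable w fun w' q c => ∃ a, w' ⊩ a ∊ T ∧ ∃ i, w' ⊩ i ∊ R ∧
      w' ⊩ isOPairF q a i ∧ Q w' i c := by
    obtain ⟨φ, hφ, hφQ⟩ := hQ
    let τ : Ext (Ext (Elt w)) → Ext (Ext (Ext (Ext (Elt w)))) := fun
      | .new => .old (.old .new)
      | .old .new => .new
      | .old (.old v) => .old (.old (.old (.old v)))
    refine ⟨form₂ fun q c => bexF (par hT) fun a => bexF (par hR) fun i =>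
        isOPairF q a i ⋏ φ.rename τ, by simpa using hφ.rename τ, fun w' hw q c _ hc => ?_⟩
    have hτ : ∀ a i, cons (cons (cons (cons Subtype.val q) c) a) i ∘ τ =
        cons (cons Subtype.val i) c := by
      intro a i; funext u
      rcases u with _ | _ | u <;> rfl
    simp only [sat_bexF, sat_and, sat_rename', sat_isOPairF, cons_old, cons_new, hτ]
    refine exists_congr fun a => and_congr_right fun ha => exists_congr fun i =>
      and_congr_right fun hi => and_congr_right fun _ => ?_
    exact hφQ w' hw i c hi.dom_left hc
  obtain ⟨D, hD, hDfam, hD'⟩ := family_exists hSg hT hQ₂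
  have hD₂ : ∀ w', w ≤ w' → ∀ a i c, w' ⊩ memFam₂F D a i c ↔
        (w' ⊩ a ∊ T ∧ w' ⊩ i ∊ R ∧ P w' a i) ∧ w' ⊩ c ∊ T ∧ Q w' i c := by
    intro w' hw a i c
    rw [memFam₂F_iff]
    simp only [hD' w' hw, hSg' w' hw]
    constructor
    · rintro ⟨q, hq, ⟨a₁, ha₁, i₁, hi₁, hPai, hq₁⟩, hc, a₂, ha₂, i₂, hi₂, hq₂, hQic⟩
      obtain ⟨ha, hi⟩ := opair_inj hq₁ hq
      exact ⟨⟨ha.eq_mem ha₁, hi.eq_mem hi₁, hP.congr hw ha hi hPai⟩, hc,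
        hQ.congr hw (opair_inj hq₂ hq).2 hc.dom_left.refl hQic⟩
    · rintro ⟨⟨ha, hi, hPai⟩, hc, hQic⟩
      obtain ⟨q, hq⟩ := opair_exists ha.dom_left hi.dom_left
      exact ⟨q, hq, ⟨a, ha, i, hi, hPai, hq⟩, hc, a, ha, i, hi, hq, hQic⟩
  refine ⟨J, D, hJ, hD, frc_isAxiomSetF.2 ⟨hJfam, ⟨Sg, hSg, frc_isSigmaF.2 ⟨?_, ?_⟩, hDfam⟩, ?_⟩,
    fun w' hw => ⟨hJ' w' hw, hD₂ w' hw⟩⟩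
  · intro w' hw p hp
    obtain ⟨a, ha, i, hi, hPai, hp⟩ := (hSg' w' hw p).1 hp
    exact ⟨a, ha, i, (hJ' w' hw a i).2 ⟨ha, hi, hPai⟩, hp⟩
  · intro w' hw a ha i hi
    obtain ⟨-, hi, hPai⟩ := (hJ' w' hw a i).1 hi
    obtain ⟨q, hq⟩ := opair_exists ha.dom_left hi.dom_left
    exact ⟨q, (hSg' w' hw q).2 ⟨a, ha, i, hi, hPai, hq⟩, hq⟩
  · exact fun w' hw a i c h => ((hD₂ w' hw a i c).1 h).2.1

/-! ### Inclusions, finite unions and relations cut out of a product -/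

theorem sub_refl {a : M} : w ⊩ subF a a := frc_subF.2 fun _ _ _ hx => hx

theorem sub_trans {a b c : M} (hab : w ⊩ subF a b) (hbc : w ⊩ subF b c) : w ⊩ subF a c :=
  frc_subF.2 fun _ hw _ hx => frc_sub (hbc.up hw) (frc_sub (hab.up hw) hx)

theorem empty_sub {a b : M} (h : w ⊩ isEmptyF a) : w ⊩ subF a b :=
  frc_subF.2 fun v hv x hx => (frc_isEmptyF.1 h v hv x hx).elim

theorem singleton_sub {u x b : M} (h : w ⊩ isPairF u x x) (hx : w ⊩ x ∊ b) : w ⊩ subF u b :=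
  frc_subF.2 fun _ hv _ hy => ((mem_singleton (h.up hv)).1 hy).symm.eq_mem (hx.up hv)

theorem singleton_mem_finSet {T S x : M} (hT : IsFinSet w T S) (hx : w ⊩ x ∊ S) :
    ∃ u, w ⊩ u ∊ T ∧ w ⊩ isPairF u x x := by
  obtain ⟨e, he, he'⟩ := empty_mem_finSet hT
  obtain ⟨u, hu, hu'⟩ := insert_mem_finSet hT he hx
  have hxu := (hu' w le_rfl x).2 (.inr hx.dom_left.refl)
  refine ⟨u, hu, frc_isPairF.2 ⟨hxu, hxu, fun v hv y hy => .inl ?_⟩⟩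
  exact ((hu' v hv y).1 hy).resolve_left (frc_isEmptyF.1 he' v hv y)

/-- By induction on b, inserting its elements into a one at a time; the bound d ∈ T keeps the
induction formula restricted. -/
theorem union_mem_finSet {T S a b : M} (hT : IsFinSet w T S) (ha : w ⊩ a ∊ T) (hb : w ⊩ b ∊ T) :
    ∃ d, w ⊩ d ∊ T ∧ w ⊩ subF a d ∧ w ⊩ subF b d ∧
      ∀ w', w ≤ w' → ∀ y, w' ⊩ y ∊ d → w' ⊩ y ∊ a ∨ w' ⊩ y ∊ b := by
  refine finSet_induction hT (P := fun w b => ∃ d, w ⊩ d ∊ T ∧ w ⊩ subF a d ∧ w ⊩ subF b d ∧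
    ∀ w', w ≤ w' → ∀ y, w' ⊩ y ∊ d → w' ⊩ y ∊ a ∨ w' ⊩ y ∊ b)
    ⟨form₂ fun _ b => bexF (par hT.2.1) fun d => subF (par ha.dom_left) d ⋏ subF b d ⋏
      ballF d fun y => y ∊ par ha.dom_left ⋎ y ∊ b, by simp, fun _ _ _ _ _ _ => by simp⟩ ?_ ?_ hb
  · intro v hv u hu hu'
    exact ⟨a, ha.up hv, sub_refl, empty_sub hu', fun _ _ y hy => .inl hy⟩
  · rintro v hv u x u' hu hx hu' hux ⟨d, hd, had, hud, hd'⟩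
    obtain ⟨e, he, hed⟩ := insert_mem_finSet (hT.up hv) hd hx
    have hde : v ⊩ subF d e := frc_subF.2 fun v' hv' y hy => (hed v' hv' y).2 (.inl hy)
    refine ⟨e, he, sub_trans had hde, frc_subF.2 fun v' hv' y hy => ?_, fun v' hv' y hy => ?_⟩
    · rcases (hux v' hv' y).1 hy with hy | hy
      · exact frc_sub (hde.up hv') (frc_sub (hud.up hv') hy)
      · exact (hed v' hv' y).2 (.inr hy)
    · rcases (hed v' hv' y).1 hy with hy | hy
      · exact (hd' v' hv' y hy).imp id fun hy => (hux v' hv' y).2 (.inl hy)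
      · exact .inr ((hux v' hv' y).2 (.inr hy))

/-- A relation on a product, defined by a restricted condition. -/
theorem rel_exists {A B : M} (hA : Dom w A) (hB : Dom w B) {P : W → M → M → Prop}
    (hP : RestrDefinable w P) :
    ∃ r, Dom w r ∧ w ⊩ isRelF r A B ∧
      ∀ w', w ≤ w' → ∀ a b, w' ⊩ relF r a b ↔ w' ⊩ a ∊ A ∧ w' ⊩ b ∊ B ∧ P w' a b := by
  obtain ⟨Z, hZ, hZ'⟩ := isSet_prod hA hB
  have hP₂ : RestrDefinable w fun w' _ z => ∃ a, w' ⊩ a ∊ A ∧ ∃ b, w' ⊩ b ∊ B ∧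
      P w' a b ∧ w' ⊩ isOPairF z a b := by
    obtain ⟨φ, hφ, hφP⟩ := hP
    let τ : Ext (Ext (Elt w)) → Ext (Ext (Ext (Ext (Elt w)))) := fun
      | .new => .new
      | .old .new => .old .new
      | .old (.old v) => .old (.old (.old (.old v)))
    refine ⟨form₂ fun _ z => bexF (par hA) fun a => bexF (par hB) fun b =>
        φ.rename τ ⋏ isOPairF z a b, by simpa using hφ.rename τ, fun w' hw x z _ _ => ?_⟩
    have hτ : ∀ a b, cons (cons (cons (cons Subtype.val x) z) a) b ∘ τ =
        cons (cons Subtype.val a) b := by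
      intro a b; funext u
      rcases u with _ | _ | u <;> rfl
    simp only [sat_bexF, sat_and, sat_rename', sat_isOPairF, cons_old, cons_new, hτ]
    refine exists_congr fun a => and_congr_right fun ha => exists_congr fun b =>
      and_congr_right fun hb => and_congr_left fun _ => ?_
    exact hφP w' hw a b ha.dom_left hb.dom_left
  obtain ⟨r, hr, hr'⟩ := isSet_restr hP₂ le_rfl hZ hZ
  refine ⟨r, hr, frc_isRelF.2 fun w' hw p hp => ?_, fun w' hw a b => ⟨fun h => ?_, ?_⟩⟩
  · exact (hZ' w' hw p).1 ((hr' w' hw p).1 hp).1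
  · obtain ⟨p, hp, hpab⟩ := frc_relF.1 h
    obtain ⟨-, a', ha', b', hb', hP', hpab'⟩ := (hr' w' hw p).1 hp
    obtain ⟨haa, hbb⟩ := opair_inj hpab' hpab
    exact ⟨haa.eq_mem ha', hbb.eq_mem hb', hP.congr hw haa hbb hP'⟩
  · rintro ⟨ha, hb, hab⟩
    obtain ⟨p, hp⟩ := opair_exists ha.dom_left hb.dom_left
    exact relF_intro hp ((hr' w' hw p).2
      ⟨(hZ' w' hw p).2 ⟨a, ha, b, hb, hp⟩, a, ha, b, hb, hab, hp⟩)

/-! ### The one-point formal topology -/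

/-- `(s, le, I, C)` is the one-point formal topology. -/
structure IsOnePoint (w : W) (s le I C : M) : Prop where
  inhabited : ∃ o, w ⊩ o ∊ s
  le_of_mem : ∀ {w'}, w ≤ w' → ∀ {a b}, w' ⊩ a ∊ s → w' ⊩ b ∊ s → w' ⊩ relF le a b
  cover : ∀ {w'}, w ≤ w' → ∀ {a}, w' ⊩ a ∊ s → ∀ Q : W → M → Prop,
    Cover w' s I C a Q ↔ ∀ v, w' ≤ v → ∀ c, v ⊩ c ∊ s → Q v c

theorem IsOnePoint.up {s le I C : M} (hs : IsOnePoint w s le I C) {v : W} (hv : w ≤ v) :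
    IsOnePoint v s le I C :=
  ⟨hs.inhabited.imp fun _ h => h.up hv, fun h => hs.le_of_mem (hv.trans h),
    fun h => hs.cover (hv.trans h)⟩

theorem restrDefinable_true : RestrDefinable w fun _ _ _ => True :=
  ⟨.bot ⟾ .bot, by simp, fun _ _ _ _ _ _ => by simp⟩

/-- On a singleton s, taking I(a) = s and C(a,i) = s makes a ◁ U mean s ⊆ U, that is a ∈ U. The
axioms of a formal topology are then immediate. -/
theorem onePoint_exists (w : W) : ∃ s le I C, (Dom w s ∧ Dom w le ∧ Dom w I ∧ Dom w C) ∧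
    w ⊩ isSetPresentedFTopF s le I C ∧ IsOnePoint w s le I C := by
  -- The point may be any existing element; ω is at hand.
  obtain ⟨o, ho, -⟩ := omega_exists w
  obtain ⟨s, hs, hs'⟩ := isSet_eq ho
  obtain ⟨le, hle, hlerel, hle'⟩ := rel_exists hs hs restrDefinable_true
  obtain ⟨I, C, hI, hC, hIC, hIC'⟩ := axiomSet_exists hs hs restrDefinable_true restrDefinable_true
  have cov : ∀ {w'}, w ≤ w' → ∀ {a}, w' ⊩ a ∊ s → ∀ Q : W → M → Prop,
      Cover w' s I C a Q ↔ ∀ v, w' ≤ v → ∀ c, v ⊩ c ∊ s → Q v c := by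
    intro w' hw a ha Q
    constructor
    · rintro ⟨i, hi, h⟩ v hv c hc
      refine h v hv c hc ?_
      have hi := ((hIC' w' hw).1 a i).1 hi
      exact ((hIC' v (hw.trans hv)).2 a i c).2 ⟨⟨ha.up hv, hi.2.1.up hv, trivial⟩, hc, trivial⟩
    · exact fun h => ⟨a, ((hIC' w' hw).1 a a).2 ⟨ha, ha, trivial⟩, fun v hv c hc _ => h v hv c hc⟩
  have heq : ∀ {w'}, w ≤ w' → ∀ {a b}, w' ⊩ a ∊ s → w' ⊩ b ∊ s → w' ⊩ a ≐ b :=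
    fun hw _ _ ha hb => ((hs' _ hw _).1 ha).trans ((hs' _ hw _).1 hb).symm
  have hle₂ : ∀ {w'}, w ≤ w' → ∀ {a b}, w' ⊩ a ∊ s → w' ⊩ b ∊ s → w' ⊩ relF le a b :=
    fun hw _ _ ha hb => (hle' _ hw _ _).2 ⟨ha, hb, trivial⟩
  refine ⟨s, le, I, C, ⟨hs, hle, hI, hC⟩, isSetPresentedFTopF_intro (frc_isPreorderF.2
    ⟨hlerel, fun w' hw x hx => hle₂ hw hx hx, fun w' hw x y z hx _ hz _ _ => hle₂ hw hx hz⟩) hIC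
    ?_ ?_ ?_ ?_, ⟨⟨o, (hs' w le_rfl o).2 ho.refl⟩, hle₂, cov⟩⟩
  · intro w' hw U hU a ha
    have has := frc_sub hU ha
    rw [cov hw has]
    exact fun v hv c hc => (heq (hw.trans hv) (has.up hv) hc).eq_mem (ha.up hv)
  · intro w' hw U U' a hU hU' ha h h'
    rw [cov hw ha] at h
    exact h' w' le_rfl a (h w' le_rfl a ha)
  · intro w' hw U U' a hU hU' ha h h'
    rw [cov hw ha] at h h' ⊢
    intro v hv c hc
    have hcc := hle₂ (hw.trans hv) hc hc
    exact ⟨c, h v hv c hc, c, h' v hv c hc, hcc, hcc⟩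
  · intro w' hw a b ha hb _
    rw [cov hw ha]
    exact fun v hv c hc => heq (hw.trans hv) hc (hb.up hv)

/-! ### The formal topology of a set of finitary rules -/

/-- `(T, le, J, D)` is the formal topology of finitely enumerable subsets of `S`, ordered by reverse
inclusion, in which `a` is covered by the singletons of the elements of `b` for every rule `(a, b)`
in `R`. -/
structure IsRuleTopology (w : W) (S R T le J D : M) : Prop where
  rules : w ⊩ isFinitaryRuleSetF S R
  fin : IsFinSet w T S
  le_iff : ∀ {w'}, w ≤ w' → ∀ u v, w' ⊩ relF le u v ↔ w' ⊩ u ∊ T ∧ w' ⊩ v ∊ T ∧ w' ⊩ subF v u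
  index_iff : ∀ {w'}, w ≤ w' → ∀ u i, w' ⊩ memFamF J u i ↔
    w' ⊩ u ∊ T ∧ w' ⊩ i ∊ R ∧ ∃ b, w' ⊩ isOPairF i u b
  mem_iff : ∀ {w'}, w ≤ w' → ∀ u i v, w' ⊩ memFam₂F D u i v ↔
    (w' ⊩ u ∊ T ∧ w' ⊩ i ∊ R ∧ ∃ b, w' ⊩ isOPairF i u b) ∧ w' ⊩ v ∊ T ∧
      ∃ u b, w' ⊩ isOPairF i u b ∧ ∃ y, w' ⊩ y ∊ b ∧ w' ⊩ isPairF v y y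

theorem IsRuleTopology.up {S R T le J D : M} (hT : IsRuleTopology w S R T le J D) {v : W}
    (hv : w ≤ v) : IsRuleTopology v S R T le J D :=
  ⟨hT.rules.up hv, hT.fin.up hv, fun h => hT.le_iff (hv.trans h), fun h => hT.index_iff (hv.trans h),
    fun h => hT.mem_iff (hv.trans h)⟩

theorem ruleTopology_exists {S R : M} (hS : Dom w S) (hR : Dom w R)
    (hSR : w ⊩ isFinitaryRuleSetF S R) :
    ∃ T le J D, (Dom w le ∧ Dom w J ∧ Dom w D) ∧ w ⊩ isPreorderF T le ∧ w ⊩ isAxiomSetF T J D ∧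
      IsRuleTopology w S R T le J D := by
  obtain ⟨T, hT⟩ := finSet_exists hS
  obtain ⟨le, hle, hlerel, hle'⟩ := rel_exists hT.2.1 hT.2.1 (P := fun w u v => w ⊩ subF v u)
    ⟨form₂ fun u v => subF v u, by simp, fun _ _ _ _ _ _ => by simp⟩
  -- Rules serve as indices: r is an index for u when its premise is u. The conclusion b lies in an
  -- element of r, so the quantifier over it is bounded.
  have hP : RestrDefinable w fun w u r => ∃ b, w ⊩ isOPairF r u b := by
    refine ⟨form₂ fun u r => bexF r fun s => bexF s fun b => isOPairF r u b, by simp,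
      fun w' hw u r _ _ => ?_⟩
    simp only [sat_bexF, sat_isOPairF, cons_old, cons_new]
    constructor
    · rintro ⟨s, hs, b, hb, h⟩
      exact ⟨b, h⟩
    · rintro ⟨b, h⟩
      obtain ⟨t, ht, -, hb⟩ := mem_opair_exists h
      exact ⟨t, ht, b, hb, h⟩
  have hQ : RestrDefinable w fun w r v => ∃ u b, w ⊩ isOPairF r u b ∧
      ∃ y, w ⊩ y ∊ b ∧ w ⊩ isPairF v y y := by
    refine ⟨form₂ fun r v => bexF r fun s => bexF s fun u => bexF s fun b => isOPairF r u b ⋏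
      bexF b fun y => isPairF v y y, by simp, fun w' hw u r _ _ => ?_⟩
    simp only [sat_bexF, sat_isOPairF, sat_and, sat_isPairF, cons_old, cons_new]
    constructor
    · rintro ⟨s, hs, u, hu, b, hb, h⟩
      exact ⟨u, b, h⟩
    · rintro ⟨u, b, h⟩
      obtain ⟨t, ht, hu, hb⟩ := mem_opair_exists h.1
      exact ⟨t, ht, u, hu, b, hb, h⟩
  obtain ⟨J, D, hJ, hD, hJD, hJD'⟩ := axiomSet_exists hT.2.1 hR hP hQ
  refine ⟨T, le, J, D, ⟨hle, hJ, hD⟩, frc_isPreorderF.2 ⟨hlerel, fun w' hw x hx => ?_, ?_⟩, hJD,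
    hSR, hT, fun hw => hle' _ hw, fun hw => (hJD' _ hw).1, fun hw => (hJD' _ hw).2⟩
  · exact (hle' w' hw x x).2 ⟨hx, hx, sub_refl⟩
  · intro w' hw x y z hx _ hz hxy hyz
    exact (hle' w' hw x z).2 ⟨hx, hz, sub_trans ((hle' w' hw y z).1 hyz).2.2
      ((hle' w' hw x y).1 hxy).2.2⟩

/-- The subset presented by a relation between the point and the finite subsets. -/
def InPoint (w : W) (s T r y : M) : Prop :=
  ∃ u, w ⊩ u ∊ T ∧ w ⊩ y ∊ u ∧ ∃ a, w ⊩ a ∊ s ∧ w ⊩ relF r a u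

/-- The u related to the point form a filter: the first and third map conditions put ∅ in it, the
second and third allow the insertion of an element of α. By finite induction it contains every
finite u ⊆ α, in particular the premise of a rule, and the fourth condition then yields the
singleton of an element of the conclusion. -/
theorem IsRuleTopology.closed_of_map {S R T le' J D s le I C r α : M}
    (hT : IsRuleTopology w S R T le' J D) (hs : IsOnePoint w s le I C) (hsd : Dom w s)
    (hrd : Dom w r) (hr : w ⊩ isFTopMapF s le I C T le' J D r)
    (hα : IsComp w α S fun v y => InPoint v s T r y) : w ⊩ isClosedSubsetF S R α := by
  obtain ⟨o, ho⟩ := hs.inhabited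
  obtain ⟨hrel, h₁, h₂, h₃, h₄⟩ := frc_isFTopMapF.1 hr
  refine frc_isClosedSubsetF.2 ⟨frc_subF.2 fun v hv y hy => ((hα.2 v hv y).1 hy).1, ?_⟩
  intro w₁ hw x y hxy hxα
  obtain ⟨p, hp, hpxy⟩ := frc_relF.1 hxy
  have hxT : w₁ ⊩ x ∊ T := by
    obtain ⟨a, ha, b, hb, hpab, haS, -, hfin⟩ := frc_isFinitaryRuleSetF.1 hT.rules w₁ hw p hp
    have hax := (opair_inj hpab hpxy).1
    exact hax.eq_mem ((hT.fin.2.2 w₁ hw a).2 ⟨ha, haS, hfin⟩)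
  -- Every cover in the one-point topology is evaluated at the covered point itself, which turns
  -- each map condition into an outright existence statement.
  have key : ∀ v, w₁ ≤ v → v ⊩ subF x α → ∃ a, v ⊩ a ∊ s ∧ v ⊩ relF r a x := by
    refine finSet_induction (hT.fin.up hw) (P := fun w u => ∀ v, w ≤ v → v ⊩ subF u α →
      ∃ a, v ⊩ a ∊ s ∧ v ⊩ relF r a u) ⟨form₂ fun _ u => subF u (par (hα.1.up hw)) ⟾
        bexF (par (hsd.up hw)) fun a => relF (par (hrd.up hw)) a u, by simp,
        fun _ _ _ _ _ _ => by simp⟩ ?_ ?_ hxT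
    · intro w₂ hw₂ u hu hu0 v hv _
      have hwv := hw.trans (hw₂.trans hv)
      have ho := ho.up hwv
      obtain ⟨d, hd, hod⟩ := (hs.cover hwv ho _).1 (h₁ v hwv o ho) v le_rfl o ho
      have hdu : v ⊩ relF le' d u := (hT.le_iff hwv d u).2 ⟨hd, hu.up hv, (empty_sub hu0).up hv⟩
      exact ⟨o, ho, (hs.cover hwv ho _).1 (h₃ v hwv d u o hd (hu.up hv) hdu ho hod) v le_rfl o ho⟩
    · intro w₂ hw₂ u x u' hu hx hu' hux ih v hv hu'α
      have hwv := hw.trans (hw₂.trans hv)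
      obtain ⟨a, ha, hau⟩ := ih v hv (frc_subF.2 fun v' hv' y hy =>
        frc_sub (hu'α.up hv') ((hux v' (hv.trans hv') y).2 (.inl hy)))
      obtain ⟨-, z, hz, hxz, b, hb, hbz⟩ := (hα.2 v hwv x).1
        (frc_sub hu'α ((hux v hv x).2 (.inr (hx.dom_left.up hv).refl)))
      obtain ⟨d, hd, hdu, hdz, had⟩ := (hs.cover hwv ha _).1 (h₂ v hwv u z a a b (hu.up hv) hz ha ha
        hb hau hbz (hs.le_of_mem hwv ha ha) (hs.le_of_mem hwv ha hb)) v le_rfl a ha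
      have hdu' : v ⊩ relF le' d u' := by
        refine (hT.le_iff hwv d u').2 ⟨hd, hu'.up hv, frc_subF.2 fun v' hv' y hy => ?_⟩
        rcases (hux v' (hv.trans hv') y).1 hy with hy | hy
        · exact frc_sub (((hT.le_iff hwv d u).1 hdu).2.2.up hv') hy
        · exact frc_sub (((hT.le_iff hwv d z).1 hdz).2.2.up hv') (hy.symm.eq_mem (hxz.up hv'))
      exact ⟨a, ha, (hs.cover hwv ha _).1 (h₃ v hwv d u' a hd (hu'.up hv) hdu' ha had) v le_rfl a ha⟩
  obtain ⟨a, ha, hax⟩ := key w₁ le_rfl hxα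
  have hJ : w₁ ⊩ memFamF J x p := (hT.index_iff hw x p).2 ⟨hxT, hp, y, hpxy⟩
  obtain ⟨d, hd, hDd, had⟩ := (hs.cover hw ha _).1 (h₄ w₁ hw x p a hxT hJ ha hax) w₁ le_rfl a ha
  obtain ⟨-, -, x', y', hpxy', z, hz, hdz⟩ := (hT.mem_iff hw x p d).1 hDd
  have hzd := (frc_isPairF.1 hdz).1
  refine ⟨z, hz.mem_eq (opair_inj hpxy' hpxy).2, (hα.2 w₁ hw z).2 ⟨?_, d, hd, hzd, a, ha, had⟩⟩
  exact frc_sub ((hT.fin.up hw).sub hd) hzd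

/-- Here r relates every point of s to the u ⊆ α. The four conditions come from the empty set, from
finite unions, from transitivity of inclusion and from closedness of α, whose witness z is used
through its singleton. -/
theorem IsRuleTopology.map_of_closed {S R T le' J D s le I C r α : M}
    (hT : IsRuleTopology w S R T le' J D) (hs : IsOnePoint w s le I C)
    (hα : w ⊩ isClosedSubsetF S R α) (hrel : w ⊩ isRelF r s T)
    (hr : ∀ w', w ≤ w' → ∀ a u, w' ⊩ relF r a u ↔ w' ⊩ a ∊ s ∧ w' ⊩ u ∊ T ∧ w' ⊩ subF u α) :
    w ⊩ isFTopMapF s le I C T le' J D r := by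
  obtain ⟨hαS, hα⟩ := frc_isClosedSubsetF.1 hα
  refine frc_isFTopMapF.2 ⟨hrel, ?_, ?_, ?_, ?_⟩
  · intro w₁ hw a ha
    rw [hs.cover hw ha]
    intro v hv c hc
    obtain ⟨e, he, he'⟩ := empty_mem_finSet (hT.fin.up (hw.trans hv))
    exact ⟨e, he, (hr v (hw.trans hv) c e).2 ⟨hc, he, empty_sub he'⟩⟩
  · intro w₁ hw b₁ b₂ a x y hb₁ hb₂ ha hx hy hxb hyb _ _
    rw [hs.cover hw ha]
    intro v hv c hc
    have hwv := hw.trans hv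
    have hb₁ := hb₁.up hv
    have hb₂ := hb₂.up hv
    obtain ⟨d, hd, h₁, h₂, hd'⟩ := union_mem_finSet (hT.fin.up hwv) hb₁ hb₂
    refine ⟨d, hd, (hT.le_iff hwv _ _).2 ⟨hd, hb₁, h₁⟩, (hT.le_iff hwv _ _).2 ⟨hd, hb₂, h₂⟩,
      (hr v hwv c d).2 ⟨hc, hd, frc_subF.2 fun v' hv' y hy => ?_⟩⟩
    rcases hd' v' hv' y hy with hy | hy
    · exact frc_sub (((hr w₁ hw _ _).1 hxb).2.2.up (hv.trans hv')) hy
    · exact frc_sub (((hr w₁ hw _ _).1 hyb).2.2.up (hv.trans hv')) hy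
  · intro w₁ hw b₁ b₂ a hb₁ hb₂ hb ha hab
    rw [hs.cover hw ha]
    intro v hv c hc
    refine (hr v (hw.trans hv) c b₂).2 ⟨hc, hb₂.up hv, ?_⟩
    exact (sub_trans ((hT.le_iff hw _ _).1 hb).2.2 ((hr w₁ hw _ _).1 hab).2.2).up hv
  · intro w₁ hw b j a hb hj ha hab
    rw [hs.cover hw ha]
    intro v hv c hc
    have hwv := hw.trans hv
    obtain ⟨-, hjR, y, hjby⟩ := (hT.index_iff hwv b j).1 (hj.up hv)
    obtain ⟨z, hzy, hzα⟩ := hα v hwv b y (relF_intro hjby hjR) (((hr w₁ hw _ _).1 hab).2.2.up hv)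
    obtain ⟨d, hd, hdz⟩ := singleton_mem_finSet (hT.fin.up hwv) (frc_sub (hαS.up hwv) hzα)
    exact ⟨d, hd, (hT.mem_iff hwv b j d).2 ⟨⟨hb.up hv, hjR, y, hjby⟩, hd, b, y, hjby, z, hzy, hdz⟩,
      (hr v hwv c d).2 ⟨hc, hd, singleton_sub hdz hzα⟩⟩

/-- The generating set consists of the subsets presented by the generating maps. To separate x ∈ α,
apply generation to the map of α at the pair of the point and {x}. A map below that of α relates the
point only to subsets of α, so it presents a subset of α. -/
theorem finitaryNID_of_maps {ρ : Empty → M}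
    (h : Sat w (formalTopologyMapsSetGenerated : Fml Empty) ρ) :
    Sat w (finitaryNID : Fml Empty) ρ := by
  rw [sat_finitaryNID]
  rw [sat_formalTopologyMapsSetGenerated] at h
  intro w₁ hw S R hS hR hSR
  obtain ⟨s, le, I, C, ⟨hsd, hle, hI, hC⟩, hst, hs⟩ := onePoint_exists w₁
  obtain ⟨T, le', J, D, ⟨hle', hJ, hD⟩, hpre, hax, hT⟩ := ruleTopology_exists hS hR hSR
  obtain ⟨G, hG, hGmap, hGgen⟩ := h w₁ hw s le I C T le' J D hsd hle hI hC hT.fin.2.1 hle' hJ hD hst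
    hpre hax
  have hP : RestrDefinable w₁ fun v r y => InPoint v s T r y :=
    ⟨form₂ fun r y => bexF (par hT.fin.2.1) fun u => y ∊ u ⋏ bexF (par hsd) fun a => relF r a u,
      by simp, fun _ _ _ _ _ _ => by simp [InPoint]⟩
  obtain ⟨G', hG', hG''⟩ := isSet_comp hG hS hP
  refine ⟨G', hG', fun v hv α hα => ?_, fun v hv α hαd hα x hx => ?_⟩
  · obtain ⟨r, hr, hα⟩ := (hG'' v hv α).1 hα
    exact (hT.up hv).closed_of_map (hs.up hv) (hsd.up hv) hr.dom_left (hGmap v hv r hr) hα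
  · have hT := hT.up hv
    have hs := hs.up hv
    obtain ⟨r, hr, hrel, hr'⟩ := rel_exists (hsd.up hv) hT.fin.2.1 (P := fun w _ u => w ⊩ subF u α)
      ⟨form₂ fun _ u => subF u (par hαd), by simp, fun _ _ _ _ _ _ => by simp⟩
    obtain ⟨o, ho⟩ := hs.inhabited
    have hxS := frc_sub (frc_isClosedSubsetF.1 hα).1 hx
    obtain ⟨u, hu, hux⟩ := singleton_mem_finSet hT.fin hxS
    obtain ⟨p, hp, hpou⟩ := frc_relF.1 ((hr' v le_rfl o u).2 ⟨ho, hu, singleton_sub hux hx⟩)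
    obtain ⟨β, hβ, hpβ, hβr⟩ := hGgen v hv r hr (hT.map_of_closed hs hα hrel hr') p hp
    obtain ⟨γ, hγ⟩ := exists_isComp hP hv hβ.dom_left hT.fin.1
    refine ⟨γ, (hG'' v hv γ).2 ⟨β, hβ, hγ⟩, (hγ.2 v le_rfl x).2 ⟨hxS, u, hu,
      (frc_isPairF.1 hux).1, o, ho, relF_intro hpou hpβ⟩, frc_subF.2 fun v' hv' y hy => ?_⟩
    obtain ⟨-, u', hu', hyu', a, ha, hau'⟩ := (hγ.2 v' hv' y).1 hy
    obtain ⟨q, hq, hqau⟩ := frc_relF.1 hau'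
    exact frc_sub ((hr' v' hv' a u').1 (relF_intro hqau (frc_sub (hβr.up hv') hq))).2.2 hyu'

end model

/-- `q = (x, (y, z))`. -/
def isTripleF {V : Type} (q x y z : V) : Fml V :=
  bexF q fun s => bexF s fun u => isOPairF q x u ⋏ isOPairF u y z

/-- `q = (t, (x, (y, z)))`. -/
def isQuadF {V : Type} (q t x y z : V) : Fml V :=
  bexF q fun s => bexF s fun u => isOPairF q t u ⋏ isTripleF u x y z

@[simp] theorem restricted_isTripleF {V : Type} (q x y z : V) : (isTripleF q x y z).Restricted := by
  simp [isTripleF]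

@[simp] theorem restricted_isQuadF {V : Type} (q t x y z : V) :
    (isQuadF q t x y z).Restricted := by
  simp [isQuadF]

/-! ### Ordered triples and quadruples in the model -/

section model
variable {W : Type 1} {M : Type} [K : SetModel W M] {w : W}

@[simp] theorem sat_isTripleF {V : Type} {ρ : V → M} (q x y z : V) :
    Sat w (isTripleF q x y z) ρ ↔ w ⊩ isTripleF (ρ q) (ρ x) (ρ y) (ρ z) := Iff.rfl

@[simp] theorem sat_isQuadF {V : Type} {ρ : V → M} (q t x y z : V) :
    Sat w (isQuadF q t x y z) ρ ↔ w ⊩ isQuadF (ρ q) (ρ t) (ρ x) (ρ y) (ρ z) := Iff.rfl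

theorem frc_isTripleF {q x y z : M} :
    w ⊩ isTripleF q x y z ↔ ∃ u, w ⊩ isOPairF q x u ∧ w ⊩ isOPairF u y z := by
  rw [Frc, isTripleF]
  simp only [sat_bexF, sat_and, sat_isOPairF, cons_old, cons_new, id]
  constructor
  · rintro ⟨s, -, u, -, h⟩
    exact ⟨u, h⟩
  · rintro ⟨u, h⟩
    obtain ⟨s, hs, -, hu⟩ := mem_opair_exists h.1
    exact ⟨s, hs, u, hu, h⟩

theorem frc_isQuadF {q t x y z : M} :
    w ⊩ isQuadF q t x y z ↔ ∃ u, w ⊩ isOPairF q t u ∧ w ⊩ isTripleF u x y z := by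
  rw [Frc, isQuadF]
  simp only [sat_bexF, sat_and, sat_isOPairF, sat_isTripleF, cons_old, cons_new, id]
  constructor
  · rintro ⟨s, -, u, -, h⟩
    exact ⟨u, h⟩
  · rintro ⟨u, h⟩
    obtain ⟨s, hs, -, hu⟩ := mem_opair_exists h.1
    exact ⟨s, hs, u, hu, h⟩

theorem triple_exists {x y z : M} (hx : Dom w x) (hy : Dom w y) (hz : Dom w z) :
    ∃ q, w ⊩ isTripleF q x y z := by
  obtain ⟨u, hu⟩ := opair_exists hy hz
  obtain ⟨q, hq⟩ := opair_exists hx (dom_of_isOPairF hu).1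
  exact ⟨q, frc_isTripleF.2 ⟨u, hq, hu⟩⟩

theorem triple_inj {q x y z x' y' z' : M} (h : w ⊩ isTripleF q x y z)
    (h' : w ⊩ isTripleF q x' y' z') : w ⊩ x ≐ x' ∧ w ⊩ y ≐ y' ∧ w ⊩ z ≐ z' := by
  obtain ⟨u, hq, hu⟩ := frc_isTripleF.1 h
  obtain ⟨u', hq', hu'⟩ := frc_isTripleF.1 h'
  obtain ⟨hx, huu⟩ := opair_inj hq hq'
  exact ⟨hx, opair_inj (isOPairF_congr hu huu (dom_of_isOPairF hu).2.1.refl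
    (dom_of_isOPairF hu).2.2.refl) hu'⟩

theorem triple_unique {q q' x y z : M} (h : w ⊩ isTripleF q x y z)
    (h' : w ⊩ isTripleF q' x y z) : w ⊩ q ≐ q' := by
  obtain ⟨u, hq, hu⟩ := frc_isTripleF.1 h
  obtain ⟨u', hq', hu'⟩ := frc_isTripleF.1 h'
  exact opair_unique (isOPairF_congr hq (dom_of_isOPairF hq).1.refl (dom_of_isOPairF hq).2.1.refl
    (opair_unique hu hu')) hq'

theorem dom_of_isTripleF {q x y z : M} (h : w ⊩ isTripleF q x y z) :
    Dom w q ∧ Dom w x ∧ Dom w y ∧ Dom w z := by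
  obtain ⟨u, hq, hu⟩ := frc_isTripleF.1 h
  exact ⟨(dom_of_isOPairF hq).1, (dom_of_isOPairF hq).2.1, (dom_of_isOPairF hu).2⟩

theorem quad_exists {t x y z : M} (ht : Dom w t) (hx : Dom w x) (hy : Dom w y) (hz : Dom w z) :
    ∃ q, w ⊩ isQuadF q t x y z := by
  obtain ⟨u, hu⟩ := triple_exists hx hy hz
  obtain ⟨q, hq⟩ := opair_exists ht (dom_of_isTripleF hu).1
  exact ⟨q, frc_isQuadF.2 ⟨u, hq, hu⟩⟩

theorem isTripleF_congr {q x y z q' x' y' z' : M} (h : w ⊩ isTripleF q x y z) (hq : w ⊩ q ≐ q')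
    (hx : w ⊩ x ≐ x') (hy : w ⊩ y ≐ y') (hz : w ⊩ z ≐ z') : w ⊩ isTripleF q' x' y' z' :=
  Sat.congr (φ := isTripleF (0 : Fin 4) 1 2 3) (ρ := ![q, x, y, z]) (ρ' := ![q', x', y', z']) h
    (by intro v; fin_cases v <;> assumption)

theorem quad_inj {q t x y z t' x' y' z' : M} (h : w ⊩ isQuadF q t x y z)
    (h' : w ⊩ isQuadF q t' x' y' z') :
    w ⊩ t ≐ t' ∧ w ⊩ x ≐ x' ∧ w ⊩ y ≐ y' ∧ w ⊩ z ≐ z' := by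
  obtain ⟨u, hq, hu⟩ := frc_isQuadF.1 h
  obtain ⟨u', hq', hu'⟩ := frc_isQuadF.1 h'
  obtain ⟨ht, huu⟩ := opair_inj hq hq'
  obtain ⟨-, hx, hy, hz⟩ := dom_of_isTripleF hu
  exact ⟨ht, triple_inj (isTripleF_congr hu huu hx.refl hy.refl hz.refl) hu'⟩

theorem quad_unique {q q' t x y z : M} (h : w ⊩ isQuadF q t x y z)
    (h' : w ⊩ isQuadF q' t x y z) : w ⊩ q ≐ q' := by
  obtain ⟨u, hq, hu⟩ := frc_isQuadF.1 h
  obtain ⟨u', hq', hu'⟩ := frc_isQuadF.1 h'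
  exact opair_unique (isOPairF_congr hq (dom_of_isOPairF hq).1.refl (dom_of_isOPairF hq).2.1.refl
    (triple_unique hu hu')) hq'

theorem isSet_triple {A B C : M} (hA : Dom w A) (hB : Dom w B) (hC : Dom w C) :
    IsSet w fun w' q => ∃ x, w' ⊩ x ∊ A ∧ ∃ y, w' ⊩ y ∊ B ∧ ∃ z, w' ⊩ z ∊ C ∧
      w' ⊩ isTripleF q x y z := by
  obtain ⟨Z, hZ, hZ'⟩ := isSet_prod hB hC
  refine (isSet_prod hA hZ).congr fun w' hw q => exists_congr fun x => and_congr_right fun _ => ?_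
  simp only [hZ' w' hw, frc_isTripleF]
  constructor
  · rintro ⟨u, ⟨y, hy, z, hz, hu⟩, hq⟩
    exact ⟨y, hy, z, hz, u, hq, hu⟩
  · rintro ⟨y, hy, z, hz, u, hq, hu⟩
    exact ⟨u, ⟨y, hy, z, hz, hu⟩, hq⟩

theorem isSet_quad {A B C D : M} (hA : Dom w A) (hB : Dom w B) (hC : Dom w C) (hD : Dom w D) :
    IsSet w fun w' q => ∃ t, w' ⊩ t ∊ A ∧ ∃ x, w' ⊩ x ∊ B ∧ ∃ y, w' ⊩ y ∊ C ∧ ∃ z, w' ⊩ z ∊ D ∧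
      w' ⊩ isQuadF q t x y z := by
  obtain ⟨Z, hZ, hZ'⟩ := isSet_triple hB hC hD
  refine (isSet_prod hA hZ).congr fun w' hw q => exists_congr fun x => and_congr_right fun _ => ?_
  simp only [hZ' w' hw, frc_isQuadF]
  constructor
  · rintro ⟨u, ⟨x, hx, y, hy, z, hz, hu⟩, hq⟩
    exact ⟨x, hx, y, hy, z, hz, u, hq, hu⟩
  · rintro ⟨x, hx, y, hy, z, hz, u, hq, hu⟩
    exact ⟨u, ⟨x, hx, y, hy, z, hz, hu⟩, hq⟩

/-! ### Rules given by restricted conditions -/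

/-- `α` is closed under the rules `{y ∈ X | P q y} ⟶ {y ∈ X | Q q y}` for `q ∈ A`. -/
def ClosedUnder (w : W) (A X : M) (P Q : W → M → M → Prop) (α : M) : Prop :=
  ∀ v, w ≤ v → ∀ q, v ⊩ q ∊ A → (∀ v', v ≤ v' → ∀ y, v' ⊩ y ∊ X → P v' q y → v' ⊩ y ∊ α) →
    ∃ y, v ⊩ y ∊ X ∧ Q v q y ∧ v ⊩ y ∊ α

/-- Rules described by conditions on a code q are turned by Replacement into a genuine set of pairs
of subsets. Two families are provided because two kinds of rules are needed below. -/
theorem setGenerated_of_closedUnder {ρ : Empty → M} (h : Sat w (finitaryNID : Fml Empty) ρ)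
    {A₁ A₂ X : M} (hA₁ : Dom w A₁) (hA₂ : Dom w A₂) (hX : Dom w X)
    {P₁ Q₁ P₂ Q₂ : W → M → M → Prop} (hP₁ : RestrDefinable w P₁) (hQ₁ : RestrDefinable w Q₁)
    (hP₂ : RestrDefinable w P₂) (hQ₂ : RestrDefinable w Q₂)
    (fin₁ : ∀ w', w ≤ w' → ∀ q, w' ⊩ q ∊ A₁ → ∀ U, IsComp w' U X (fun v y => P₁ v q y) →
      w' ⊩ isFinEnumF U)
    (fin₂ : ∀ w', w ≤ w' → ∀ q, w' ⊩ q ∊ A₂ → ∀ U, IsComp w' U X (fun v y => P₂ v q y) →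
      w' ⊩ isFinEnumF U) :
    SetGenerated w fun v α => v ⊩ subF α X ∧ ClosedUnder v A₁ X P₁ Q₁ α ∧
      ClosedUnder v A₂ X P₂ Q₂ α := by
  obtain ⟨R, hR, hR'⟩ := isSet_or (isSet_opair_comp hA₁ hX hP₁ hQ₁) (isSet_opair_comp hA₂ hX hP₂ hQ₂)
  have hcomp : ∀ {w'}, w ≤ w' → ∀ {U : M} {P : W → M → Prop}, IsComp w' U X P → w' ⊩ subF U X :=
    fun hw U P hU => frc_subF.2 fun v hv y hy => ((hU.2 v hv y).1 hy).1
  have hrules : w ⊩ isFinitaryRuleSetF X R := by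
    refine frc_isFinitaryRuleSetF.2 fun w' hw p hp => ?_
    rcases (hR' w' hw p).1 hp with ⟨q, hq, U, V, hpUV, hU, hV⟩ | ⟨q, hq, U, V, hpUV, hU, hV⟩
    · exact ⟨U, hU.1, V, hV.1, hpUV, hcomp hw hU, hcomp hw hV, fin₁ w' hw q hq U hU⟩
    · exact ⟨U, hU.1, V, hV.1, hpUV, hcomp hw hU, hcomp hw hV, fin₂ w' hw q hq U hU⟩
  have hrel : ∀ {w'}, w ≤ w' → ∀ x y, w' ⊩ relF R x y ↔
      (∃ q, w' ⊩ q ∊ A₁ ∧ IsComp w' x X (fun v y => P₁ v q y) ∧ IsComp w' y X fun v y => Q₁ v q y) ∨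
      (∃ q, w' ⊩ q ∊ A₂ ∧ IsComp w' x X (fun v y => P₂ v q y) ∧
        IsComp w' y X fun v y => Q₂ v q y) := by
    intro w' hw x y
    constructor
    · intro h
      obtain ⟨p, hp, hpxy⟩ := frc_relF.1 h
      refine ((hR' w' hw p).1 hp).imp ?_ ?_ <;>
      · rintro ⟨q, hq, U, V, hpUV, hU, hV⟩
        obtain ⟨hUx, hVy⟩ := opair_inj hpUV hpxy
        exact ⟨q, hq, hU.congr hUx, hV.congr hVy⟩
    · rintro (⟨q, hq, hx, hy⟩ | ⟨q, hq, hx, hy⟩)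
      all_goals obtain ⟨p, hp⟩ := opair_exists hx.1 hy.1
      · exact relF_intro hp ((hR' w' hw p).2 (.inl ⟨q, hq, x, y, hp, hx, hy⟩))
      · exact relF_intro hp ((hR' w' hw p).2 (.inr ⟨q, hq, x, y, hp, hx, hy⟩))
  have hclosed : ∀ {w'}, w ≤ w' → ∀ α, w' ⊩ isClosedSubsetF X R α ↔ w' ⊩ subF α X ∧
      ClosedUnder w' A₁ X P₁ Q₁ α ∧ ClosedUnder w' A₂ X P₂ Q₂ α := by
    intro w' hw α
    rw [frc_isClosedSubsetF]
    refine and_congr_right fun _ => ⟨fun h => ⟨?_, ?_⟩, ?_⟩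
    · intro v hv q hq hprem
      obtain ⟨x, hx⟩ := exists_isComp hP₁ (hw.trans hv) hq.dom_left (hX.up (hw.trans hv))
      obtain ⟨y, hy⟩ := exists_isComp hQ₁ (hw.trans hv) hq.dom_left (hX.up (hw.trans hv))
      obtain ⟨z, hz, hzα⟩ := h v hv x y ((hrel (hw.trans hv) x y).2 (.inl ⟨q, hq, hx, hy⟩))
        (frc_subF.2 fun v' hv' z hz => by
          obtain ⟨hzX, hzP⟩ := (hx.2 v' hv' z).1 hz
          exact hprem v' hv' z hzX hzP)
      obtain ⟨hzX, hzQ⟩ := (hy.2 v le_rfl z).1 hz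
      exact ⟨z, hzX, hzQ, hzα⟩
    · intro v hv q hq hprem
      obtain ⟨x, hx⟩ := exists_isComp hP₂ (hw.trans hv) hq.dom_left (hX.up (hw.trans hv))
      obtain ⟨y, hy⟩ := exists_isComp hQ₂ (hw.trans hv) hq.dom_left (hX.up (hw.trans hv))
      obtain ⟨z, hz, hzα⟩ := h v hv x y ((hrel (hw.trans hv) x y).2 (.inr ⟨q, hq, hx, hy⟩))
        (frc_subF.2 fun v' hv' z hz => by
          obtain ⟨hzX, hzP⟩ := (hx.2 v' hv' z).1 hz
          exact hprem v' hv' z hzX hzP)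
      obtain ⟨hzX, hzQ⟩ := (hy.2 v le_rfl z).1 hz
      exact ⟨z, hzX, hzQ, hzα⟩
    · rintro ⟨h₁, h₂⟩ v hv x y hxy hxα
      rcases (hrel (hw.trans hv) x y).1 hxy with ⟨q, hq, hx, hy⟩ | ⟨q, hq, hx, hy⟩
      · obtain ⟨z, hzX, hzQ, hzα⟩ := h₁ v hv q hq fun v' hv' z hzX hzP =>
          frc_sub (hxα.up hv') ((hx.2 v' hv' z).2 ⟨hzX, hzP⟩)
        exact ⟨z, (hy.2 v le_rfl z).2 ⟨hzX, hzQ⟩, hzα⟩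
      · obtain ⟨z, hzX, hzQ, hzα⟩ := h₂ v hv q hq fun v' hv' z hzX hzP =>
          frc_sub (hxα.up hv') ((hx.2 v' hv' z).2 ⟨hzX, hzP⟩)
        exact ⟨z, (hy.2 v le_rfl z).2 ⟨hzX, hzQ⟩, hzα⟩
  obtain ⟨G, hG, hG₁, hG₂⟩ := sat_finitaryNID.1 h w le_rfl X R hX hR hrules
  exact ⟨G, hG, fun v hv β hβ => (hclosed hv β).1 (hG₁ v hv β hβ),
    fun v hv α hαd hα => hG₂ v hv α hαd ((hclosed hv α).2 hα)⟩

/-! ### Auxiliary sets -/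

/-- A set that is not an element of a given set. -/
theorem exists_not_mem {Y : M} (hY : Dom w Y) : ∃ t, Dom w t ∧ ∀ w', w ≤ w' → ¬ w' ⊩ t ∊ Y := by
  -- Russell's set {z ∈ Y | z ∉ z}: it is not an element of itself, hence not of Y.
  obtain ⟨t, ht, ht'⟩ := isSet_restr (w := w) (P := fun v _ z => ∀ v', v ≤ v' → v' ⊩ z ∊ z → False)
    ⟨form₂ fun _ z => z ∊ z ⟾ .bot, by simp, fun _ _ _ _ _ _ => by simp⟩ le_rfl hY hY
  have hn : ∀ v, w ≤ v → ¬ v ⊩ t ∊ t := fun v hv h => ((ht' v hv t).1 h).2 v le_rfl h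
  exact ⟨t, ht, fun v hv h => hn v hv ((ht' v hv t).2 ⟨h, fun v' hv' => hn v' (hv.trans hv')⟩)⟩

/-- A set that contains all indices of a family. -/
theorem exists_index_bound {I : M} (hI : Dom w I) : ∃ Y, Dom w Y ∧
    ∀ w', w ≤ w' → ∀ a i, w' ⊩ memFamF I a i → w' ⊩ i ∊ Y := by
  -- Three unions, since an index is reached by i ∈ J ∈ {a, J} ∈ (a, J) ∈ I.
  obtain ⟨A, hA, hA'⟩ := isSet_union hI
  obtain ⟨B, hB, hB'⟩ := isSet_union hA
  obtain ⟨Y, hY, hY'⟩ := isSet_union hB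
  refine ⟨Y, hY, fun w' hw a i h => ?_⟩
  obtain ⟨p, hp, t, ht, u, hu, -, hi⟩ := frc_memFamF.1 h
  exact (hY' w' hw i).2 ⟨u, (hB' w' hw u).2 ⟨t, (hA' w' hw t).2 ⟨p, hp, ht⟩, hu⟩, hi⟩

/-- A set that is not the first component of any pair in a given set. -/
theorem exists_fresh_tag {X : M} (hX : Dom w X) : ∃ t, Dom w t ∧
    ∀ w', w ≤ w' → ∀ p u, w' ⊩ p ∊ X → ¬ w' ⊩ isOPairF p t u := by
  obtain ⟨A, hA, hA'⟩ := isSet_union hX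
  obtain ⟨B, hB, hB'⟩ := isSet_union hA
  obtain ⟨t, ht, ht'⟩ := exists_not_mem hB
  refine ⟨t, ht, fun w' hw p u hp h => ht' w' hw ?_⟩
  obtain ⟨s, hs, hts, -⟩ := mem_opair_exists h
  exact (hB' w' hw t).2 ⟨s, (hA' w' hw s).2 ⟨p, hp, hs⟩, hts⟩

theorem isFinEnumF_singleton {u x : M} (h : w ⊩ isPairF u x x) : w ⊩ isFinEnumF u := by
  have hx := (dom_of_isPairF h).2.1
  obtain ⟨U, hU, hU'⟩ := isSet_eq hx
  obtain ⟨T, hT⟩ := finSet_exists hU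
  obtain ⟨e, he, hee⟩ := empty_mem_finSet hT
  refine isFinEnumF_insert hx ((hT.2.2 w le_rfl e).1 he).2.2 fun v hv y => ?_
  rw [mem_singleton (h.up hv)]
  exact ⟨.inr, fun hy => hy.resolve_left (frc_isEmptyF.1 hee v hv y)⟩

/-! ### Relations closed under covering requests -/

/-- For all `P ∈ F`, `a ∈ S` and `U ∈ Us` with `Rq P a U`: if `P ⊆ r`, then `a ◁ r⁻ U`. -/
def MeetsRequests (w : W) (S I C F Us : M) (Rq : W → M → M → M → Prop) (r : M) : Prop :=
  ∀ v, w ≤ v → ∀ P a U, v ⊩ P ∊ F → v ⊩ a ∊ S → v ⊩ U ∊ Us → Rq v P a U → v ⊩ subF P r →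
    Cover v S I C a fun v' c => ∃ d, v' ⊩ d ∊ U ∧ v' ⊩ relF r c d

/-- The core of the passage from NID to maps. The choice of an index i witnessing a ◁ r⁻U is
recorded as a marker in an enlarged carrier, which splits the ∃∀∃ statement into two kinds of
finitary rules. Generation is then transferred along the trace on X. -/
theorem setGenerated_meetsRequests {ρ : Empty → M} (h : Sat w (finitaryNID : Fml Empty) ρ)
    {S I C X F Us : M} (hS : Dom w S) (hI : Dom w I) (hC : Dom w C) (hUs : Dom w Us)
    (hF : IsFinSet w F X) {Rq : W → M → M → M → Prop}
    (hRq : IsSet w fun v q => ∃ P, v ⊩ P ∊ F ∧ ∃ a, v ⊩ a ∊ S ∧ ∃ U, v ⊩ U ∊ Us ∧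
      v ⊩ isTripleF q P a U ∧ Rq v P a U) :
    SetGenerated w fun v r => v ⊩ subF r X ∧ MeetsRequests v S I C F Us Rq r := by
  have hXd := hF.1
  have hFd := hF.2.1
  obtain ⟨Is, hIs, hIs'⟩ := exists_index_bound hI
  -- The tag t, never the first coordinate of a pair in X, keeps the markers (t,i,a,U) disjoint from
  -- X.
  obtain ⟨t, ht, fresh⟩ := exists_fresh_tag hXd
  obtain ⟨Mk, hMk, hMk'⟩ : IsSet w fun v m => ∃ i, v ⊩ i ∊ Is ∧ ∃ a, v ⊩ a ∊ S ∧ ∃ U, v ⊩ U ∊ Us ∧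
      v ⊩ isQuadF m t i a U := by
    obtain ⟨s, hs, hs'⟩ := isSet_eq ht
    refine (isSet_quad hs hIs hS hUs).congr fun v hv m => ⟨?_, ?_⟩
    · rintro ⟨t', ht', i, hi, a, ha, U, hU, hm⟩
      obtain ⟨u, hmu, hu⟩ := frc_isQuadF.1 hm
      exact ⟨i, hi, a, ha, U, hU, frc_isQuadF.2 ⟨u, isOPairF_congr hmu (dom_of_isOPairF hmu).1.refl
        ((hs' v hv t').1 ht') (dom_of_isOPairF hmu).2.2.refl, hu⟩⟩
    · rintro ⟨i, hi, a, ha, U, hU, hm⟩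
      exact ⟨t, (hs' v hv t).2 (ht.up hv).refl, i, hi, a, ha, U, hU, hm⟩
  obtain ⟨X', hX'd, hX'⟩ := isSet_or (isSet_mem hXd) (isSet_mem hMk)
  have hdisj : ∀ v, w ≤ v → ∀ m i a U, v ⊩ isQuadF m t i a U → ¬ v ⊩ m ∊ X := by
    intro v hv m i a U hm hmX
    obtain ⟨u, hmu, -⟩ := frc_isQuadF.1 hm
    exact fresh v hv m u hmX hmu
  obtain ⟨N₁, hN₁, hN₁'⟩ := hRq
  obtain ⟨N₂, hN₂, hN₂'⟩ : IsSet w fun v q => ∃ c, v ⊩ c ∊ S ∧ ∃ i, v ⊩ i ∊ Is ∧ ∃ a, v ⊩ a ∊ S ∧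
      ∃ U, v ⊩ U ∊ Us ∧ v ⊩ isQuadF q c i a U ∧ v ⊩ memFam₂F C a i c := by
    obtain ⟨Z, hZ, hZ'⟩ := isSet_quad hS hIs hS hUs
    refine (isSet_restr (P := fun v _ q => ∃ c, v ⊩ c ∊ S ∧ ∃ i, v ⊩ i ∊ Is ∧ ∃ a, v ⊩ a ∊ S ∧
      ∃ U, v ⊩ U ∊ Us ∧ v ⊩ isQuadF q c i a U ∧ v ⊩ memFam₂F C a i c)
      ⟨form₂ fun _ q => bexF (par hS) fun c => bexF (par hIs) fun i => bexF (par hS) fun a =>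
        bexF (par hUs) fun U => isQuadF q c i a U ⋏ memFam₂F (par hC) a i c, by simp,
        fun _ _ _ _ _ _ => by simp⟩ le_rfl hZ hZ).congr fun v hv q => and_iff_right_of_imp ?_
    rintro ⟨c, hc, i, hi, a, ha, U, hU, hq, -⟩
    exact (hZ' v hv q).2 ⟨c, hc, i, hi, a, ha, U, hU, hq⟩
  -- A code (P,a,U) in N₁ stands for the rule from P to the markers (t,i,a,U) with i ∈ I(a). A code
  -- (c,i,a,U) in N₂, where c ∈ C(a,i), stands for the rule from that one marker to the pairs (c,d)
  -- ∈ X with d ∈ U. The premises are thus P itself and a singleton, both finitely enumerable.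
  let P₁ : W → M → M → Prop := fun v q y => ∃ P, v ⊩ P ∊ F ∧ ∃ a, v ⊩ a ∊ S ∧ ∃ U, v ⊩ U ∊ Us ∧
    v ⊩ isTripleF q P a U ∧ v ⊩ y ∊ P
  let Q₁ : W → M → M → Prop := fun v q y => ∃ P, v ⊩ P ∊ F ∧ ∃ a, v ⊩ a ∊ S ∧ ∃ U, v ⊩ U ∊ Us ∧
    v ⊩ isTripleF q P a U ∧ ∃ i, v ⊩ i ∊ Is ∧ v ⊩ memFamF I a i ∧ v ⊩ isQuadF y t i a U
  let P₂ : W → M → M → Prop := fun v q y => ∃ c, v ⊩ c ∊ S ∧ ∃ i, v ⊩ i ∊ Is ∧ ∃ a, v ⊩ a ∊ S ∧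
    ∃ U, v ⊩ U ∊ Us ∧ v ⊩ isQuadF q c i a U ∧ v ⊩ isQuadF y t i a U
  let Q₂ : W → M → M → Prop := fun v q y => ∃ c, v ⊩ c ∊ S ∧ ∃ i, v ⊩ i ∊ Is ∧ ∃ a, v ⊩ a ∊ S ∧
    ∃ U, v ⊩ U ∊ Us ∧ v ⊩ isQuadF q c i a U ∧ ∃ d, v ⊩ d ∊ U ∧ v ⊩ isOPairF y c d ∧ v ⊩ y ∊ X
  have hP₁ : RestrDefinable w P₁ :=
    ⟨form₂ fun q y => bexF (par hFd) fun P => bexF (par hS) fun a => bexF (par hUs) fun U =>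
      isTripleF q P a U ⋏ y ∊ P, by simp, fun _ _ _ _ _ _ => by simp [P₁]⟩
  have hQ₁ : RestrDefinable w Q₁ :=
    ⟨form₂ fun q y => bexF (par hFd) fun P => bexF (par hS) fun a => bexF (par hUs) fun U =>
      isTripleF q P a U ⋏ bexF (par hIs) fun i => memFamF (par hI) a i ⋏ isQuadF y (par ht) i a U,
      by simp, fun _ _ _ _ _ _ => by simp [Q₁]⟩
  have hP₂ : RestrDefinable w P₂ :=
    ⟨form₂ fun q y => bexF (par hS) fun c => bexF (par hIs) fun i => bexF (par hS) fun a =>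
      bexF (par hUs) fun U => isQuadF q c i a U ⋏ isQuadF y (par ht) i a U,
      by simp, fun _ _ _ _ _ _ => by simp [P₂]⟩
  have hQ₂ : RestrDefinable w Q₂ :=
    ⟨form₂ fun q y => bexF (par hS) fun c => bexF (par hIs) fun i => bexF (par hS) fun a =>
      bexF (par hUs) fun U => isQuadF q c i a U ⋏ bexF U fun d => isOPairF y c d ⋏ y ∊ par hXd,
      by simp, fun _ _ _ _ _ _ => by simp [Q₂]⟩
  have fin₁ : ∀ w', w ≤ w' → ∀ q, w' ⊩ q ∊ N₁ → ∀ U, IsComp w' U X' (fun v y => P₁ v q y) →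
      w' ⊩ isFinEnumF U := by
    intro v hv q hq Y hY
    obtain ⟨P, hP, a, ha, U, hU, hq, -⟩ := (hN₁' v hv q).1 hq
    obtain ⟨hPd, hPX, hPfin⟩ := (hF.2.2 v hv P).1 hP
    refine isFinEnumF_congr hPfin (ext hPd hY.1 fun v' hv' y => ?_)
    rw [hY.2 v' hv', hX' v' (hv.trans hv')]
    constructor
    · exact fun hy => ⟨.inl (frc_sub (hPX.up hv') hy), P, hP.up hv', a, ha.up hv', U, hU.up hv',
        hq.up hv', hy⟩
    · rintro ⟨-, P', -, a', -, U', -, hq', hy⟩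
      exact hy.mem_eq (triple_inj hq' (hq.up hv')).1
  have fin₂ : ∀ w', w ≤ w' → ∀ q, w' ⊩ q ∊ N₂ → ∀ U, IsComp w' U X' (fun v y => P₂ v q y) →
      w' ⊩ isFinEnumF U := by
    intro v hv q hq Y hY
    obtain ⟨c, hc, i, hi, a, ha, U, hU, hq, -⟩ := (hN₂' v hv q).1 hq
    obtain ⟨m, hm⟩ := quad_exists (ht.up hv) hi.dom_left ha.dom_left hU.dom_left
    have hmY : v ⊩ m ∊ Y := (hY.2 v le_rfl m).2 ⟨(hX' v hv m).2 (.inr ((hMk' v hv m).2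
      ⟨i, hi, a, ha, U, hU, hm⟩)), c, hc, i, hi, a, ha, U, hU, hq, hm⟩
    refine isFinEnumF_singleton (x := m) (frc_isPairF.2 ⟨hmY, hmY, fun v' hv' y hy => .inl ?_⟩)
    obtain ⟨-, c', -, i', -, a', -, U', -, hq', hy⟩ := (hY.2 v' hv' y).1 hy
    obtain ⟨-, hii, haa, hUU⟩ := quad_inj hq' (hq.up hv')
    obtain ⟨u, hyu, hu⟩ := frc_isQuadF.1 hy
    exact quad_unique (frc_isQuadF.2 ⟨u, hyu, isTripleF_congr hu (dom_of_isTripleF hu).1.refl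
      hii haa hUU⟩) (hm.up hv')
  obtain ⟨G, hG, hG₁, hG₂⟩ :=
    setGenerated_of_closedUnder h hN₁ hN₂ hX'd hP₁ hQ₁ hP₂ hQ₂ fin₁ fin₂
  have hmem : RestrDefinable w fun v β y => v ⊩ y ∊ β :=
    ⟨form₂ fun β y => y ∊ β, by simp, fun _ _ _ _ _ _ => by simp⟩
  obtain ⟨G', hG', hG'mem⟩ := isSet_comp hG hXd hmem
  refine ⟨G', hG', ?_, ?_⟩
  · intro v hv γ hγ
    obtain ⟨β, hβ, hγβ⟩ := (hG'mem v hv γ).1 hγ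
    obtain ⟨-, hcl₁, hcl₂⟩ := hG₁ v hv β hβ
    refine ⟨frc_subF.2 fun v' hv' y hy => ((hγβ.2 v' hv' y).1 hy).1, ?_⟩
    intro v₁ hv₁ P a U hP ha hU hPaU hPγ
    have hw₁ := hv.trans hv₁
    obtain ⟨q, hq⟩ := triple_exists hP.dom_left ha.dom_left hU.dom_left
    -- The first rule puts a marker into β, and its index i witnesses the cover. The second rule,
    -- applied below to this marker and to each c ∈ C(a,i), supplies the pair (c,d).
    obtain ⟨m, hmX', ⟨P', hP', a', ha', U', hU', hq', i, hi, hIi, hm⟩, hmβ⟩ := hcl₁ v₁ hv₁ q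
      ((hN₁' v₁ hw₁ q).2 ⟨P, hP, a, ha, U, hU, hq, hPaU⟩) (by
        rintro v₂ hv₂ y - ⟨P', -, a', -, U', -, hq', hy⟩
        exact ((hγβ.2 v₂ (hv₁.trans hv₂) y).1 (frc_sub (hPγ.up hv₂)
          (hy.mem_eq (triple_inj hq' (hq.up hv₂)).1))).2)
    obtain ⟨-, haa, hUU⟩ := triple_inj hq' hq
    have hm : v₁ ⊩ isQuadF m t i a U := by
      obtain ⟨u, hmu, hu⟩ := frc_isQuadF.1 hm
      exact frc_isQuadF.2 ⟨u, hmu, isTripleF_congr hu (dom_of_isTripleF hu).1.refl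
        hi.dom_left.refl haa hUU⟩
    have hIi : v₁ ⊩ memFamF I a i := by
      obtain ⟨L, hL, hiL⟩ := memFamF_iff.1 hIi
      exact memFamF_iff.2 ⟨L, relF_congr hL haa hiL.dom_right.refl, hiL⟩
    refine ⟨i, hIi, fun v₂ hv₂ c hc hcC => ?_⟩
    have hw₂ := hw₁.trans hv₂
    obtain ⟨q₂, hq₂⟩ := quad_exists hc.dom_left (hi.dom_left.up hv₂) (ha.dom_left.up hv₂)
      (hU.dom_left.up hv₂)
    obtain ⟨y, -, ⟨c', hc', i', hi', a', ha', U', hU', hq', d, hd, hy, hyX⟩, hyβ⟩ := hcl₂ v₂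
      (hv₁.trans hv₂) q₂ ((hN₂' v₂ hw₂ q₂).2 ⟨c, hc, i, hi.up hv₂, a, ha.up hv₂, U, hU.up hv₂, hq₂,
        hcC⟩) (by
        rintro v₃ hv₃ y - ⟨c', -, i', -, a', -, U', -, hq', hy⟩
        obtain ⟨-, hii, haa, hUU⟩ := quad_inj hq' (hq₂.up hv₃)
        obtain ⟨u, hyu, hu⟩ := frc_isQuadF.1 hy
        exact (quad_unique (hm.up (hv₂.trans hv₃)) (frc_isQuadF.2 ⟨u, hyu, isTripleF_congr hu
          (dom_of_isTripleF hu).1.refl hii haa hUU⟩)).eq_mem (hmβ.up (hv₂.trans hv₃)))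
    obtain ⟨hcc, -, -, hUU⟩ := quad_inj hq' hq₂
    exact ⟨d, hd.mem_eq hUU, relF_intro (isOPairF_congr hy (dom_of_isOPairF hy).1.refl hcc
      (dom_of_isOPairF hy).2.2.refl) ((hγβ.2 v₂ (hv₁.trans hv₂) y).2 ⟨hyX, hyβ⟩)⟩
  · rintro v hv r hrd ⟨hrX, hreq⟩ z hz
    -- A consists of the markers whose promise is kept by r. Adding all of them to r gives a closed
    -- α without choosing indices.
    obtain ⟨A, hA, hA'⟩ := isSet_restr (w := v) (P := fun v _ m => ∃ i, v ⊩ i ∊ Is ∧ ∃ a, v ⊩ a ∊ S ∧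
      ∃ U, v ⊩ U ∊ Us ∧ v ⊩ isQuadF m t i a U ∧ ∀ v', v ≤ v' → ∀ c, v' ⊩ c ∊ S →
        ∀ v'', v' ≤ v'' → v'' ⊩ memFam₂F C a i c → ∃ d, v'' ⊩ d ∊ U ∧ v'' ⊩ relF r c d)
      ⟨form₂ fun _ m => bexF (par (hIs.up hv)) fun i => bexF (par (hS.up hv)) fun a =>
        bexF (par (hUs.up hv)) fun U => isQuadF m (par (ht.up hv)) i a U ⋏ ballF (par (hS.up hv))
          fun c => memFam₂F (par (hC.up hv)) a i c ⟾ bexF U fun d => relF (par hrd) c d, by simp,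
        fun _ _ _ _ _ _ => by simp⟩ le_rfl hrd (hMk.up hv)
    obtain ⟨α, hα, hα'⟩ := isSet_or (isSet_mem hrd) (isSet_mem hA)
    have hXr : ∀ v', v ≤ v' → ∀ y, v' ⊩ y ∊ α → v' ⊩ y ∊ X → v' ⊩ y ∊ r := by
      intro v' hv' y hy hyX
      refine ((hα' v' hv' y).1 hy).resolve_right fun hyA => ?_
      obtain ⟨-, i, -, a, -, U, -, hy, -⟩ := (hA' v' hv' y).1 hyA
      exact hdisj v' (hv.trans hv') y i a U hy hyX
    have hαX' : v ⊩ subF α X' := by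
      refine frc_subF.2 fun v' hv' y hy => (hX' v' (hv.trans hv') y).2 ?_
      exact ((hα' v' hv' y).1 hy).imp (frc_sub (hrX.up hv')) fun hy => ((hA' v' hv' y).1 hy).1
    have hcl₁ : ClosedUnder v N₁ X' P₁ Q₁ α := by
      intro v₁ hv₁ q hq hprem
      have hw₁ := hv.trans hv₁
      obtain ⟨P, hP, a, ha, U, hU, hq, hPaU⟩ := (hN₁' v₁ hw₁ q).1 hq
      have hPX : v₁ ⊩ subF P X := ((hF.2.2 v₁ hw₁ P).1 hP).2.1
      obtain ⟨i, hIi, hcov⟩ := hreq v₁ hv₁ P a U hP ha hU hPaU (by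
        refine frc_subF.2 fun v₂ hv₂ y hy => ?_
        have hyX := frc_sub (hPX.up hv₂) hy
        exact hXr v₂ (hv₁.trans hv₂) y (hprem v₂ hv₂ y ((hX' v₂ (hw₁.trans hv₂) y).2 (.inl hyX))
          ⟨P, hP.up hv₂, a, ha.up hv₂, U, hU.up hv₂, hq.up hv₂, hy⟩) hyX)
      have hi := hIs' v₁ hw₁ a i hIi
      obtain ⟨m, hm⟩ := quad_exists (ht.up hw₁) hi.dom_left ha.dom_left hU.dom_left
      have hmMk := (hMk' v₁ hw₁ m).2 ⟨i, hi, a, ha, U, hU, hm⟩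
      refine ⟨m, (hX' v₁ hw₁ m).2 (.inr hmMk), ⟨P, hP, a, ha, U, hU, hq, i, hi, hIi, hm⟩,
        (hα' v₁ hv₁ m).2 (.inr ((hA' v₁ hv₁ m).2 ⟨hmMk, i, hi, a, ha, U, hU, hm, ?_⟩))⟩
      exact fun v₂ hv₂ c hc v₃ hv₃ hcC => hcov v₃ (hv₂.trans hv₃) c (hc.up hv₃) hcC
    have hcl₂ : ClosedUnder v N₂ X' P₂ Q₂ α := by
      intro v₁ hv₁ q hq hprem
      have hw₁ := hv.trans hv₁
      obtain ⟨c, hc, i, hi, a, ha, U, hU, hq, hcC⟩ := (hN₂' v₁ hw₁ q).1 hq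
      obtain ⟨m, hm⟩ := quad_exists (ht.up hw₁) hi.dom_left ha.dom_left hU.dom_left
      have hmMk := (hMk' v₁ hw₁ m).2 ⟨i, hi, a, ha, U, hU, hm⟩
      have hmα := hprem v₁ le_rfl m ((hX' v₁ hw₁ m).2 (.inr hmMk))
        ⟨c, hc, i, hi, a, ha, U, hU, hq, hm⟩
      -- A marker in α cannot come from r ⊆ X, so its promise holds.
      have hmA := ((hα' v₁ hv₁ m).1 hmα).resolve_left fun hmr =>
        hdisj v₁ hw₁ m i a U hm (frc_sub (hrX.up hv₁) hmr)
      obtain ⟨-, i', -, a', -, U', -, hm', hval⟩ := (hA' v₁ hv₁ m).1 hmA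
      obtain ⟨-, hii, haa, hUU⟩ := quad_inj hm' hm
      have hcC' : v₁ ⊩ memFam₂F C a' i' c := by
        obtain ⟨p, hp, hpc⟩ := memFam₂F_iff.1 hcC
        exact memFam₂F_iff.2
          ⟨p, isOPairF_congr hp (dom_of_isOPairF hp).1.refl haa.symm hii.symm, hpc⟩
      obtain ⟨d, hd, hcd⟩ := hval v₁ le_rfl c hc v₁ le_rfl hcC'
      obtain ⟨p, hp, hpcd⟩ := frc_relF.1 hcd
      have hpX := frc_sub (hrX.up hv₁) hp
      exact ⟨p, (hX' v₁ hw₁ p).2 (.inl hpX), ⟨c, hc, i, hi, a, ha, U, hU, hq, d, hd.mem_eq hUU,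
        hpcd, hpX⟩, (hα' v₁ hv₁ p).2 (.inl hp)⟩
    obtain ⟨β, hβ, hzβ, hβα⟩ := hG₂ v hv α hα ⟨hαX', hcl₁, hcl₂⟩ z ((hα' v le_rfl z).2 (.inl hz))
    obtain ⟨γ, hγ⟩ := exists_isComp hmem hv hβ.dom_left (hXd.up hv)
    refine ⟨γ, (hG'mem v hv γ).2 ⟨β, hβ, hγ⟩, (hγ.2 v le_rfl z).2 ⟨frc_sub hrX hz, hzβ⟩,
      frc_subF.2 fun v' hv' y hy => ?_⟩
    obtain ⟨hyX, hyβ⟩ := (hγ.2 v' hv' y).1 hy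
    exact hXr v' hv' y (frc_sub (hβα.up hv') hyβ) hyX

/-! ### Formal topology maps as relations that meet requests -/

/-- A formal topology map that includes `P` has to cover `a` by the inverse image of `U`. -/
def MapRequest (S le T le' J Js D : M) (w : W) (P a U : M) : Prop :=
  w ⊩ subF T U ∨
  (∃ b₁, w ⊩ b₁ ∊ T ∧ ∃ b₂, w ⊩ b₂ ∊ T ∧ ∃ x, w ⊩ x ∊ S ∧ ∃ y, w ⊩ y ∊ S ∧ w ⊩ relF P x b₁ ∧
    w ⊩ relF P y b₂ ∧ w ⊩ relF le a x ∧ w ⊩ relF le a y ∧ ∀ v, w ≤ v → ∀ d, v ⊩ d ∊ T →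
      ∀ v', v ≤ v' → v' ⊩ relF le' d b₁ ∧ v' ⊩ relF le' d b₂ → v' ⊩ d ∊ U) ∨
  (∃ b₁, w ⊩ b₁ ∊ T ∧ ∃ b₂, w ⊩ b₂ ∊ T ∧ w ⊩ relF le' b₁ b₂ ∧ w ⊩ relF P a b₁ ∧ w ⊩ b₂ ∊ U) ∨
  ∃ b, w ⊩ b ∊ T ∧ ∃ j, w ⊩ j ∊ Js ∧ w ⊩ memFamF J b j ∧ w ⊩ relF P a b ∧ ∀ v, w ≤ v →
    ∀ d, v ⊩ d ∊ T → ∀ v', v ≤ v' → v' ⊩ memFam₂F D b j d → v' ⊩ d ∊ U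

/-- The class `P` of elements of `T` is an element of `Us`. -/
def HasComp (w : W) (Us T : M) (P : W → M → Prop) : Prop := ∃ U, w ⊩ U ∊ Us ∧ IsComp w U T P

/-- Without power sets, U cannot range over all subsets of T. The targets occurring in the map
conditions, namely T, b₁ ↓ b₂, {b} and D(b,j), are families indexed by sets and so can be collected.
-/
theorem requestTargets_exist {T le' D Js : M} (hT : Dom w T) (hle' : Dom w le') (hD : Dom w D)
    (hJs : Dom w Js) : ∃ Us, Dom w Us ∧ w ⊩ T ∊ Us ∧ ∀ w', w ≤ w' →
      (∀ b₁ b₂, w' ⊩ b₁ ∊ T → w' ⊩ b₂ ∊ T →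
        HasComp w' Us T fun v d => v ⊩ relF le' d b₁ ∧ v ⊩ relF le' d b₂) ∧
      (∀ b, w' ⊩ b ∊ T → HasComp w' Us T fun v d => v ⊩ d ≐ b) ∧
      ∀ b j, w' ⊩ b ∊ T → w' ⊩ j ∊ Js → HasComp w' Us T fun v d => v ⊩ memFam₂F D b j d := by
  obtain ⟨A, hA, hA'⟩ := isSet_prod hT hT
  obtain ⟨B, hB, hB'⟩ := isSet_prod hT hJs
  obtain ⟨Us, hUs, hUs'⟩ := isSet_or (isSet_or (isSet_eq hT)
    (isSet_comp hA hT (P := fun v q d => ∃ b₁, v ⊩ b₁ ∊ T ∧ ∃ b₂, v ⊩ b₂ ∊ T ∧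
      v ⊩ isOPairF q b₁ b₂ ∧ v ⊩ relF le' d b₁ ∧ v ⊩ relF le' d b₂)
      ⟨form₂ fun q d => bexF (par hT) fun b₁ => bexF (par hT) fun b₂ => isOPairF q b₁ b₂ ⋏
        relF (par hle') d b₁ ⋏ relF (par hle') d b₂, by simp, fun _ _ _ _ _ _ => by simp⟩))
    (isSet_or (isSet_comp hT hT (P := fun v b d => v ⊩ d ≐ b)
      ⟨form₂ fun b d => d ≐ b, by simp, fun _ _ _ _ _ _ => by simp⟩)
    (isSet_comp hB hT (P := fun v q d => ∃ b, v ⊩ b ∊ T ∧ ∃ j, v ⊩ j ∊ Js ∧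
      v ⊩ isOPairF q b j ∧ v ⊩ memFam₂F D b j d)
      ⟨form₂ fun q d => bexF (par hT) fun b => bexF (par hJs) fun j => isOPairF q b j ⋏
        memFam₂F (par hD) b j d, by simp, fun _ _ _ _ _ _ => by simp⟩))
  refine ⟨Us, hUs, (hUs' w le_rfl T).2 (.inl (.inl hT.refl)), fun w' hw => ⟨?_, ?_, ?_⟩⟩
  · intro b₁ b₂ hb₁ hb₂
    obtain ⟨q, hq⟩ := opair_exists hb₁.dom_left hb₂.dom_left
    obtain ⟨U, hU, hU'⟩ := isSet_restr (w := w') (P := fun v q d => ∃ b₁, v ⊩ b₁ ∊ T ∧ ∃ b₂,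
      v ⊩ b₂ ∊ T ∧ v ⊩ isOPairF q b₁ b₂ ∧ v ⊩ relF le' d b₁ ∧ v ⊩ relF le' d b₂)
      ⟨form₂ fun q d => bexF (par (hT.up hw)) fun b₁ => bexF (par (hT.up hw)) fun b₂ =>
        isOPairF q b₁ b₂ ⋏ relF (par (hle'.up hw)) d b₁ ⋏ relF (par (hle'.up hw)) d b₂, by simp,
        fun _ _ _ _ _ _ => by simp⟩ le_rfl (dom_of_isOPairF hq).1 (hT.up hw)
    refine ⟨U, (hUs' w' hw U).2 (.inl (.inr ⟨q, (hA' w' hw q).2 ⟨b₁, hb₁, b₂, hb₂, hq⟩, hU, hU'⟩)),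
      hU, fun v hv d => (hU' v hv d).trans (and_congr_right fun hd => ⟨?_, fun h =>
        ⟨b₁, hb₁.up hv, b₂, hb₂.up hv, hq.up hv, h⟩⟩)⟩
    rintro ⟨b₁', -, b₂', -, hq', h₁, h₂⟩
    obtain ⟨e₁, e₂⟩ := opair_inj hq' (hq.up hv)
    exact ⟨relF_congr h₁ hd.dom_left.refl e₁, relF_congr h₂ hd.dom_left.refl e₂⟩
  · intro b hb
    obtain ⟨U, hU⟩ := isSet_restr (w := w') (P := fun v b d => v ⊩ d ≐ b)
      ⟨form₂ fun b d => d ≐ b, by simp, fun _ _ _ _ _ _ => by simp⟩ le_rfl hb.dom_left (hT.up hw)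
    exact ⟨U, (hUs' w' hw U).2 (.inr (.inl ⟨b, hb, hU⟩)), hU⟩
  · intro b j hb hj
    obtain ⟨q, hq⟩ := opair_exists hb.dom_left hj.dom_left
    obtain ⟨U, hU, hU'⟩ := isSet_restr (w := w') (P := fun v q d => ∃ b, v ⊩ b ∊ T ∧ ∃ j,
      v ⊩ j ∊ Js ∧ v ⊩ isOPairF q b j ∧ v ⊩ memFam₂F D b j d)
      ⟨form₂ fun q d => bexF (par (hT.up hw)) fun b => bexF (par (hJs.up hw)) fun j =>
        isOPairF q b j ⋏ memFam₂F (par (hD.up hw)) b j d, by simp, fun _ _ _ _ _ _ => by simp⟩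
      le_rfl (dom_of_isOPairF hq).1 (hT.up hw)
    refine ⟨U, (hUs' w' hw U).2 (.inr (.inr ⟨q, (hB' w' hw q).2 ⟨b, hb, j, hj, hq⟩, hU, hU'⟩)),
      hU, fun v hv d => (hU' v hv d).trans (and_congr_right fun hd => ⟨?_, fun h =>
        ⟨b, hb.up hv, j, hj.up hv, hq.up hv, h⟩⟩)⟩
    rintro ⟨b', -, j', -, hq', h⟩
    obtain ⟨e₁, e₂⟩ := opair_inj hq' (hq.up hv)
    obtain ⟨p, hp, hpd⟩ := memFam₂F_iff.1 h
    exact memFam₂F_iff.2 ⟨p, isOPairF_congr hp (dom_of_isOPairF hp).1.refl e₁ e₂, hpd⟩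

/-- A request only asks that U include the target of a map condition, and covers are monotone, so
maps meet all requests. Conversely, each map condition is the request whose U is the exact target
and whose P is the finite part of r mentioned in the condition: empty, a pair or a singleton. -/
theorem frc_isFTopMapF_iff_meetsRequests {S le I C T le' J D X F Js Us r : M}
    (hX : ∀ w', w ≤ w' → ∀ z, w' ⊩ z ∊ X ↔
      ∃ c, w' ⊩ c ∊ S ∧ ∃ d, w' ⊩ d ∊ T ∧ w' ⊩ isOPairF z c d)
    (hF : IsFinSet w F X) (hJs : ∀ w', w ≤ w' → ∀ b j, w' ⊩ memFamF J b j → w' ⊩ j ∊ Js)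
    (hTUs : w ⊩ T ∊ Us) (hUs : ∀ w', w ≤ w' →
      (∀ b₁ b₂, w' ⊩ b₁ ∊ T → w' ⊩ b₂ ∊ T →
        HasComp w' Us T fun v d => v ⊩ relF le' d b₁ ∧ v ⊩ relF le' d b₂) ∧
      (∀ b, w' ⊩ b ∊ T → HasComp w' Us T fun v d => v ⊩ d ≐ b) ∧
      ∀ b j, w' ⊩ b ∊ T → w' ⊩ j ∊ Js → HasComp w' Us T fun v d => v ⊩ memFam₂F D b j d)
    {v : W} (hv : w ≤ v) : v ⊩ isFTopMapF S le I C T le' J D r ↔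
      v ⊩ subF r X ∧ MeetsRequests v S I C F Us (MapRequest S le T le' J Js D) r := by
  have hrel : v ⊩ isRelF r S T ↔ v ⊩ subF r X := by
    rw [frc_isRelF, frc_subF]
    exact forall₂_congr fun v' hv' => forall₂_congr fun p _ => (hX v' (hv.trans hv') p).symm
  rw [frc_isFTopMapF, hrel]
  have hsub : ∀ {u : W} {P : M}, u ⊩ subF P r → ∀ {x y}, u ⊩ relF P x y → u ⊩ relF r x y := by
    intro u P hP x y h
    obtain ⟨p, hp, hpxy⟩ := frc_relF.1 h
    exact relF_intro hpxy (frc_sub hP hp)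
  refine and_congr_right fun hrX => ⟨?_, fun h => ⟨?_, ?_, ?_, ?_⟩⟩
  · rintro ⟨h₁, h₂, h₃, h₄⟩ u hu P a U hP ha hU hreq hPr
    rcases hreq with hTU | ⟨b₁, hb₁, b₂, hb₂, x, hx, y, hy, hxb, hyb, hax, hay, hUb⟩ |
      ⟨b₁, hb₁, b₂, hb₂, hb, hab, hbU⟩ | ⟨b, hb, j, -, hj, hab, hUb⟩
    · refine (h₁ u hu a ha).mono fun u' hu' c _ => ?_
      rintro ⟨d, hd, hcd⟩
      exact ⟨d, frc_sub (hTU.up hu') hd, hcd⟩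
    · refine (h₂ u hu b₁ b₂ a x y hb₁ hb₂ ha hx hy (hsub hPr hxb) (hsub hPr hyb) hax hay).mono
        fun u' hu' c _ => ?_
      rintro ⟨d, hd, hd₁, hd₂, hcd⟩
      exact ⟨d, hUb u' hu' d hd u' le_rfl ⟨hd₁, hd₂⟩, hcd⟩
    · exact (h₃ u hu b₁ b₂ a hb₁ hb₂ hb ha (hsub hPr hab)).mono fun u' hu' c _ hcb =>
        ⟨b₂, hbU.up hu', hcb⟩
    · refine (h₄ u hu b j a hb hj ha (hsub hPr hab)).mono fun u' hu' c _ => ?_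
      rintro ⟨d, hd, hDd, hcd⟩
      exact ⟨d, hUb u' hu' d hd u' le_rfl hDd, hcd⟩
  · intro u hu a ha
    have hwu := hv.trans hu
    obtain ⟨e, he, he'⟩ := empty_mem_finSet (hF.up hwu)
    exact h u hu e a T he ha (hTUs.up hwu) (.inl sub_refl) (empty_sub he')
  · intro u hu b₁ b₂ a x y hb₁ hb₂ ha hx hy hxb hyb hax hay
    have hwu := hv.trans hu
    obtain ⟨p, hp, hpx⟩ := frc_relF.1 hxb
    obtain ⟨q, hq, hqy⟩ := frc_relF.1 hyb
    -- P = {p, q} is built by two insertions into the empty set; p and q need not be distinct.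
    obtain ⟨e, he, he'⟩ := empty_mem_finSet (hF.up hwu)
    obtain ⟨P₁, hP₁, hP₁'⟩ := insert_mem_finSet (hF.up hwu) he (frc_sub (hrX.up hu) hp)
    obtain ⟨P, hP, hP'⟩ := insert_mem_finSet (hF.up hwu) hP₁ (frc_sub (hrX.up hu) hq)
    have hpP : u ⊩ p ∊ P :=
      (hP' u le_rfl p).2 (.inl ((hP₁' u le_rfl p).2 (.inr hp.dom_left.refl)))
    have hqP : u ⊩ q ∊ P := (hP' u le_rfl q).2 (.inr hq.dom_left.refl)
    obtain ⟨U, hU, hU'⟩ := (hUs u hwu).1 b₁ b₂ hb₁ hb₂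
    refine (h u hu P a U hP ha hU (.inr (.inl ⟨b₁, hb₁, b₂, hb₂, x, hx, y, hy, relF_intro hpx hpP,
      relF_intro hqy hqP, hax, hay, fun u' hu' d hd u'' hu'' hd' => ?_⟩)) ?_).mono
      fun u' hu' c _ => ?_
    · exact (hU'.2 u'' (hu'.trans hu'') d).2 ⟨hd.up hu'', hd'⟩
    · refine frc_subF.2 fun u' hu' z hz => ?_
      rcases (hP' u' hu' z).1 hz with hz | hz
      · rcases (hP₁' u' hu' z).1 hz with hz | hz
        exacts [(frc_isEmptyF.1 he' u' hu' z hz).elim, hz.symm.eq_mem (hp.up hu')]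
      · exact hz.symm.eq_mem (hq.up hu')
    · rintro ⟨d, hd, hcd⟩
      obtain ⟨hd, hd₁, hd₂⟩ := (hU'.2 u' hu' d).1 hd
      exact ⟨d, hd, hd₁, hd₂, hcd⟩
  · intro u hu b₁ b₂ a hb₁ hb₂ hb ha hab
    have hwu := hv.trans hu
    obtain ⟨p, hp, hpab⟩ := frc_relF.1 hab
    obtain ⟨P, hP, hP'⟩ := singleton_mem_finSet (hF.up hwu) (frc_sub (hrX.up hu) hp)
    obtain ⟨U, hU, hU'⟩ := (hUs u hwu).2.1 b₂ hb₂
    refine (h u hu P a U hP ha hU (.inr (.inr (.inl ⟨b₁, hb₁, b₂, hb₂, hb, relF_intro hpab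
      (frc_isPairF.1 hP').1, (hU'.2 u le_rfl b₂).2 ⟨hb₂, hb₂.dom_left.refl⟩⟩)))
      (singleton_sub hP' hp)).mono fun u' hu' c hc => ?_
    rintro ⟨d, hd, hcd⟩
    exact relF_congr hcd hc.dom_left.refl ((hU'.2 u' hu' d).1 hd).2
  · intro u hu b j a hb hj ha hab
    have hwu := hv.trans hu
    obtain ⟨p, hp, hpab⟩ := frc_relF.1 hab
    obtain ⟨P, hP, hP'⟩ := singleton_mem_finSet (hF.up hwu) (frc_sub (hrX.up hu) hp)
    have hj' := hJs u hwu b j hj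
    obtain ⟨U, hU, hU'⟩ := (hUs u hwu).2.2 b j hb hj'
    refine (h u hu P a U hP ha hU (.inr (.inr (.inr ⟨b, hb, j, hj', hj, relF_intro hpab
      (frc_isPairF.1 hP').1, fun u' hu' d hd u'' hu'' hd' => ?_⟩)))
      (singleton_sub hP' hp)).mono fun u' hu' c hc => ?_
    · exact (hU'.2 u'' (hu'.trans hu'') d).2 ⟨hd.up hu'', hd'⟩
    · rintro ⟨d, hd, hcd⟩
      obtain ⟨hd, hd'⟩ := (hU'.2 u' hu' d).1 hd
      exact ⟨d, hd, hd', hcd⟩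

/-- All quantifiers in a request are bounded by given sets, the one over indices j by Js, so
Restricted Separation applies to the set of triples (P,a,U). -/
theorem isSet_mapRequest {S le T le' J Js D F Us : M} (hS : Dom w S) (hle : Dom w le)
    (hT : Dom w T) (hle' : Dom w le') (hJ : Dom w J) (hJs : Dom w Js) (hD : Dom w D)
    (hF : Dom w F) (hUs : Dom w Us) :
    IsSet w fun v q => ∃ P, v ⊩ P ∊ F ∧ ∃ a, v ⊩ a ∊ S ∧ ∃ U, v ⊩ U ∊ Us ∧
      v ⊩ isTripleF q P a U ∧ MapRequest S le T le' J Js D v P a U := by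
  obtain ⟨Z, hZ, hZ'⟩ := isSet_triple hF hS hUs
  refine (isSet_restr (P := fun v _ q => ∃ P, v ⊩ P ∊ F ∧ ∃ a, v ⊩ a ∊ S ∧ ∃ U, v ⊩ U ∊ Us ∧
      v ⊩ isTripleF q P a U ∧ MapRequest S le T le' J Js D v P a U)
    ⟨form₂ fun _ q => bexF (par hF) fun P => bexF (par hS) fun a => bexF (par hUs) fun U =>
      isTripleF q P a U ⋏ (subF (par hT) U ⋎
        (bexF (par hT) fun b₁ => bexF (par hT) fun b₂ => bexF (par hS) fun x =>
          bexF (par hS) fun y => relF P x b₁ ⋏ relF P y b₂ ⋏ relF (par hle) a x ⋏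
          relF (par hle) a y ⋏ ballF (par hT) fun d =>
            (relF (par hle') d b₁ ⋏ relF (par hle') d b₂) ⟾ d ∊ U) ⋎
        (bexF (par hT) fun b₁ => bexF (par hT) fun b₂ => relF (par hle') b₁ b₂ ⋏ relF P a b₁ ⋏
          b₂ ∊ U) ⋎
        (bexF (par hT) fun b => bexF (par hJs) fun j => memFamF (par hJ) b j ⋏ relF P a b ⋏
          ballF (par hT) fun d => memFam₂F (par hD) b j d ⟾ d ∊ U)), by simp,
      fun _ _ _ _ _ _ => by simp [MapRequest]⟩ le_rfl hZ hZ).congr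
    fun v hv q => and_iff_right_of_imp ?_
  rintro ⟨P, hP, a, ha, U, hU, hq, -⟩
  exact (hZ' v hv q).2 ⟨P, hP, a, ha, U, hU, hq⟩

/-- Maps are the subsets of X = S × T that meet the requests, with the finite parts P ranging over
the set F of finitely enumerable subsets of X. -/
theorem maps_of_finitaryNID {ρ : Empty → M} (h : Sat w (finitaryNID : Fml Empty) ρ) :
    Sat w (formalTopologyMapsSetGenerated : Fml Empty) ρ := by
  refine sat_formalTopologyMapsSetGenerated.2 ?_
  intro w₁ hw S le I C T le' J D hS hle hI hC hT hle' hJ hD _ _ _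
  obtain ⟨X, hX, hX'⟩ := isSet_prod hS hT
  obtain ⟨F, hF⟩ := finSet_exists hX
  obtain ⟨Js, hJs, hJs'⟩ := exists_index_bound hJ
  obtain ⟨Us, hUs, hTUs, hUs'⟩ := requestTargets_exist hT hle' hD hJs
  have hmap : ∀ {v}, w₁ ≤ v → ∀ r, v ⊩ isFTopMapF S le I C T le' J D r ↔
      v ⊩ subF r X ∧ MeetsRequests v S I C F Us (MapRequest S le T le' J Js D) r :=
    fun hv r => frc_isFTopMapF_iff_meetsRequests hX' hF hJs' hTUs hUs' hv
  obtain ⟨G, hG, hG₁, hG₂⟩ := setGenerated_meetsRequests (h.up hw) hS hI hC hUs hF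
    (isSet_mapRequest hS hle hT hle' hJ hJs hD hF.2.1 hUs)
  exact ⟨G, hG, fun v hv r hr => (hmap hv r).2 (hG₁ v hv r hr),
    fun v hv r hrd hr => hG₂ v hv r hrd ((hmap hv r).1 hr)⟩

end model
end CST

/-! ### The equivalence, by completeness and the two forced implications -/

theorem mainTheorem4 :
    CST.EquivalentOver CST.ECST_FPA CST.finitaryNID CST.formalTopologyMapsSetGenerated :=
  CST.derives_of_forall_sat CST.ECST_FPA_stable fun W M _ hM _ _ =>
    letI : CST.SetModel W M := { ‹CST.Kripke W M› with models := hM }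
    (CST.sat_iff _ _).2 fun _ _ => ⟨CST.maps_of_finitaryNID, CST.finitaryNID_of_maps⟩
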